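/- Let $[a,b]\subset\mathbb R$ be a compact interval and let $(\Lambda_n)_{n\ge 0}$ be a recurrent Harris chain on $[a,b]$ with transition kernel $g$. That is, there are Borel sets $B,C\subseteq[a,b]$, a number $\varepsilon>0$ and a probability measure $\nu_0$ carried by $C$ such that every starting state reaches $B$ with positive probability, $g(x,D)\ge\varepsilon\,\nu_0(D)$ for all $x\in B$ and all Borel $D\subseteq C$, and the chain started from $\nu_0$ almost surely visits $B$ infinitely often. Assume that the chain has a spectral gap: there is $r<1$ such that the spectrum of $Pf(x)=\int f(y)\,g(x,dy)$ on the space of bounded measurable functions on $[a,b]$ with the supremum norm lies in $\{|z|\le r\}$, except for the eigenvalue $1$ and finitely many other eigenvalues on the unit circle, each of finite algebraic multiplicity. Let $\rho_s$ be the stationary probability measure. Let $(F_\lambda)_{\lambda\in[a,b]}$ be a measurable family of distribution functions on $[0,\infty)$ such that * every $F_\lambda$ is non-arithmetic, i.e. not concentrated on $d\mathbb Z$ for any $d>0$; * $\sup_\lambda F_\lambda(\delta)<1$ for some $\delta>0$; * $\inf_\lambda F_\lambda(K)>0$ for some $K<\infty$. Let $\mu_\lambda=\int_0^\infty x\,dF_\lambda(x)\in[0,\infty]$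 and $\mu_{\rho_s}=\int_a^b\mu_\lambda\,d\rho_s(\lambda)$. Given a realization $(\lambda_n)$ of the chain, let $X_0,X_1,\dots$ be independent, $X_n$ having distribution function $F_{\lambda_n}$. Put $S_0=0$, $S_n=X_0+\dots+X_{n-1}$, $N_t=\inf\{n:S_n>t\}$, $\Lambda(t)=\Lambda_{N_t-1}$, and $\Phi_{t,\lambda_0}(A)=\mathbb P(\Lambda(t)\in A\mid\Lambda_0=\lambda_0)$. The family is of *scaled type* if $a>0$ and $F_\lambda(t)=F(\lambda t)$ for all $\lambda\in[a,b]$, $t\ge 0$, for some distribution function $F$ on $[0,\infty)$. **Theorem.** Let $A\subseteq[a,b]$ be a Borel set with $\rho_s(A)>0$. Then, for every $\lambda_0\in[a,b]$: 1. If $\mu_{\rho_s}<\infty$ and no $F_\lambda$ is concentrated on an arithmetic progression $c+d\mathbb Z$ ($c\in\mathbb R$, $d>0$), then $$\lim_{t\to\infty}\Phi_{t,\lambda_0}(A)=\frac1{\mu_{\rho_s}}\int_A\mu_\lambda\,d\rho_s(\lambda).$$ 2. In the scaled type case with $\int_0^\infty x\,dF(x)<\infty$, $$\lim_{t\to\infty}\Phi_{t,\lambda_0}(A)=\frac{\int_A\lambda^{-1}\,d\rho_s(\lambda)}{\int_a^b\lambda^{-1}\,d\rho_s(\lambda)}.$$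 3. In the scaled type case with $1-F(t)=t^{-\alpha}L(t)$ for all $t>0$, where $\alpha\in[0,1]$ and $L$ is a positive function on $[0,\infty)$ that is slowly varying at infinity ($L(ct)/L(t)\to1$ as $t\to\infty$ for every $c>0$), $$\lim_{t\to\infty}\Phi_{t,\lambda_0}(A)=\frac{\int_A\lambda^{-\alpha}\,d\rho_s(\lambda)}{\int_a^b\lambda^{-\alpha}\,d\rho_s(\lambda)}.$$ In particular, the limit is $\rho_s(A)$ when $\alpha=0$. -/

import Mathlib

open MeasureTheory ProbabilityTheory Filter Topology Set
open scoped ENNReal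

noncomputable section

namespace MarkovRenewal

variable {S : Type*} [MeasurableSpace S]

/-! ### The Markov chain of types -/

/-- The law on `S^ℕ` of the homogeneous Markov chain `Λ₀, Λ₁, …` with transition kernel `g` and
initial distribution `μ₀`. -/
def chainLaw (g : Kernel S S) [IsMarkovKernel g] (μ₀ : Measure S) [IsProbabilityMeasure μ₀] :
    Measure (ℕ → S) :=
  Kernel.trajMeasure (X := fun _ => S) μ₀
    (fun n => g.comap (fun h : (Finset.Iic n → S) => h ⟨n, Finset.mem_Iic.2 le_rfl⟩)
      (measurable_pi_apply _))

instance chainLaw_isProb (g : Kernel S S) [IsMarkovKernel g] (μ₀ : Measure S) [IsProbabilityMeasure μ₀] :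
    IsProbabilityMeasure (chainLaw g μ₀) := by
  unfold chainLaw; infer_instance

/-- Recurrent Harris chain: there are sets `B`, `C`, a constant `ε > 0` and a probability measure
`ν` carried by `C` such that
* from every state, `B` is reached with positive probability;
* `g x D ≥ ε ν D` for all `x ∈ B` and measurable `D ⊆ C` (so that, with probability `ε`, a step
  from `B` is a step to a `ν`-distributed state: a regeneration);
* the regeneration is recurrent: started from `ν`, the chain visits `B` infinitely often, a.s. -/
def IsRecurrentHarris (g : Kernel S S) [IsMarkovKernel g] : Prop :=
  ∃ (B C : Set S) (ε : ℝ≥0∞) (ν : Measure S) (_ : IsProbabilityMeasure ν),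
    MeasurableSet B ∧ MeasurableSet C ∧ 0 < ε ∧ ν Cᶜ = 0 ∧
    (∀ z : S, 0 < chainLaw g (Measure.dirac z) {ω | ∃ n, ω n ∈ B}) ∧
    (∀ x ∈ B, ∀ D ⊆ C, MeasurableSet D → ε * ν D ≤ g x D) ∧
    chainLaw g ν {ω | ∃ᶠ n in atTop, ω n ∈ B} = 1

/-- The space `L_∞(S)` of bounded measurable complex functions on `S` (functions, not classes of
functions), with the supremum norm. -/
def bddMeas (S : Type*) [MeasurableSpace S] : Submodule ℂ (lp (fun _ : S => ℂ) ∞) where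
  carrier := {f | Measurable (f : S → ℂ)}
  add_mem' := by
    intro f g hf hg
    simp only [Set.mem_ofPred_eq, lp.coeFn_add] at *
    exact hf.add hg
  zero_mem' := by
    simp only [Set.mem_ofPred_eq, lp.coeFn_zero]
    exact measurable_const
  smul_mem' := by
    intro c f hf
    simp only [Set.mem_ofPred_eq, lp.coeFn_smul] at *
    exact hf.const_smul c

lemma bddMeas_measurable (f : bddMeas S) : Measurable (f.1 : S → ℂ) := f.2

lemma bddMeas_norm_le (f : bddMeas S) (x : S) : ‖f.1 x‖ ≤ ‖f‖ :=
  lp.norm_apply_le_norm ENNReal.top_ne_zero f.1 x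

lemma bddMeas_integrable (f : bddMeas S) (μ : Measure S) [IsFiniteMeasure μ] :
    Integrable (fun y => f.1 y) μ :=
  Integrable.of_bound (bddMeas_measurable f).aestronglyMeasurable ‖f‖
    (Eventually.of_forall (bddMeas_norm_le f))

lemma norm_integral_bddMeas_le (f : bddMeas S) (μ : Measure S) [IsProbabilityMeasure μ] :
    ‖∫ y, f.1 y ∂μ‖ ≤ ‖f‖ := by
  have h := norm_integral_le_of_norm_le_const (μ := μ) (f := fun y => f.1 y) (C := ‖f‖)
    (Eventually.of_forall (bddMeas_norm_le f))
  simpa using h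

/-- The transition operator `(P f)(x) = ∫ f(y) g(x, dy)` on bounded measurable functions. -/
def transitionOp (g : Kernel S S) [IsMarkovKernel g] : bddMeas S →L[ℂ] bddMeas S :=
  LinearMap.mkContinuous
    { toFun := fun f =>
        ⟨⟨fun x => ∫ y, f.1 y ∂(g x),
          memℓp_infty ⟨‖f‖, by rintro _ ⟨x, rfl⟩; exact norm_integral_bddMeas_le f (g x)⟩⟩,
          ((bddMeas_measurable f).stronglyMeasurable.integral_kernel).measurable⟩
      map_add' := by
        intro f h
        ext x
        exact integral_add (bddMeas_integrable f (g x)) (bddMeas_integrable h (g x))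
      map_smul' := by
        intro c f
        ext x
        exact integral_const_mul c (fun y => f.1 y) }
    1 (by
      intro f
      rw [one_mul]
      exact lp.norm_le_of_forall_le (norm_nonneg f)
        (fun x => norm_integral_bddMeas_le f (g x)))

lemma transitionOp_apply (g : Kernel S S) [IsMarkovKernel g] (f : bddMeas S) (x : S) :
    (transitionOp g f).1 x = ∫ y, f.1 y ∂(g x) := rfl

/-- `z` is an eigenvalue of `T` of finite algebraic multiplicity: for some `k ≥ 1`, the space
`ker (T - z)^k` is (nonzero,) finite dimensional, and complemented by the range of `(T - z)^k`. -/
def IsFiniteMultEigenvalue {V : Type*} [AddCommGroup V] [Module ℂ V] (T : Module.End ℂ V)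
    (z : ℂ) : Prop :=
  T.HasEigenvalue z ∧ ∃ k : ℕ, 0 < k ∧
    FiniteDimensional ℂ (LinearMap.ker ((T - algebraMap ℂ (Module.End ℂ V) z) ^ k)) ∧
    IsCompl (LinearMap.ker ((T - algebraMap ℂ (Module.End ℂ V) z) ^ k))
      (LinearMap.range ((T - algebraMap ℂ (Module.End ℂ V) z) ^ k))

/-- Spectral gap: the spectrum of the transition operator on `L_∞(S)` lies in a disc of radius
`r < 1`, except for finitely many eigenvalues (of finite multiplicity) on the unit circle. The
number `1` is always one of these. -/
def HasSpectralGap (g : Kernel S S) [IsMarkovKernel g] : Prop :=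
  ∃ r : ℝ, r < 1 ∧ ∃ E : Finset ℂ,
    (∀ z ∈ E, ‖z‖ = 1 ∧
      IsFiniteMultEigenvalue (transitionOp g : bddMeas S →ₗ[ℂ] bddMeas S) z) ∧
    ∀ z ∈ spectrum ℂ (transitionOp g), ‖z‖ ≤ r ∨ z ∈ E

/-! ### The distributions of the waiting times

The family `F_λ` is given by a kernel `κ` from the types to `ℝ`: `κ λ` is the distribution with
distribution function `F_λ`, so `F_λ(t) = cdf (κ λ) t`. -/

/-- `μ` is concentrated on the multiples of some `d > 0`. -/
def IsArithmetic (μ : Measure ℝ) : Prop :=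
  ∃ d : ℝ, 0 < d ∧ ∀ᵐ x ∂μ, ∃ k : ℤ, x = k * d

/-- `μ` is concentrated on some arithmetic progression `c + dℤ`, `d > 0`. -/
def IsLattice (μ : Measure ℝ) : Prop :=
  ∃ c d : ℝ, 0 < d ∧ ∀ᵐ x ∂μ, ∃ k : ℤ, x = c + k * d

/-- The basic assumptions on the waiting time distributions. -/
structure BasicAssumptions (κ : Kernel S ℝ) : Prop where
  nonneg : ∀ l, ∀ᵐ x ∂(κ l), 0 ≤ x
  nonarithmetic : ∀ l, ¬ IsArithmetic (κ l)
  not_small : ∃ δ : ℝ, 0 < δ ∧ ∃ c : ℝ, c < 1 ∧ ∀ l, cdf (κ l) δ ≤ c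
  not_large : ∃ K : ℝ, 0 ≤ K ∧ ∃ c : ℝ, 0 < c ∧ ∀ l, c ≤ cdf (κ l) K

/-- The mean `μ_λ ∈ [0, ∞]` of the waiting time of type `λ`. -/
def meanWait (κ : Kernel S ℝ) (l : S) : ℝ≥0∞ := ∫⁻ x, ENNReal.ofReal x ∂(κ l)

/-- Scaled type: the types lie in `[a, b]` with `a > 0`, and `F_λ(t) = F(λ t)` for a distribution
function `F` on `[0, ∞)`, namely that of `ν`. -/
structure IsScaledType {a b : ℝ} (κ : Kernel (Icc a b) ℝ) (ν : Measure ℝ) : Prop where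
  pos : 0 < a
  nonneg : ∀ᵐ x ∂ν, 0 ≤ x
  scaled : ∀ (l : Icc a b) (t : ℝ), 0 ≤ t → cdf (κ l) t = cdf ν (l * t)

/-- Positive function on `[0, ∞)`, slowly varying at infinity. -/
def SlowlyVarying (L : ℝ → ℝ) : Prop :=
  (∀ t, 0 ≤ t → 0 < L t) ∧ ∀ c, 0 < c → Tendsto (fun t => L (c * t) / L t) atTop (𝓝 1)

/-! ### The Markov renewal process -/

lemma measurable_infinitePi (κ : Kernel S ℝ) [IsMarkovKernel κ] :
    Measurable (fun l : ℕ → S => Measure.infinitePi (fun j => κ (l j))) := by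
  refine Measurable.measure_of_isPiSystem_of_isProbabilityMeasure
    (generateFrom_squareCylinders (α := fun _ : ℕ => ℝ)).symm
    (isPiSystem_squareCylinders (fun _ => MeasurableSpace.isPiSystem_measurableSet) (by simp)) ?_
  rintro _ ⟨s, t, ht, rfl⟩
  have ht' : ∀ i, MeasurableSet (t i) := fun i => ht i (Set.mem_univ i)
  have h : ∀ l : ℕ → S, Measure.infinitePi (fun j => κ (l j)) ((s : Set ℕ).pi t)
      = ∏ i ∈ s, κ (l i) (t i) := fun l => Measure.infinitePi_pi _ (fun i _ => ht' i)
  simp only [h]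
  exact Finset.measurable_prod _ fun i _ =>
    (Kernel.measurable_coe κ (ht' i)).comp (measurable_pi_apply i)

/-- Given the realization `λ₀, λ₁, …` of the chain, the waiting times `X₀, X₁, …` are independent,
`X_j` having distribution function `F_{λ_j}`. -/
def waitKernel (κ : Kernel S ℝ) [IsMarkovKernel κ] : Kernel (ℕ → S) (ℕ → ℝ) where
  toFun l := Measure.infinitePi (fun j => κ (l j))
  measurable' := measurable_infinitePi κ

instance waitKernel_isMarkov (κ : Kernel S ℝ) [IsMarkovKernel κ] : IsMarkovKernel (waitKernel κ) :=
  ⟨fun l => inferInstanceAs (IsProbabilityMeasure (Measure.infinitePi (fun j => κ (l j))))⟩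

/-- The joint law of the types `(Λ_n)` and the waiting times `(X_n)`, given `Λ₀ = λ₀`. -/
def renewalLaw (g : Kernel S S) [IsMarkovKernel g] (κ : Kernel S ℝ) [IsMarkovKernel κ]
    (l₀ : S) : Measure ((ℕ → S) × (ℕ → ℝ)) :=
  chainLaw g (Measure.dirac l₀) ⊗ₘ waitKernel κ

instance renewalLaw_isProb (g : Kernel S S) [IsMarkovKernel g] (κ : Kernel S ℝ) [IsMarkovKernel κ] (l₀ : S) :
    IsProbabilityMeasure (renewalLaw g κ l₀) := by
  unfold renewalLaw; infer_instance

/-- `N_t = inf {n : S_n > t}` with `S_n = X₀ + ⋯ + X_{n-1}`. -/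
def renewalCount (x : ℕ → ℝ) (t : ℝ) : ℕ := sInf {n | t < ∑ j ∈ Finset.range n, x j}

/-- The current type `Λ(t) = Λ_{N_t - 1}`. -/
def currentType (t : ℝ) (ω : (ℕ → S) × (ℕ → ℝ)) : S := ω.1 (renewalCount ω.2 t - 1)

/-- `Φ_{t,λ₀}(A) = ℙ(Λ(t) ∈ A | Λ₀ = λ₀)`. -/
def currentTypeProb (g : Kernel S S) [IsMarkovKernel g] (κ : Kernel S ℝ) [IsMarkovKernel κ]
    (t : ℝ) (l₀ : S) (A : Set S) : ℝ :=
  (renewalLaw g κ l₀).real {ω | currentType t ω ∈ A}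

end MarkovRenewal

end

/-!
The pair of the current type and the remaining time `t - Sₙ` moves on `S × ℝ` by the kernel
`stepKernel g κ`, whose potential (the sum of its powers) is denoted by `U` here. At time `t ≥ 0`,
the type `Λ(t)` lies in `A` if and only if, at some step, the type is in `A`, the remaining time is
nonnegative, and the waiting time exceeds it. So `Φ_{t,λ₀}(A)` is the potential
`U f_A (λ₀, t)` of the function `f_A (l, s) = 1_A(l) 1_{s ≥ 0} (1 - F_l(s))`
(`BasicAssumptions.renewalLaw_currentType`). The limit theorems are statements about the asymptotic
behaviour of such potentials.

*Regeneration.* The minorization condition splits `g = k + 1_B e ν` into a part without and a part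
with regeneration (`Regeneration`). Decomposing `U` at the first and at the last regeneration turns
the problem into an ordinary renewal equation on `ℝ`, for the law of the length of a cycle
(`Regeneration.avg_potential_eq`). This needs that the chain regenerates almost surely from every
state, not only from almost every one. The probability never to regenerate is a bounded harmonic
function, and bounded harmonic functions are constant: a stationary martingale does not move, so
such a function is constant after regenerations, and a supremum above this constant is not attained.
In that case the sets where the function is close to its supremum decrease to the empty set, while
chains started deep inside remain there most of the time; since the invariant functions form a
finite-dimensional space complemented by the range of `P - 1`, this is impossible
(`Regeneration.le_zero_of_harmonic`). For the same reason the Poisson equation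
`c - ρ(c) = h - P h` has bounded solutions (`Regeneration.exists_poisson`).

*The renewal theorem.* A bounded uniformly continuous function that asymptotically equals its
convolution with a non-arithmetic law on `[0, ∞)` is asymptotically invariant under translations
(`tendsto_shift_sub`). Applied to a smoothed renewal density, this yields the key renewal theorem
for superpositions of hat functions, with the occupation measure of a cycle proportional to `ρ`
(`RenewalSetting.exists_isDensity`). The value of the density need not be known. If the stationary
mean is finite, the comparison of `f_A` from above and of `f_S` (whose potential is `1`) from below
with such superpositions gives the upper bound for `Φ_t(A)`; the upper bound for the complement of
`A` is the matching lower bound (`RenewalSetting.tendsto_avgSurvival`).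

*Infinite mean.* Then the density tends to zero, and only large remaining times matter. If the tail
of type `l` is asymptotically `p l * T` for a common subexponential tail `T`, the Poisson equation
shows that `U (c ⊗ T) - ρ(c) U (1 ⊗ T)` tends to zero for bounded `c`, and dividing the case
`c = 1_A p` by the case `c = p` gives the limit
(`RenewalSetting.tendsto_currentTypeProb_of_isReferenceTail`). In the scaled type case with a
regularly varying tail, `p l = l ^ (-α)` by the uniform convergence theorem. If the mean of `F` is
finite, then `α = 1`, and the limit agrees with that of the finite mean case.

*Lattices.* The law of the length of a cycle must not be arithmetic. This is immediate if no `F_l`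
is concentrated on an arithmetic progression, because the last waiting time of a cycle is
independent of the others. In the scaled type case, `F` itself may be concentrated on a progression
`y + d₀ ℤ`; following a path to a regeneration along which the remaining times stay in the right
classes shows that a positive integer multiple of `y` is a multiple of `d₀`, so that `F` would be
arithmetic (`Regeneration.not_isArithmetic_cycleLaw_of_scaled`).
-/

namespace MarkovRenewal

section

/-! ### Potential kernels -/

/-- Expansion of a power of a sum according to the rightmost factor `y`. -/
lemma add_pow_succ_eq_antidiagonal {R : Type*} [Semiring R] (x y : R) (n : ℕ) :
    (x + y) ^ (n + 1) = x ^ (n + 1) +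
      ∑ p ∈ Finset.HasAntidiagonal.antidiagonal n, (x + y) ^ p.1 * y * x ^ p.2 := by
  induction n with
  | zero => simp
  | succ n ih =>
    rw [pow_succ, mul_add, Finset.Nat.sum_antidiagonal_succ']
    nth_rw 1 [ih]
    simp only [add_mul, Finset.sum_mul, pow_succ x, pow_zero, mul_one, mul_assoc]
    abel

/-- Expansion of a power of a sum according to the leftmost factor `y`. -/
lemma add_pow_succ_eq_antidiagonal' {R : Type*} [Semiring R] (x y : R) (n : ℕ) :
    (x + y) ^ (n + 1) = x ^ (n + 1) +
      ∑ p ∈ Finset.HasAntidiagonal.antidiagonal n, x ^ p.1 * y * (x + y) ^ p.2 := by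
  induction n with
  | zero => simp
  | succ n ih =>
    rw [pow_succ', add_mul, Finset.Nat.sum_antidiagonal_succ]
    nth_rw 1 [ih]
    simp only [mul_add, Finset.mul_sum, pow_succ' x, pow_zero, one_mul, mul_assoc]
    abel

variable {E : Type*} [MeasurableSpace E]

/-- Kernels on a space form a semiring under addition and composition. -/
noncomputable abbrev kernelSemiring : Semiring (Kernel E E) where
  __ := (inferInstance : AddCommMonoid (Kernel E E))
  __ := (inferInstance : Monoid (Kernel E E))
  left_distrib a b c := Kernel.comp_add_right b c a
  right_distrib a b c := Kernel.comp_add_left c a b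
  zero_mul a := Kernel.zero_comp a
  mul_zero a := Kernel.comp_zero a

/-- The potential kernel `∑ₙ Kⁿ` of a kernel `K`. -/
noncomputable def potential (K : Kernel E E) : Kernel E E := Kernel.sum fun n => K ^ n

lemma potential_apply (K : Kernel E E) (x : E) {s : Set E} (hs : MeasurableSet s) :
    potential K x s = ∑' n, (K ^ n) x s := Kernel.sum_apply' _ x hs

lemma lintegral_potential (K : Kernel E E) (x : E) (f : E → ℝ≥0∞) :
    ∫⁻ y, f y ∂(potential K x) = ∑' n, ∫⁻ y, f y ∂((K ^ n) x) := by
  rw [potential, Kernel.sum_apply, lintegral_sum_measure]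

lemma potential_comp_comp_apply (K₀ K₁ K : Kernel E E) (x : E) {s : Set E} (hs : MeasurableSet s) :
    (potential K₀ ∘ₖ K₁ ∘ₖ potential K) x s
      = ∑' i : ℕ, ∑' j : ℕ, ((K₀ ^ i) ∘ₖ K₁ ∘ₖ (K ^ j)) x s := by
  have h : potential K₀ ∘ₖ K₁ ∘ₖ potential K
      = Kernel.sum fun i => Kernel.sum fun j => ((K₀ ^ i) ∘ₖ K₁ ∘ₖ (K ^ j)) := by
    simp only [potential, Kernel.comp_sum_left, Kernel.comp_sum_right]
    exact Kernel.sum_comm _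
  rw [h, Kernel.sum_apply' _ _ hs]
  exact tsum_congr fun i => Kernel.sum_apply' _ _ hs

lemma potential_eq_of_pow_succ {K K₀ A C D : Kernel E E}
    (h : ∀ n, K ^ (n + 1) = K₀ ^ (n + 1) +
      ∑ p ∈ Finset.HasAntidiagonal.antidiagonal n, ((A ^ p.1) ∘ₖ C ∘ₖ (D ^ p.2))) :
    potential K = potential K₀ + potential A ∘ₖ C ∘ₖ potential D := by
  ext x s hs
  rw [_root_.add_apply, Measure.add_apply, potential_comp_comp_apply _ _ _ _ hs,
    potential_apply _ _ hs, potential_apply _ _ hs, tsum_eq_zero_add' ENNReal.summable,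
    tsum_eq_zero_add' (f := fun n => (K₀ ^ n) x s) ENNReal.summable, pow_zero, pow_zero, add_assoc]
  congr 1
  have : ∀ n, (K ^ (n + 1)) x s = (K₀ ^ (n + 1)) x s +
      ∑ p ∈ Finset.HasAntidiagonal.antidiagonal n, ((A ^ p.1) ∘ₖ C ∘ₖ (D ^ p.2)) x s := by
    intro n
    rw [h n, _root_.add_apply, Measure.add_apply, Kernel.finsetSum_apply']
  simp_rw [this]
  rw [ENNReal.tsum_add]
  congr 1
  rw [← ENNReal.tsum_prod,
    ← (Finset.HasAntidiagonal.sigmaAntidiagonalEquivProd (A := ℕ)).tsum_eq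
      (fun p : ℕ × ℕ => ((A ^ p.1) ∘ₖ C ∘ₖ (D ^ p.2)) x s), ENNReal.tsum_sigma']
  refine tsum_congr fun n => ?_
  rw [← Finset.tsum_subtype]
  rfl

/-- Resolvent identity, splitting at the first use of `K₁`; the kernel on the right acts first. -/
lemma potential_add (K₀ K₁ : Kernel E E) :
    potential (K₀ + K₁) = potential K₀ + potential (K₀ + K₁) ∘ₖ K₁ ∘ₖ potential K₀ :=
  potential_eq_of_pow_succ fun n =>
    letI := kernelSemiring (E := E)
    add_pow_succ_eq_antidiagonal K₀ K₁ n

/-- Resolvent identity, splitting at the last use of `K₁`. -/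
lemma potential_add' (K₀ K₁ : Kernel E E) :
    potential (K₀ + K₁) = potential K₀ + potential K₀ ∘ₖ K₁ ∘ₖ potential (K₀ + K₁) :=
  potential_eq_of_pow_succ fun n =>
    letI := kernelSemiring (E := E)
    add_pow_succ_eq_antidiagonal' K₀ K₁ n

lemma lintegral_pow_succ (K : Kernel E E) (n : ℕ) (x : E) {f : E → ℝ≥0∞} (hf : Measurable f) :
    ∫⁻ y, f y ∂((K ^ (n + 1)) x) = ∫⁻ y, ∫⁻ z, f z ∂((K ^ n) y) ∂(K x) := by
  rw [pow_succ]
  exact Kernel.lintegral_comp _ _ _ hf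

lemma lintegral_pow_succ' (K : Kernel E E) (n : ℕ) (x : E) {f : E → ℝ≥0∞} (hf : Measurable f) :
    ∫⁻ y, f y ∂((K ^ (n + 1)) x) = ∫⁻ y, ∫⁻ z, f z ∂(K y) ∂((K ^ n) x) := by
  rw [pow_succ']
  exact Kernel.lintegral_comp _ _ _ hf

lemma lintegral_pow_zero (K : Kernel E E) (x : E) {f : E → ℝ≥0∞} (hf : Measurable f) :
    ∫⁻ y, f y ∂((K ^ 0) x) = f x := by
  rw [pow_zero]
  exact Kernel.lintegral_id' hf x

/-- The potential solves the Poisson equation `Uf = f + KUf`. -/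
lemma lintegral_potential_eq_add (K : Kernel E E) (x : E) {f : E → ℝ≥0∞} (hf : Measurable f) :
    ∫⁻ y, f y ∂(potential K x) = f x + ∫⁻ y, ∫⁻ z, f z ∂(potential K y) ∂(K x) := by
  simp_rw [lintegral_potential]
  rw [tsum_eq_zero_add' ENNReal.summable, lintegral_pow_zero K x hf,
    lintegral_tsum fun n => (hf.lintegral_kernel (κ := K ^ n)).aemeasurable]
  simp_rw [lintegral_pow_succ K _ x hf]

/-- The potential solves the adjoint Poisson equation `Uf = f + U(Kf)`. -/
lemma lintegral_potential_eq_add' (K : Kernel E E) (x : E) {f : E → ℝ≥0∞} (hf : Measurable f) :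
    ∫⁻ y, f y ∂(potential K x) = f x + ∫⁻ y, ∫⁻ z, f z ∂(K y) ∂(potential K x) := by
  simp_rw [lintegral_potential]
  rw [tsum_eq_zero_add' ENNReal.summable, lintegral_pow_zero K x hf]
  simp_rw [lintegral_pow_succ' K _ x hf]

end

section

variable {S : Type*} [MeasurableSpace S]

/-! ### The walk of types and remaining times -/

/-- The kernel on `S × ℝ` that moves the type `l` by `k` and, independently, lowers the remaining
time `t` by a waiting time with law `κ l`. -/
noncomputable def stepKernel (k : Kernel S S) (κ : Kernel S ℝ) : Kernel (S × ℝ) (S × ℝ) :=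
  (k.comap Prod.fst measurable_fst) ×ₖ
    (((κ.comap Prod.fst measurable_fst) ×ₖ (Kernel.deterministic Prod.snd measurable_snd)).map
      fun p => p.2 - p.1)

instance (k : Kernel S S) [IsFiniteKernel k] (κ : Kernel S ℝ) [IsFiniteKernel κ] :
    IsFiniteKernel (stepKernel k κ) := by
  unfold stepKernel; infer_instance

lemma lintegral_stepKernel (k : Kernel S S) [IsFiniteKernel k] (κ : Kernel S ℝ) [IsFiniteKernel κ]
    (p : S × ℝ) {f : S × ℝ → ℝ≥0∞} (hf : Measurable f) :
    ∫⁻ y, f y ∂(stepKernel k κ p) = ∫⁻ x, ∫⁻ l, f (l, p.2 - x) ∂(k p.1) ∂(κ p.1) := by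
  unfold stepKernel
  rw [Kernel.lintegral_prod _ _ _ hf,
    lintegral_lintegral_swap (f := fun l y => f (l, y)) hf.aemeasurable]
  have h1 : Measurable fun y : ℝ => ∫⁻ l, f (l, y) ∂(k p.1) :=
    Measurable.lintegral_prod_left' hf
  simp only [Kernel.comap_apply]
  rw [Kernel.map_apply _ (by fun_prop), lintegral_map h1 (by fun_prop),
    Kernel.lintegral_prod _ _ _ (by fun_prop)]
  simp only [Kernel.comap_apply]
  refine lintegral_congr fun x => ?_
  rw [Kernel.lintegral_deterministic' _ (by fun_prop)]

lemma stepKernel_add (k₀ k₁ : Kernel S S) [IsFiniteKernel k₀] [IsFiniteKernel k₁]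
    (κ : Kernel S ℝ) [IsFiniteKernel κ] :
    stepKernel (k₀ + k₁) κ = stepKernel k₀ κ + stepKernel k₁ κ := by
  refine Kernel.ext_fun fun p f hf => ?_
  rw [_root_.add_apply, lintegral_add_measure, lintegral_stepKernel _ _ _ hf,
    lintegral_stepKernel _ _ _ hf, lintegral_stepKernel _ _ _ hf, ← lintegral_add_left]
  · simp [_root_.add_apply, lintegral_add_measure]
  · exact Measurable.lintegral_prod_left' (f := fun q : S × ℝ => f (q.1, p.2 - q.2))
      (hf.comp (by fun_prop))

/-- A kernel on `S × ℝ` is equivariant under translations of the second coordinate. -/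
def IsEquivariant (K : Kernel (S × ℝ) (S × ℝ)) : Prop :=
  ∀ (l : S) (t s : ℝ) (f : S × ℝ → ℝ≥0∞), Measurable f →
    ∫⁻ y, f y ∂(K (l, t + s)) = ∫⁻ y, f (y.1, y.2 + s) ∂(K (l, t))

lemma IsEquivariant.comp {K L : Kernel (S × ℝ) (S × ℝ)} (hK : IsEquivariant K)
    (hL : IsEquivariant L) : IsEquivariant (K ∘ₖ L) := by
  intro l t s f hf
  rw [Kernel.lintegral_comp _ _ _ hf,
    Kernel.lintegral_comp _ _ _ (g := fun y : S × ℝ => f (y.1, y.2 + s)) (by fun_prop),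
    hL l t s _ hf.lintegral_kernel]
  exact lintegral_congr fun y => hK _ _ _ f hf

lemma IsEquivariant.pow {K : Kernel (S × ℝ) (S × ℝ)} (hK : IsEquivariant K) (n : ℕ) :
    IsEquivariant (K ^ n) := by
  induction n with
  | zero =>
    intro l t s f hf
    rw [lintegral_pow_zero _ _ hf,
      lintegral_pow_zero _ _ (f := fun y : S × ℝ => f (y.1, y.2 + s)) (by fun_prop)]
  | succ n ih => rw [pow_succ]; exact ih.comp hK

lemma IsEquivariant.potential {K : Kernel (S × ℝ) (S × ℝ)} (hK : IsEquivariant K) :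
    IsEquivariant (potential K) := by
  intro l t s f hf
  rw [lintegral_potential, lintegral_potential]
  exact tsum_congr fun n => hK.pow n l t s f hf

lemma isEquivariant_stepKernel (k : Kernel S S) [IsFiniteKernel k] (κ : Kernel S ℝ)
    [IsFiniteKernel κ] : IsEquivariant (stepKernel k κ) := by
  intro l t s f hf
  rw [lintegral_stepKernel _ _ _ hf,
    lintegral_stepKernel _ _ _ (f := fun y : S × ℝ => f (y.1, y.2 + s)) (by fun_prop)]
  simp only [add_sub_right_comm]

/-- The law of the time elapsed under an equivariant kernel. -/
noncomputable def elapsed (K : Kernel (S × ℝ) (S × ℝ)) : Kernel S ℝ :=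
  (K.comap (fun l : S => (l, (0 : ℝ))) (by fun_prop)).map fun y => -y.2

lemma lintegral_elapsed (K : Kernel (S × ℝ) (S × ℝ)) (l : S) {w : ℝ → ℝ≥0∞}
    (hw : Measurable w) :
    ∫⁻ x, w x ∂(elapsed K l) = ∫⁻ y, w (-y.2) ∂(K (l, 0)) := by
  rw [elapsed, Kernel.map_apply _ (by fun_prop), lintegral_map hw (by fun_prop),
    Kernel.comap_apply]

lemma IsEquivariant.lintegral_snd {K : Kernel (S × ℝ) (S × ℝ)} (hK : IsEquivariant K) (l : S)
    (t : ℝ) {w : ℝ → ℝ≥0∞} (hw : Measurable w) :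
    ∫⁻ y, w y.2 ∂(K (l, t)) = ∫⁻ x, w (t - x) ∂(elapsed K l) := by
  rw [lintegral_elapsed K l (w := fun x => w (t - x)) (by fun_prop)]
  have h := hK l 0 t (fun y => w y.2) (hw.comp measurable_snd)
  rw [zero_add] at h
  rw [h]
  refine lintegral_congr fun y => ?_
  simp [add_comm]

lemma lintegral_fst_stepKernel_pow (k : Kernel S S) [IsFiniteKernel k] (κ : Kernel S ℝ)
    [IsMarkovKernel κ] (n : ℕ) (l : S) (t : ℝ) {c : S → ℝ≥0∞} (hc : Measurable c) :
    ∫⁻ y, c y.1 ∂((stepKernel k κ ^ n) (l, t)) = ∫⁻ x, c x ∂((k ^ n) l) := by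
  induction n generalizing l t with
  | zero =>
    rw [lintegral_pow_zero _ _ (f := fun y : S × ℝ => c y.1) (by fun_prop),
      lintegral_pow_zero _ _ hc]
  | succ n ih =>
    rw [lintegral_pow_succ _ _ _ (f := fun y : S × ℝ => c y.1) (by fun_prop),
      lintegral_pow_succ _ _ _ hc]
    simp_rw [show ∀ y : S × ℝ, ∫⁻ z, c z.1 ∂((stepKernel k κ ^ n) y) = ∫⁻ x, c x ∂((k ^ n) y.1)
      from fun y => ih y.1 y.2]
    have h : Measurable fun x => ∫⁻ y, c y ∂((k ^ n) x) := hc.lintegral_kernel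
    rw [lintegral_stepKernel _ _ _ (f := fun y : S × ℝ => ∫⁻ x, c x ∂((k ^ n) y.1)) (by fun_prop)]
    simp

lemma lintegral_fst_potential (k : Kernel S S) [IsFiniteKernel k] (κ : Kernel S ℝ)
    [IsMarkovKernel κ] (l : S) (t : ℝ) {c : S → ℝ≥0∞} (hc : Measurable c) :
    ∫⁻ y, c y.1 ∂(potential (stepKernel k κ) (l, t)) = ∫⁻ x, c x ∂(potential k l) := by
  simp_rw [lintegral_potential, lintegral_fst_stepKernel_pow k κ _ l t hc]

/-! ### Splitting off the regenerations -/

/-- The part of the transition kernel that regenerates: from `B`, jump to the law `ν` with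
probability `e`. -/
noncomputable def regenKernel {B : Set S} (hB : MeasurableSet B) (e : ℝ≥0∞) (ν : Measure S) :
    Kernel S S :=
  letI := Classical.decPred (· ∈ B)
  Kernel.piecewise hB (Kernel.const S (e • ν)) 0

lemma lintegral_regenKernel {B : Set S} (hB : MeasurableSet B) (e : ℝ≥0∞) (ν : Measure S) (l : S)
    (f : S → ℝ≥0∞) :
    ∫⁻ x, f x ∂(regenKernel hB e ν l) = B.indicator (fun _ => e) l * ∫⁻ x, f x ∂ν := by
  classical
  unfold regenKernel
  by_cases h : l ∈ B <;> simp [Kernel.piecewise_apply, h]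

lemma isFiniteKernel_regenKernel {B : Set S} (hB : MeasurableSet B) {e : ℝ≥0∞} (he : e ≠ ∞)
    (ν : Measure S) [IsFiniteMeasure ν] : IsFiniteKernel (regenKernel hB e ν) := by
  have : IsFiniteMeasure (e • ν) := ν.smul_finite he
  unfold regenKernel; infer_instance

/-- A kernel with a minorization on `B` is the sum of the regeneration kernel and a remainder. -/
lemma exists_add_regenKernel (g : Kernel S S) [IsMarkovKernel g] {B : Set S}
    (hB : MeasurableSet B) {e : ℝ≥0∞} (he : e ≠ ∞) (ν : Measure S) [IsProbabilityMeasure ν]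
    (h : ∀ x ∈ B, e • ν ≤ g x) :
    ∃ k : Kernel S S, IsFiniteKernel k ∧ g = k + regenKernel hB e ν := by
  classical
  have : IsFiniteMeasure (e • ν) := ν.smul_finite he
  have hm : Measurable fun x => if x ∈ B then g x - e • ν else g x := by
    refine Measure.measurable_of_measurable_coe _ fun D hD => ?_
    have : (fun x => (if x ∈ B then g x - e • ν else g x) D)
        = fun x => if x ∈ B then g x D - (e • ν) D else g x D := by
      funext x
      by_cases hx : x ∈ B
      · simp only [hx, if_true]
        exact Measure.sub_apply hD (h x hx)
      · simp [hx]
    rw [this]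
    exact Measurable.ite hB ((g.measurable_coe hD).sub measurable_const) (g.measurable_coe hD)
  refine ⟨⟨_, hm⟩, ?_, ?_⟩
  · refine isFiniteKernel_of_le (ν := g) fun x => ?_
    by_cases hx : x ∈ B
    · simp only [Kernel.coe_mk, hx, if_true]
      exact Measure.sub_le
    · simp [hx]
  · ext1 x
    rw [_root_.add_apply]
    by_cases hx : x ∈ B
    · simp only [Kernel.coe_mk, hx, if_true, regenKernel, Kernel.piecewise_apply,
        Kernel.const_apply]
      exact (Measure.sub_add_cancel_of_le (h x hx)).symm
    · simp [hx, regenKernel, Kernel.piecewise_apply]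

end

section

variable {S : Type*} [MeasurableSpace S]

/-! ### Regeneration and the renewal equation -/

/-- A splitting `g = k + 1_B · e · ν` of the transition kernel: from a state in `B`, the chain
regenerates with probability `e`, that is, it restarts from the law `ν`. -/
structure Regeneration (g : Kernel S S) where
  /-- the set from which the chain may regenerate -/
  B : Set S
  measurableSet_B : MeasurableSet B
  /-- the probability of regenerating from a state in `B` -/
  e : ℝ≥0∞
  e_ne_zero : e ≠ 0
  e_ne_top : e ≠ ∞
  /-- the law after a regeneration -/
  ν : Measure S
  isProb : IsProbabilityMeasure ν
  /-- the transitions without regeneration -/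
  k : Kernel S S
  isFinite : IsFiniteKernel k
  eq_add : g = k + regenKernel measurableSet_B e ν

namespace Regeneration

attribute [instance] isProb isFinite

variable {g : Kernel S S} (R : Regeneration g) (κ : Kernel S ℝ) [IsMarkovKernel κ]

/-- The regenerating transitions. -/
noncomputable def r : Kernel S S := regenKernel R.measurableSet_B R.e R.ν

instance : IsFiniteKernel R.r := isFiniteKernel_regenKernel _ R.e_ne_top _

lemma eq_add' : g = R.k + R.r := R.eq_add

/-- The sub-probability law of the time at which the next regeneration occurs. -/
noncomputable def cycleKernel : Kernel S ℝ :=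
  elapsed (stepKernel R.r κ ∘ₖ potential (stepKernel R.k κ))

/-- The law of the length of a cycle between two regenerations. -/
noncomputable def cycleLaw : Measure ℝ := R.cycleKernel κ ∘ₘ R.ν

/-- The expected number of regenerations after time zero, as a measure in time, for the chain
with initial law `ν`. -/
noncomputable def regenMeasure : Measure ℝ :=
  elapsed (stepKernel R.r κ ∘ₖ potential (stepKernel g κ)) ∘ₘ R.ν

/-- The renewal measure of the regeneration times. -/
noncomputable def renewalMeasure : Measure ℝ := Measure.dirac 0 + R.regenMeasure κ

lemma lintegral_stepKernel_r (p : S × ℝ) {f : S × ℝ → ℝ≥0∞} (hf : Measurable f) :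
    ∫⁻ y, f y ∂(stepKernel R.r κ p)
      = ∫⁻ y, ∫⁻ l, f (l, y.2) ∂(R.ν) ∂(stepKernel R.r κ p) := by
  have h : Measurable fun y : S × ℝ => ∫⁻ l, f (l, y.2) ∂(R.ν) :=
    (Measurable.lintegral_prod_left' hf).comp measurable_snd
  rw [lintegral_stepKernel _ _ _ hf, lintegral_stepKernel _ _ _ h]
  refine lintegral_congr fun x => ?_
  simp only [r, lintegral_regenKernel]
  simp

/-- After a regeneration the type has law `ν`, independently of the elapsed time. -/
lemma lintegral_r_comp {K : Kernel (S × ℝ) (S × ℝ)} (hK : IsEquivariant K) (l : S) (t : ℝ)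
    {f : S × ℝ → ℝ≥0∞} (hf : Measurable f) :
    ∫⁻ y, f y ∂((stepKernel R.r κ ∘ₖ K) (l, t))
      = ∫⁻ x, ∫⁻ l', f (l', t - x) ∂(R.ν) ∂(elapsed (stepKernel R.r κ ∘ₖ K) l) := by
  have h : Measurable fun s : ℝ => ∫⁻ l, f (l, s) ∂(R.ν) := Measurable.lintegral_prod_left' hf
  rw [← ((isEquivariant_stepKernel R.r κ).comp hK).lintegral_snd l t h,
    Kernel.lintegral_comp _ _ _ hf, Kernel.lintegral_comp _ _ _
      (g := fun y : S × ℝ => ∫⁻ l, f (l, y.2) ∂(R.ν)) (h.comp measurable_snd)]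
  exact lintegral_congr fun y => R.lintegral_stepKernel_r κ y hf

lemma stepKernel_eq : stepKernel g κ = stepKernel R.k κ + stepKernel R.r κ := by
  conv_lhs => rw [R.eq_add']
  exact stepKernel_add _ _ _

lemma isEquivariant_g (R : Regeneration g) (κ : Kernel S ℝ) [IsMarkovKernel κ] :
    IsEquivariant (stepKernel g κ) := by
  have : IsFiniteKernel g := by rw [R.eq_add']; infer_instance
  exact isEquivariant_stepKernel g κ

lemma isEquivariant_potential_k : IsEquivariant (potential (stepKernel R.k κ)) :=
  (isEquivariant_stepKernel R.k κ).potential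

lemma isEquivariant_potential (R : Regeneration g) (κ : Kernel S ℝ) [IsMarkovKernel κ] :
    IsEquivariant (potential (stepKernel g κ)) :=
  (R.isEquivariant_g κ).potential

lemma measurable_avg_potential (K : Kernel (S × ℝ) (S × ℝ)) {f : S × ℝ → ℝ≥0∞}
    (hf : Measurable f) (t : ℝ) : Measurable fun l => ∫⁻ y, f y ∂(K (l, t)) := by
  have h : Measurable fun p => ∫⁻ y, f y ∂(K p) := hf.lintegral_kernel
  exact h.comp (by fun_prop)

lemma measurable_avg (K : Kernel (S × ℝ) (S × ℝ)) {f : S × ℝ → ℝ≥0∞} (hf : Measurable f) :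
    Measurable fun t => ∫⁻ l, ∫⁻ y, f y ∂(K (l, t)) ∂(R.ν) := by
  have h : Measurable fun p => ∫⁻ y, f y ∂(K p) := hf.lintegral_kernel
  exact Measurable.lintegral_prod_left' h

/-- Decomposition of the potential at the first regeneration. -/
lemma lintegral_potential_eq (l : S) (t : ℝ) {f : S × ℝ → ℝ≥0∞} (hf : Measurable f) :
    ∫⁻ y, f y ∂(potential (stepKernel g κ) (l, t))
      = ∫⁻ y, f y ∂(potential (stepKernel R.k κ) (l, t)) +
        ∫⁻ x, ∫⁻ l', ∫⁻ y, f y ∂(potential (stepKernel g κ) (l', t - x)) ∂(R.ν)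
          ∂(R.cycleKernel κ l) := by
  have h : potential (stepKernel g κ) = potential (stepKernel R.k κ) +
      potential (stepKernel g κ) ∘ₖ (stepKernel R.r κ ∘ₖ potential (stepKernel R.k κ)) := by
    rw [← Kernel.comp_assoc, R.stepKernel_eq κ]
    exact potential_add _ _
  conv_lhs => rw [h]
  rw [_root_.add_apply, lintegral_add_measure, Kernel.lintegral_comp _ _ _ hf,
    R.lintegral_r_comp κ (R.isEquivariant_potential_k κ) l t hf.lintegral_kernel]
  rfl

/-- Decomposition of the potential at the last regeneration. -/
lemma lintegral_potential_eq' (l : S) (t : ℝ) {f : S × ℝ → ℝ≥0∞} (hf : Measurable f) :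
    ∫⁻ y, f y ∂(potential (stepKernel g κ) (l, t))
      = ∫⁻ y, f y ∂(potential (stepKernel R.k κ) (l, t)) +
        ∫⁻ x, ∫⁻ l', ∫⁻ y, f y ∂(potential (stepKernel R.k κ) (l', t - x)) ∂(R.ν)
          ∂(elapsed (stepKernel R.r κ ∘ₖ potential (stepKernel g κ)) l) := by
  have h : potential (stepKernel g κ) = potential (stepKernel R.k κ) +
      potential (stepKernel R.k κ) ∘ₖ (stepKernel R.r κ ∘ₖ potential (stepKernel g κ)) := by
    rw [← Kernel.comp_assoc, R.stepKernel_eq κ]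
    exact potential_add' _ _
  conv_lhs => rw [h]
  rw [_root_.add_apply, lintegral_add_measure, Kernel.lintegral_comp _ _ _ hf,
    R.lintegral_r_comp κ (R.isEquivariant_potential κ) l t hf.lintegral_kernel]

/-- The renewal equation for the potential started from `ν`. -/
lemma avg_potential_eq (t : ℝ) {f : S × ℝ → ℝ≥0∞} (hf : Measurable f) :
    ∫⁻ l, ∫⁻ y, f y ∂(potential (stepKernel g κ) (l, t)) ∂(R.ν)
      = ∫⁻ l, ∫⁻ y, f y ∂(potential (stepKernel R.k κ) (l, t)) ∂(R.ν) +
        ∫⁻ x, ∫⁻ l, ∫⁻ y, f y ∂(potential (stepKernel g κ) (l, t - x)) ∂(R.ν)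
          ∂(R.cycleLaw κ) := by
  have h := R.measurable_avg (potential (stepKernel g κ)) hf
  rw [cycleLaw, Measure.lintegral_bind (R.cycleKernel κ).aemeasurable (by fun_prop),
    ← lintegral_add_left (measurable_avg_potential _ hf t)]
  exact lintegral_congr fun l => R.lintegral_potential_eq κ l t hf

/-- The solution of the renewal equation: the potential started from `ν` is the convolution of the
renewal measure with the potential of a single cycle. -/
lemma avg_potential_eq_renewalMeasure (t : ℝ) {f : S × ℝ → ℝ≥0∞} (hf : Measurable f) :
    ∫⁻ l, ∫⁻ y, f y ∂(potential (stepKernel g κ) (l, t)) ∂(R.ν)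
      = ∫⁻ x, ∫⁻ l, ∫⁻ y, f y ∂(potential (stepKernel R.k κ) (l, t - x)) ∂(R.ν)
          ∂(R.renewalMeasure κ) := by
  have h := R.measurable_avg (potential (stepKernel R.k κ)) hf
  rw [renewalMeasure, lintegral_add_measure, lintegral_dirac' _ (by fun_prop), sub_zero,
    regenMeasure, Measure.lintegral_bind (Kernel.aemeasurable _) (by fun_prop),
    ← lintegral_add_left (measurable_avg_potential _ hf t)]
  exact lintegral_congr fun l => R.lintegral_potential_eq' κ l t hf

/-- Convolution with the renewal measure solves the renewal equation of the cycle law. -/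
lemma lintegral_renewalMeasure_eq (t : ℝ) {w : ℝ → ℝ≥0∞} (hw : Measurable w) :
    ∫⁻ x, w (t - x) ∂(R.renewalMeasure κ)
      = w t + ∫⁻ x, ∫⁻ z, w (t - x - z) ∂(R.renewalMeasure κ) ∂(R.cycleLaw κ) := by
  have hf : Measurable fun y : S × ℝ => ∫⁻ z, w z.2 ∂(stepKernel R.r κ y) :=
    Measurable.lintegral_kernel (by fun_prop)
  -- the number of regenerations is the potential of the probability to regenerate next
  have hM : ∀ s, ∫⁻ x, w (s - x) ∂(R.regenMeasure κ) = ∫⁻ l, ∫⁻ y,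
      ∫⁻ z, w z.2 ∂(stepKernel R.r κ y) ∂(potential (stepKernel g κ) (l, s)) ∂(R.ν) := by
    intro s
    rw [regenMeasure, Measure.lintegral_bind (Kernel.aemeasurable _) (by fun_prop)]
    refine lintegral_congr fun l => ?_
    rw [← ((isEquivariant_stepKernel R.r κ).comp
      (R.isEquivariant_potential κ)).lintegral_snd l s hw,
      Kernel.lintegral_comp _ _ _ (by fun_prop)]
  have hG : ∀ s, ∫⁻ x, w (s - x) ∂(R.cycleLaw κ) = ∫⁻ l, ∫⁻ y,
      ∫⁻ z, w z.2 ∂(stepKernel R.r κ y) ∂(potential (stepKernel R.k κ) (l, s)) ∂(R.ν) := by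
    intro s
    rw [cycleLaw, Measure.lintegral_bind (Kernel.aemeasurable _) (by fun_prop)]
    refine lintegral_congr fun l => ?_
    rw [cycleKernel, ← ((isEquivariant_stepKernel R.r κ).comp
      (R.isEquivariant_potential_k κ)).lintegral_snd l s hw,
      Kernel.lintegral_comp _ _ _ (by fun_prop)]
  have hD : ∀ s, ∫⁻ x, w (s - x) ∂(R.renewalMeasure κ)
      = w s + ∫⁻ x, w (s - x) ∂(R.regenMeasure κ) := by
    intro s
    rw [renewalMeasure, lintegral_add_measure, lintegral_dirac' _ (by fun_prop), sub_zero]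
  simp_rw [hD]
  congr 1
  rw [lintegral_add_left (by fun_prop), hM, R.avg_potential_eq κ t hf, hG]
  simp_rw [hM]

lemma cycleKernel_univ (l : S) :
    R.cycleKernel κ l univ = ∫⁻ x, R.B.indicator (fun _ => R.e) x ∂(potential R.k l) := by
  have h : Measurable (R.B.indicator fun _ => R.e) :=
    measurable_const.indicator R.measurableSet_B
  have h1 := lintegral_elapsed (stepKernel R.r κ ∘ₖ potential (stepKernel R.k κ)) l
    (w := fun _ => 1) measurable_const
  rw [lintegral_one] at h1
  rw [cycleKernel, h1, Kernel.lintegral_comp _ _ _ measurable_const,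
    ← lintegral_fst_potential R.k κ l 0 h]
  refine lintegral_congr fun y => ?_
  rw [lintegral_stepKernel _ _ _ measurable_const]
  simp only [r, lintegral_regenKernel]
  simp

end Regeneration

end

section

/-! ### Asymptotic translation invariance in the renewal equation -/

lemma exists_sub_of_mem_closure {T : Set ℝ} {x : ℝ} (hx : x ∈ AddSubgroup.closure T) :
    ∃ a ∈ AddSubmonoid.closure T, ∃ b ∈ AddSubmonoid.closure T, x = b - a := by
  induction hx using AddSubgroup.closure_induction with
  | mem x hx => exact ⟨0, zero_mem _, x, AddSubmonoid.subset_closure hx, by simp⟩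
  | zero => exact ⟨0, zero_mem _, 0, zero_mem _, by simp⟩
  | add x y _ _ hx hy =>
    obtain ⟨a, ha, b, hb, rfl⟩ := hx
    obtain ⟨a', ha', b', hb', rfl⟩ := hy
    exact ⟨a + a', add_mem ha ha', b + b', add_mem hb hb', by ring⟩
  | neg x _ hx =>
    obtain ⟨a, ha, b, hb, rfl⟩ := hx
    exact ⟨b, hb, a, ha, by ring⟩

/-- A submonoid of `[0, ∞)` that generates a dense group is asymptotically dense at `∞`. -/
lemma exists_forall_ge_exists_mem_abs_sub_lt {T : AddSubmonoid ℝ} (hT : ∀ x ∈ T, 0 ≤ x)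
    (hd : Dense (AddSubgroup.closure (T : Set ℝ) : Set ℝ)) {δ : ℝ} (hδ : 0 < δ) :
    ∃ x₀, ∀ x ≥ x₀, ∃ y ∈ T, |x - y| < δ := by
  obtain ⟨d, hd1, hd2⟩ := hd.exists_mem_open isOpen_Ioo (nonempty_Ioo.2 hδ)
  obtain ⟨a, ha, b, hb, rfl⟩ := exists_sub_of_mem_closure hd1
  rw [AddSubmonoid.closure_eq] at ha hb
  obtain ⟨h0, h1⟩ := hd2
  -- replace `a`, `b` by `a + b`, `b + b`, which are positive
  set p := a + b with hp
  have hp0 : 0 < p := by linarith [hT a ha]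
  have hpT : p ∈ T := add_mem ha hb
  have hqT : b + b ∈ T := add_mem hb hb
  set D := b - a with hD
  obtain ⟨n₀, hn₀⟩ := exists_nat_ge (p / D)
  refine ⟨n₀ * p, fun x hx => ?_⟩
  have hx0 : 0 ≤ x := le_trans (by positivity) hx
  set n := ⌊x / p⌋₊ with hn
  have hn1 : n * p ≤ x := (le_div_iff₀ hp0).1 (Nat.floor_le (by positivity))
  have hn2 : x < (n + 1) * p := (div_lt_iff₀ hp0).1 (Nat.lt_floor_add_one _)
  have hn3 : n₀ ≤ n := Nat.le_floor ((le_div_iff₀ hp0).2 hx)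
  set r := x - n * p with hr
  have hr0 : 0 ≤ r := by linarith
  have hrp : r < p := by linarith
  set m := ⌊r / D⌋₊ with hm
  have hm1 : m * D ≤ r := (le_div_iff₀ h0).1 (Nat.floor_le (by positivity))
  have hm2 : r < (m + 1) * D := (div_lt_iff₀ h0).1 (Nat.lt_floor_add_one _)
  have hmn : m ≤ n := by
    have h2 : (m : ℝ) ≤ n := by
      calc (m : ℝ) ≤ r / D := (le_div_iff₀ h0).2 hm1
        _ ≤ p / D := by gcongr
        _ ≤ n₀ := hn₀
        _ ≤ n := by exact_mod_cast hn3
    exact_mod_cast h2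
  refine ⟨(n - m) • p + m • (b + b), add_mem (T.nsmul_mem hpT _) (T.nsmul_mem hqT _), ?_⟩
  have h3 : (n - m) • p + m • (b + b) = n * p + m * D := by
    simp only [nsmul_eq_mul, Nat.cast_sub hmn, hp, hD]
    ring
  rw [h3, abs_lt]
  constructor <;> nlinarith

lemma dense_closure_support {G : Measure ℝ} (hG : ¬ IsArithmetic G) :
    Dense (AddSubgroup.closure (AddSubmonoid.closure G.support : Set ℝ) : Set ℝ) := by
  refine (AddSubgroup.dense_or_cyclic _).resolve_right ?_
  rintro ⟨a, ha⟩
  have h : ∀ᵐ x ∂G, ∃ k : ℤ, x = k * a := by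
    filter_upwards [Measure.support_mem_ae (μ := G)] with x hx
    have h1 : x ∈ AddSubgroup.closure (AddSubmonoid.closure G.support : Set ℝ) :=
      AddSubgroup.subset_closure (AddSubmonoid.subset_closure hx)
    rw [ha, AddSubgroup.mem_closure_singleton] at h1
    obtain ⟨k, hk⟩ := h1
    exact ⟨k, by rw [← hk, zsmul_eq_mul]⟩
  refine hG ?_
  rcases lt_trichotomy a 0 with h0 | h0 | h0
  · refine ⟨-a, by linarith, h.mono ?_⟩
    rintro x ⟨k, rfl⟩
    exact ⟨-k, by push_cast; ring⟩
  · refine ⟨1, one_pos, h.mono ?_⟩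
    rintro x ⟨k, rfl⟩
    exact ⟨0, by simp [h0]⟩
  · exact ⟨a, h0, h⟩

/-- If `W` is asymptotically a fixed point of convolution with `G`, and `W` approaches its upper
limit along a sequence `u`, then it also does so along the translates `u - x` with `x` in the
support of `G`. -/
lemma tendsto_sub_of_mem_support {G : Measure ℝ} [IsProbabilityMeasure G] {W : ℝ → ℝ} {C : ℝ}
    (hb : ∀ t, |W t| ≤ C) (huc : UniformContinuous W)
    (h : Tendsto (fun t => W t - ∫ x, W (t - x) ∂G) atTop (𝓝 0)) {η : ℝ}
    (hη : ∀ ε > 0, ∀ᶠ t in atTop, W t < η + ε) {u : ℕ → ℝ} (hu : Tendsto u atTop atTop)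
    (huη : Tendsto (fun n => W (u n)) atTop (𝓝 η)) {x : ℝ} (hx : x ∈ G.support) :
    Tendsto (fun n => W (u n - x)) atTop (𝓝 η) := by
  have hWc : Continuous W := huc.continuous
  have hint : ∀ t, Integrable (fun y => W (t - y)) G := fun t =>
    Integrable.of_bound (by fun_prop) C (ae_of_all _ fun y => hb _)
  -- the positive part of `W - η` does not contribute in the limit
  have he : Tendsto (fun t => ∫ y, max (W (t - y) - η) 0 ∂G) atTop (𝓝 0) := by
    have : Tendsto (fun t => ∫ y, max (W (t - y) - η) 0 ∂G) atTop (𝓝 (∫ _, (0 : ℝ) ∂G)) := by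
      refine tendsto_integral_filter_of_dominated_convergence (fun _ => C + |η|) ?_ ?_ ?_ ?_
      · exact Eventually.of_forall fun t => by fun_prop
      · refine Eventually.of_forall fun t => ae_of_all _ fun y => ?_
        rw [Real.norm_eq_abs, abs_of_nonneg (le_max_right _ _)]
        have h1 := abs_le.1 (hb (t - y))
        have h2 := neg_abs_le η
        have h3 := abs_nonneg η
        exact max_le (by linarith) (by linarith)
      · exact integrable_const _
      · refine ae_of_all _ fun y => ?_
        rw [Metric.tendsto_atTop']
        intro ε hε
        have h1 := (tendsto_atTop_add_const_right atTop (-y) tendsto_id).eventually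
          (hη ε hε)
        obtain ⟨N, hN⟩ := eventually_atTop.1 h1
        refine ⟨N, fun t ht => ?_⟩
        have h2 := hN t ht.le
        simp only [id, ← sub_eq_add_neg] at h2
        rw [Real.dist_eq, sub_zero, abs_of_nonneg (le_max_right _ _)]
        exact max_lt (by linarith) hε
    simpa using this
  have hd : Tendsto (fun n => ∫ y, max (η - W (u n - y)) 0 ∂G) atTop (𝓝 0) := by
    have h1 : ∀ t, ∫ y, max (η - W (t - y)) 0 ∂G
        = (η - W t) + (W t - ∫ y, W (t - y) ∂G) + ∫ y, max (W (t - y) - η) 0 ∂G := by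
      intro t
      have h2 : ∀ y, max (η - W (t - y)) 0 = (η - W (t - y)) + max (W (t - y) - η) 0 := by
        intro y
        rcases le_total (W (t - y)) η with h3 | h3
        · rw [max_eq_left (by linarith), max_eq_right (by linarith), add_zero]
        · rw [max_eq_right (by linarith), max_eq_left (by linarith)]; ring
      have h4 : Integrable (fun y => W (t - y) - η) G := (hint t).sub (integrable_const _)
      have h5 : Integrable (fun y => η - W (t - y)) G := (integrable_const _).sub (hint t)
      simp_rw [h2]
      rw [integral_add h5 h4.pos_part, integral_sub (integrable_const _) (hint t)]
      simp
    simp_rw [h1]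
    have h2 := ((huη.const_sub η).add (h.comp hu)).add (he.comp hu)
    simpa using h2
  have hux : Tendsto (fun n => u n - x) atTop atTop := tendsto_atTop_add_const_right _ _ hu
  rw [Metric.tendsto_atTop]
  intro ε hε
  obtain ⟨r, hr, hW⟩ := Metric.uniformContinuous_iff.1 huc (ε / 2) (by linarith)
  have hm : 0 < G (Metric.ball x r) :=
    (Measure.mem_support_iff_forall x).1 hx _ (Metric.ball_mem_nhds x hr)
  have hm' : 0 < G.real (Metric.ball x r) := ENNReal.toReal_pos hm.ne' (measure_ne_top _ _)
  have hev := (hux.eventually (hη ε hε)).and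
    (hd.eventually (gt_mem_nhds (show 0 < G.real (Metric.ball x r) * (ε / 2) by positivity)))
  obtain ⟨N, hN⟩ := eventually_atTop.1 hev
  refine ⟨N, fun n hn => ?_⟩
  obtain ⟨h1, h2⟩ := hN n hn
  rw [Real.dist_eq, abs_lt]
  refine ⟨?_, by linarith⟩
  by_contra hcon
  refine absurd h2 (not_lt.2 ?_)
  have h5 : Integrable (fun y => max (η - W (u n - y)) 0) G :=
    ((integrable_const _).sub (hint _)).pos_part
  calc G.real (Metric.ball x r) * (ε / 2)
      = ∫ y in Metric.ball x r, ε / 2 ∂G := by simp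
    _ ≤ ∫ y in Metric.ball x r, max (η - W (u n - y)) 0 ∂G := by
        refine setIntegral_mono_on (integrable_const _).integrableOn h5.integrableOn
          measurableSet_ball fun y hy => ?_
        have h6 := hW (a := u n - y) (b := u n - x) (by
          rw [dist_sub_left]; exact hy)
        rw [Real.dist_eq, abs_lt] at h6
        exact le_max_of_le_left (by linarith)
    _ ≤ ∫ y, max (η - W (u n - y)) 0 ∂G :=
        setIntegral_le_integral h5 (ae_of_all _ fun y => le_max_right _ _)

lemma support_nonneg {G : Measure ℝ} (hG : ∀ᵐ x ∂G, 0 ≤ x) {x : ℝ} (hx : x ∈ G.support) :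
    0 ≤ x :=
  Measure.support_subset_of_isClosed isClosed_Ici hG hx

/-- The increments of `Z` do not exceed `ε` in the limit. Otherwise they would approach a positive
upper limit along a sequence, hence be large at many points of an arithmetic progression with step
`s`, contrary to the boundedness of `Z`. -/
lemma eventually_shift_sub_lt {G : Measure ℝ} [IsProbabilityMeasure G] (hG0 : ∀ᵐ x ∂G, 0 ≤ x)
    (hG : ¬ IsArithmetic G) {Z : ℝ → ℝ} {C : ℝ} (hb : ∀ t, |Z t| ≤ C) (huc : UniformContinuous Z)
    (h : Tendsto (fun t => Z t - ∫ x, Z (t - x) ∂G) atTop (𝓝 0)) {s : ℝ} (hs : 0 < s) {ε : ℝ}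
    (hε : 0 < ε) : ∀ᶠ t in atTop, Z (t + s) - Z t < ε := by
  by_contra hcon
  have hfreq : ∃ᶠ t in atTop, ε ≤ Z (t + s) - Z t := by
    simpa only [not_eventually, not_lt] using hcon
  set W : ℝ → ℝ := fun t => Z (t + s) - Z t with hWdef
  have hZc : Continuous Z := huc.continuous
  have hWb : ∀ t, |W t| ≤ 2 * C := fun t => by
    have h1 := abs_le.1 (hb (t + s))
    have h2 := abs_le.1 (hb t)
    rw [abs_le]
    constructor <;> simp only [hWdef] <;> linarith
  have hWuc : UniformContinuous W :=
    (huc.comp (uniformContinuous_id.add uniformContinuous_const)).sub huc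
  have hWh : Tendsto (fun t => W t - ∫ x, W (t - x) ∂G) atTop (𝓝 0) := by
    have h1 := (h.comp (tendsto_atTop_add_const_right atTop s tendsto_id)).sub h
    rw [sub_zero] at h1
    refine h1.congr fun t => ?_
    have hint : ∀ t, Integrable (fun y => Z (t - y)) G := fun t =>
      Integrable.of_bound (by fun_prop) C (ae_of_all _ fun y => hb _)
    have h2 : ∫ x, W (t - x) ∂G = ∫ x, Z (t + s - x) ∂G - ∫ x, Z (t - x) ∂G := by
      rw [← integral_sub (hint _) (hint _)]
      simp only [hWdef, add_sub_right_comm]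
    rw [h2]
    simp only [hWdef, Function.comp_apply, id]
    ring
  have hbdd : IsBoundedUnder (· ≤ ·) atTop W :=
    isBoundedUnder_of ⟨2 * C, fun t => (abs_le.1 (hWb t)).2⟩
  have hcobdd : IsCoboundedUnder (· ≤ ·) atTop W :=
    (isBoundedUnder_of ⟨-(2 * C), fun t => (abs_le.1 (hWb t)).1⟩ :
      IsBoundedUnder (· ≥ ·) atTop W).isCoboundedUnder_le
  set η := limsup W atTop with hηdef
  have hηε : ε ≤ η := le_limsup_of_frequently_le hfreq hbdd
  have hη : ∀ δ > 0, ∀ᶠ t in atTop, W t < η + δ := fun δ hδ =>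
    eventually_lt_of_limsup_lt (by rw [← hηdef]; linarith) hbdd
  have hex : ∀ n : ℕ, ∃ t : ℝ, (n : ℝ) ≤ t ∧ |W t - η| < 1 / (n + 1) := by
    intro n
    have hn : (0 : ℝ) < 1 / (n + 1) := Nat.one_div_pos_of_nat
    have h1 : ∃ᶠ t in atTop, η - 1 / (n + 1) < W t :=
      frequently_lt_of_lt_limsup hcobdd (by rw [← hηdef]; linarith)
    obtain ⟨t, ⟨h2, h3⟩, h4⟩ :=
      ((h1.and_eventually (hη _ hn)).and_eventually (eventually_ge_atTop (n : ℝ))).exists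
    exact ⟨t, h4, abs_lt.2 ⟨by linarith, by linarith⟩⟩
  choose u hu1 hu2 using hex
  have hu : Tendsto u atTop atTop := tendsto_atTop_mono hu1 tendsto_natCast_atTop_atTop
  have huη : Tendsto (fun n => W (u n)) atTop (𝓝 η) := by
    rw [tendsto_iff_dist_tendsto_zero]
    refine squeeze_zero (fun n => dist_nonneg) (fun n => (hu2 n).le) ?_
    exact tendsto_one_div_add_atTop_nhds_zero_nat
  -- `W (u n - x) → η` for every `x` in the submonoid generated by the support
  have hsub : ∀ x ∈ AddSubmonoid.closure G.support, ∀ v : ℕ → ℝ, Tendsto v atTop atTop →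
      Tendsto (fun n => W (v n)) atTop (𝓝 η) → Tendsto (fun n => W (v n - x)) atTop (𝓝 η) := by
    intro x hx
    induction hx using AddSubmonoid.closure_induction with
    | mem x hx => exact fun v hv hvη => tendsto_sub_of_mem_support hWb hWuc hWh hη hv hvη hx
    | zero => exact fun v hv hvη => by simpa using hvη
    | add x y _ _ hx hy =>
      intro v hv hvη
      have h1 := hy _ (tendsto_atTop_add_const_right atTop (-x) hv)
        (by simpa only [← sub_eq_add_neg] using hx v hv hvη)
      simpa only [← sub_eq_add_neg, sub_sub] using h1
  have hnn : ∀ x ∈ AddSubmonoid.closure G.support, 0 ≤ x := by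
    intro x hx
    induction hx using AddSubmonoid.closure_induction with
    | mem x hx => exact support_nonneg hG0 hx
    | zero => exact le_rfl
    | add x y _ _ hx hy => exact add_nonneg hx hy
  obtain ⟨δ, hδ, hWδ⟩ := Metric.uniformContinuous_iff.1 hWuc (ε / 4) (by linarith)
  obtain ⟨x₀, hx₀⟩ := exists_forall_ge_exists_mem_abs_sub_lt hnn (dense_closure_support hG) hδ
  -- hence `W` is at least `ε / 2` at many points of an arithmetic progression with step `s`
  have hprog : ∀ j : ℕ, ∀ᶠ n in atTop, ε / 2 ≤ W (u n - (x₀ + j * s)) := by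
    intro j
    obtain ⟨y, hy, hyx⟩ := hx₀ (x₀ + j * s) (by have : 0 ≤ (j : ℝ) * s := by positivity
                                                linarith)
    have h1 := (hsub y hy u hu huη).eventually (lt_mem_nhds (show η - ε / 4 < η by linarith))
    filter_upwards [h1] with n hn
    have h2 := hWδ (a := u n - (x₀ + j * s)) (b := u n - y) (by
      rw [dist_sub_left]; exact hyx)
    rw [Real.dist_eq, abs_lt] at h2
    linarith [h2.1]
  obtain ⟨M, hM⟩ := exists_nat_gt (2 * C / (ε / 2))
  have hM' : 2 * C < M * (ε / 2) := (div_lt_iff₀ (by linarith)).1 hM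
  have hall : ∀ᶠ n in atTop, ∀ j ∈ Finset.range M, ε / 2 ≤ W (u n - (x₀ + j * s)) :=
    (Filter.eventually_all_finset _).2 fun j _ => hprog j
  obtain ⟨n, hn⟩ := hall.exists
  have hsum := Finset.card_nsmul_le_sum _ _ _ hn
  -- the increments telescope to a difference of two values of `Z`
  have htel : ∑ j ∈ Finset.range M, W (u n - (x₀ + j * s))
      = Z (u n - x₀ + s) - Z (u n - x₀ + s - M * s) := by
    have := Finset.sum_range_sub' (fun j : ℕ => Z (u n - x₀ + s - j * s)) M
    simp only [Nat.cast_zero, zero_mul, sub_zero] at this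
    rw [← this]
    refine Finset.sum_congr rfl fun j _ => ?_
    simp only [hWdef]
    congr 2
    · ring
    · push_cast; ring
  rw [htel, Finset.card_range, nsmul_eq_mul] at hsum
  have h1 := (abs_le.1 (hb (u n - x₀ + s))).2
  have h2 := (abs_le.1 (hb (u n - x₀ + s - M * s))).1
  linarith

/-- Asymptotic translation invariance, the qualitative content of Blackwell's renewal theorem. -/
lemma tendsto_shift_sub {G : Measure ℝ} [IsProbabilityMeasure G] (hG0 : ∀ᵐ x ∂G, 0 ≤ x)
    (hG : ¬ IsArithmetic G) {Z : ℝ → ℝ} {C : ℝ} (hb : ∀ t, |Z t| ≤ C) (huc : UniformContinuous Z)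
    (h : Tendsto (fun t => Z t - ∫ x, Z (t - x) ∂G) atTop (𝓝 0)) (s : ℝ) :
    Tendsto (fun t => Z (t + s) - Z t) atTop (𝓝 0) := by
  have hpos : ∀ s, 0 < s → Tendsto (fun t => Z (t + s) - Z t) atTop (𝓝 0) := by
    intro s hs
    have hneg : Tendsto (fun t => -Z t - ∫ x, -Z (t - x) ∂G) atTop (𝓝 0) := by
      have h1 := h.neg
      rw [neg_zero] at h1
      refine h1.congr fun t => ?_
      rw [integral_neg]; ring
    rw [tendsto_order]
    refine ⟨fun a ha => ?_, fun a ha => eventually_shift_sub_lt hG0 hG hb huc h hs ha⟩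
    have h2 := eventually_shift_sub_lt (Z := fun t => -Z t) hG0 hG (fun t => by simpa using hb t)
      huc.neg hneg hs (neg_pos.2 ha)
    filter_upwards [h2] with t ht
    linarith
  rcases lt_trichotomy s 0 with hs | hs | hs
  · have h1 := ((hpos (-s) (by linarith)).comp
      (tendsto_atTop_add_const_right atTop s tendsto_id)).neg
    rw [neg_zero] at h1
    refine h1.congr fun t => ?_
    simp
  · simp [hs]
  · exact hpos s hs

end

section

/-! ### Contractions with an isolated eigenvalue one -/

section Contraction

variable {V : Type*} [NormedAddCommGroup V] [NormedSpace ℂ V]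

lemma norm_pow_apply_le {T : V →L[ℂ] V} (hT : ‖T‖ ≤ 1) (n : ℕ) (v : V) : ‖(T ^ n) v‖ ≤ ‖v‖ := by
  induction n with
  | zero => simp
  | succ n ih =>
    rw [pow_succ', mul_apply_eq_comp]
    exact ((T.le_of_opNorm_le hT _).trans_eq (one_mul _)).trans ih

/-- The eigenvalue `1` of a contraction is semisimple. -/
lemma apply_eq_of_sub_sub_eq_zero {T : V →L[ℂ] V} (hT : ‖T‖ ≤ 1) {v : V}
    (h : T (T v - v) - (T v - v) = 0) : T v = v := by
  have h1 : ∀ n : ℕ, (T ^ n) v = v + (n : ℂ) • (T v - v) := by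
    intro n
    induction n with
    | zero => simp
    | succ n ih =>
      have h3 : T (T v - v) = T v - v := sub_eq_zero.1 h
      rw [pow_succ', mul_apply_eq_comp, ih, map_add, map_smul, h3, Nat.cast_succ,
        add_smul, one_smul]
      abel
  have h2 : ∀ n : ℕ, n * ‖T v - v‖ ≤ 2 * ‖v‖ := by
    intro n
    have h3 : (n : ℂ) • (T v - v) = (T ^ n) v - v := by rw [h1 n]; abel
    calc n * ‖T v - v‖ = ‖(n : ℂ) • (T v - v)‖ := by rw [norm_smul]; simp
      _ = ‖(T ^ n) v - v‖ := by rw [h3]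
      _ ≤ ‖(T ^ n) v‖ + ‖v‖ := norm_sub_le _ _
      _ ≤ 2 * ‖v‖ := by linarith [norm_pow_apply_le hT n v]
  by_contra hne
  have hpos : 0 < ‖T v - v‖ := norm_pos_iff.2 (sub_ne_zero.2 hne)
  obtain ⟨n, hn⟩ := exists_nat_gt (2 * ‖v‖ / ‖T v - v‖)
  have := (div_lt_iff₀ hpos).1 hn
  linarith [h2 n]

lemma ker_pow_sub_one_le {T : V →L[ℂ] V} (hT : ‖T‖ ≤ 1) (k : ℕ) :
    LinearMap.ker (((T : V →ₗ[ℂ] V) - 1) ^ k) ≤ LinearMap.ker ((T : V →ₗ[ℂ] V) - 1) := by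
  induction k with
  | zero =>
    intro v hv
    have : v = 0 := by simpa using hv
    simp [this]
  | succ k ih =>
    rcases k with _ | k
    · simp
    · intro v hv
      refine ih ?_
      have h1 : (((T : V →ₗ[ℂ] V) - 1) ^ (k + 1 + 1)) v = 0 := hv
      rw [pow_succ', pow_succ', Module.End.mul_apply, Module.End.mul_apply] at h1
      have h2 : (((T : V →ₗ[ℂ] V) - 1) ^ (k + 1)) v = 0 := by
        rw [pow_succ', Module.End.mul_apply]
        exact sub_eq_zero.2 (apply_eq_of_sub_sub_eq_zero hT h1)
      exact h2

lemma finiteDimensional_ker_sub_one {T : V →L[ℂ] V}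
    (h : IsFiniteMultEigenvalue (T : V →ₗ[ℂ] V) 1) :
    FiniteDimensional ℂ (LinearMap.ker ((T : V →ₗ[ℂ] V) - 1)) := by
  obtain ⟨-, k, hk, hfd, -⟩ := h
  rw [map_one] at hfd
  refine Submodule.finiteDimensional_of_le (S₂ := LinearMap.ker (((T : V →ₗ[ℂ] V) - 1) ^ k)) ?_
  intro v hv
  obtain ⟨j, rfl⟩ := Nat.exists_eq_succ_of_ne_zero hk.ne'
  rw [LinearMap.mem_ker] at hv ⊢
  rw [Nat.succ_eq_add_one, pow_succ, Module.End.mul_apply, hv, map_zero]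

/-- Mean ergodic decomposition `f = u + (Tw - w)` with `Tu = u`, with control of the norms. -/
lemma exists_ergodic_decomposition [CompleteSpace V] {T : V →L[ℂ] V} (hT : ‖T‖ ≤ 1)
    (h : IsFiniteMultEigenvalue (T : V →ₗ[ℂ] V) 1) :
    ∃ C : ℝ, ∀ f : V, ∃ u w : V, T u = u ∧ f = u + (T w - w) ∧ ‖u‖ ≤ C * ‖f‖ ∧ ‖w‖ ≤ C * ‖f‖ := by
  have hfd := finiteDimensional_ker_sub_one h
  obtain ⟨-, k, hk, -, hc⟩ := h
  rw [map_one] at hc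
  set N := LinearMap.ker ((T : V →ₗ[ℂ] V) - 1) with hN
  have : CompleteSpace N := FiniteDimensional.complete ℂ N
  let Ψ : N × V →L[ℂ] V :=
    N.subtypeL.comp (ContinuousLinearMap.fst ℂ N V) +
      (T - 1).comp (ContinuousLinearMap.snd ℂ N V)
  have hΨ : ∀ p, Ψ p = p.1 + (T p.2 - p.2) := fun p => rfl
  have hsurj : Function.Surjective Ψ := by
    intro f
    obtain ⟨u, hu, v, ⟨w, rfl⟩, rfl⟩ := Submodule.mem_sup.1
      (hc.sup_eq_top.ge (Submodule.mem_top : f ∈ ⊤))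
    obtain ⟨j, rfl⟩ := Nat.exists_eq_succ_of_ne_zero hk.ne'
    refine ⟨(⟨u, ker_pow_sub_one_le hT _ hu⟩, (((T : V →ₗ[ℂ] V) - 1) ^ j) w), ?_⟩
    have h1 : (((T : V →ₗ[ℂ] V) - 1) ^ j.succ) w
        = T ((((T : V →ₗ[ℂ] V) - 1) ^ j) w) - (((T : V →ₗ[ℂ] V) - 1) ^ j) w := by
      rw [Nat.succ_eq_add_one, pow_succ', Module.End.mul_apply]
      rfl
    rw [hΨ, h1]
  obtain ⟨C, -, hC⟩ := Ψ.exists_preimage_norm_le hsurj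
  refine ⟨C, fun f => ?_⟩
  obtain ⟨⟨u, w⟩, h1, h2⟩ := hC f
  refine ⟨u, w, sub_eq_zero.1 u.2, ?_, (norm_fst_le (u, w)).trans h2, (norm_snd_le (u, w)).trans h2⟩
  rw [← h1, hΨ]

lemma sum_pow_apply_sub {T : V →L[ℂ] V} {f u w : V} (hu : T u = u) (hf : f = u + (T w - w))
    (n : ℕ) :
    ∑ i ∈ Finset.range n, (T ^ i) f - (n : ℂ) • u = (T ^ n) w - w := by
  have hu' : ∀ i : ℕ, (T ^ i) u = u := by
    intro i
    induction i with
    | zero => simp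
    | succ i ih => rw [pow_succ, mul_apply_eq_comp, hu, ih]
  induction n with
  | zero => simp
  | succ n ih =>
    have h1 : (T ^ n) f = u + ((T ^ (n + 1)) w - (T ^ n) w) := by
      rw [hf, map_add, map_sub, hu', pow_succ, mul_apply_eq_comp]
    have h2 : ∑ i ∈ Finset.range n, (T ^ i) f = (T ^ n) w - w + (n : ℂ) • u := by
      rw [← ih]; abel
    rw [Finset.sum_range_succ, h1, h2, Nat.cast_succ, add_smul, one_smul]
    abel

lemma pow_succ_apply (T : V →L[ℂ] V) (n : ℕ) (v : V) : (T ^ (n + 1)) v = T ((T ^ n) v) := by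
  rw [pow_succ', mul_apply_eq_comp]

lemma one_mem_spectrum {T : V →L[ℂ] V} {c : V} (hc : T c = c) (h0 : c ≠ 0) :
    (1 : ℂ) ∈ spectrum ℂ T := by
  rw [spectrum.mem_iff, map_one]
  rintro ⟨u, hu⟩
  refine h0 ?_
  have hc' : (u : V →L[ℂ] V) c = 0 := by
    rw [hu]
    exact sub_eq_zero.2 hc.symm
  have h1 : ((↑u⁻¹ : V →L[ℂ] V) * ↑u) c = c := by simp
  rw [← h1, mul_apply_eq_comp]
  exact (congrArg _ hc').trans (map_zero _)

/-- Let `F k` be bounded vectors whose orbits tend to zero in every coordinate `ℓ y`. Then the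
Cesàro means of some `F k` are eventually small, uniformly in the coordinate: the invariant parts
of the `F k` lie in a finite-dimensional space, so that they tend to zero in norm along a
subsequence. -/
lemma exists_forall_norm_sum_le [CompleteSpace V] {T : V →L[ℂ] V} (hT : ‖T‖ ≤ 1)
    (h : IsFiniteMultEigenvalue (T : V →ₗ[ℂ] V) 1) {ι : Type*} (ℓ : ι → V →L[ℂ] ℂ)
    (hℓ : ∀ y v, ‖ℓ y v‖ ≤ ‖v‖) (hsep : ∀ v, (∀ y, ℓ y v = 0) → v = 0) {F : ℕ → V}
    (hF : ∀ k, ‖F k‖ ≤ 1)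
    (hlim : ∀ n y, Tendsto (fun k => ℓ y ((T ^ n) (F k))) atTop (𝓝 0)) {ε : ℝ} (hε : 0 < ε) :
    ∃ (k : ℕ) (K : ℝ), ∀ (n : ℕ) y, ‖∑ i ∈ Finset.range n, ℓ y ((T ^ i) (F k))‖ ≤ n * ε + K := by
  obtain ⟨K', hK'⟩ := exists_ergodic_decomposition hT h
  set K := max K' 0 with hKdef
  have hK0 : 0 ≤ K := le_max_right _ _
  choose u w hu hFuw hun hwn using fun k => hK' (F k)
  have hbound : ∀ k, K' * ‖F k‖ ≤ K := fun k =>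
    calc K' * ‖F k‖ ≤ K * ‖F k‖ := mul_le_mul_of_nonneg_right (le_max_left _ _) (norm_nonneg _)
      _ ≤ K := mul_le_of_le_one_right hK0 (hF k)
  have hun' : ∀ k, ‖u k‖ ≤ K := fun k => (hun k).trans (hbound k)
  have hwn' : ∀ k, ‖w k‖ ≤ K := fun k => (hwn k).trans (hbound k)
  have hces : ∀ k n y, ‖∑ i ∈ Finset.range n, ℓ y ((T ^ i) (F k)) - n * ℓ y (u k)‖ ≤ 2 * K := by
    intro k n y
    have h2 : ∑ i ∈ Finset.range n, ℓ y ((T ^ i) (F k)) - n * ℓ y (u k)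
        = ℓ y ((T ^ n) (w k) - w k) := by
      rw [← sum_pow_apply_sub (hu k) (hFuw k) n, map_sub, map_sum, map_smul, smul_eq_mul]
    rw [h2]
    calc ‖ℓ y ((T ^ n) (w k) - w k)‖ ≤ ‖(T ^ n) (w k) - w k‖ := hℓ y _
      _ ≤ ‖(T ^ n) (w k)‖ + ‖w k‖ := norm_sub_le _ _
      _ ≤ K + K := add_le_add ((norm_pow_apply_le hT n _).trans (hwn' k)) (hwn' k)
      _ = 2 * K := by ring
  have hfd := finiteDimensional_ker_sub_one h
  set N := LinearMap.ker ((T : V →ₗ[ℂ] V) - 1) with hN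
  have : ProperSpace N := FiniteDimensional.proper ℂ N
  have huN : ∀ k, u k ∈ N := fun k => sub_eq_zero.2 (hu k)
  obtain ⟨u₀, -, φ, hφ, hφlim⟩ := tendsto_subseq_of_bounded
    (Metric.isBounded_closedBall (x := (0 : N)) (r := K)) (x := fun k => ⟨u k, huN k⟩)
    (fun k => by
      rw [mem_closedBall_zero_iff]
      exact hun' k)
  have hlim' : Tendsto (fun j => u (φ j)) atTop (𝓝 (u₀ : V)) :=
    (continuous_subtype_val.tendsto _).comp hφlim
  have hu0 : (u₀ : V) = 0 := by
    refine hsep _ fun y => ?_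
    have h1 : Tendsto (fun j => ℓ y (u (φ j))) atTop (𝓝 (ℓ y u₀)) :=
      ((ℓ y).continuous.tendsto _).comp hlim'
    have h2 : ∀ n : ℕ, n * ‖ℓ y u₀‖ ≤ 2 * K := by
      intro n
      have h3 : Tendsto (fun j => ∑ i ∈ Finset.range n, ℓ y ((T ^ i) (F (φ j)))
          - n * ℓ y (u (φ j))) atTop (𝓝 (0 - n * ℓ y u₀)) := by
        refine Tendsto.sub ?_ (h1.const_mul _)
        rw [← Finset.sum_const_zero (s := Finset.range n)]
        exact tendsto_finsetSum _ fun i _ => (hlim i y).comp hφ.tendsto_atTop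
      have h4 := le_of_tendsto h3.norm (Eventually.of_forall fun j => hces (φ j) n y)
      simpa using h4
    by_contra hne
    have hpos : 0 < ‖ℓ y u₀‖ := norm_pos_iff.2 hne
    obtain ⟨n, hn⟩ := exists_nat_gt (2 * K / ‖ℓ y u₀‖)
    have := (div_lt_iff₀ hpos).1 hn
    linarith [h2 n]
  rw [hu0] at hlim'
  obtain ⟨j, hj⟩ := (hlim'.norm.eventually (gt_mem_nhds (show ‖(0 : V)‖ < ε by
    rwa [norm_zero]))).exists
  refine ⟨φ j, 2 * K, fun n y => ?_⟩
  have h1 := hces (φ j) n y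
  have h3 : ‖(n : ℂ) * ℓ y (u (φ j))‖ ≤ n * ε := by
    rw [norm_mul, Complex.norm_natCast]
    exact mul_le_mul_of_nonneg_left ((hℓ y _).trans hj.le) (Nat.cast_nonneg n)
  have h4 := norm_sub_norm_le (∑ i ∈ Finset.range n, ℓ y ((T ^ i) (F (φ j)))) (n * ℓ y (u (φ j)))
  linarith

end Contraction

/-! ### The transition operator -/

section Transition

variable {S : Type*} [MeasurableSpace S]

/-- A bounded measurable function, as an element of `L_∞(S)`. -/
noncomputable def toBddMeas (f : S → ℂ) (hf : Measurable f) (C : ℝ) (hC : ∀ x, ‖f x‖ ≤ C) :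
    bddMeas S :=
  ⟨⟨f, memℓp_infty ⟨C, by rintro _ ⟨x, rfl⟩; exact hC x⟩⟩, hf⟩

lemma norm_toBddMeas_le {f : S → ℂ} {hf : Measurable f} {C : ℝ} {hC : ∀ x, ‖f x‖ ≤ C}
    (h0 : 0 ≤ C) : ‖toBddMeas f hf C hC‖ ≤ C :=
  lp.norm_le_of_forall_le h0 hC

instance : CompleteSpace (bddMeas S) := by
  refine IsClosed.completeSpace_coe (hs := ?_)
  refine IsSeqClosed.isClosed fun f f₀ hf hlim => ?_
  refine measurable_of_tendsto_metrizable (f := fun n => (f n : S → ℂ)) hf ?_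
  rw [tendsto_pi_nhds]
  intro x
  rw [tendsto_iff_norm_sub_tendsto_zero] at hlim ⊢
  refine squeeze_zero (fun n => norm_nonneg _) (fun n => ?_) hlim
  have := lp.norm_apply_le_norm ENNReal.top_ne_zero (f n - f₀) x
  simpa using this

lemma norm_transitionOp_le (g : Kernel S S) [IsMarkovKernel g] : ‖transitionOp g‖ ≤ 1 :=
  LinearMap.mkContinuous_norm_le _ zero_le_one _

instance isMarkovKernel_pow (g : Kernel S S) [IsMarkovKernel g] (n : ℕ) :
    IsMarkovKernel (g ^ n) := by
  induction n with
  | zero => rw [pow_zero]; exact inferInstanceAs (IsMarkovKernel Kernel.id)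
  | succ n ih => rw [pow_succ]; exact inferInstanceAs (IsMarkovKernel ((g ^ n) ∘ₖ g))

lemma integral_pow_succ {E : Type*} [NormedAddCommGroup E] [NormedSpace ℝ E] (g : Kernel S S)
    [IsMarkovKernel g] (n : ℕ) (x : S) {f : S → E} (hf : StronglyMeasurable f) {C : ℝ}
    (hC : ∀ x, ‖f x‖ ≤ C) :
    ∫ y, f y ∂((g ^ (n + 1)) x) = ∫ y, ∫ z, f z ∂((g ^ n) y) ∂(g x) := by
  have h1 : Integrable f ((g ^ (n + 1)) x) :=
    Integrable.of_bound hf.aestronglyMeasurable C (ae_of_all _ hC)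
  rw [pow_succ] at h1 ⊢
  exact Kernel.integral_comp h1

lemma transitionOp_pow_apply (g : Kernel S S) [IsMarkovKernel g] (n : ℕ) (f : bddMeas S) (x : S) :
    ((transitionOp g ^ n) f).1 x = ∫ y, f.1 y ∂((g ^ n) x) := by
  induction n generalizing x with
  | zero =>
    have h : ∫ y, f.1 y ∂((g ^ 0) x) = f.1 x := by
      rw [pow_zero]
      change ∫ y, f.1 y ∂(Kernel.id x) = f.1 x
      rw [Kernel.id_apply, integral_dirac' _ _ (bddMeas_measurable f).stronglyMeasurable]
    exact h.symm
  | succ n ih =>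
    rw [pow_succ_apply, transitionOp_apply,
      integral_pow_succ g n x (bddMeas_measurable f).stronglyMeasurable (bddMeas_norm_le f)]
    simp_rw [ih]

/-- As a point of the spectrum on the unit circle, `1` is one of the exceptional eigenvalues. -/
lemma isFiniteMultEigenvalue_one {g : Kernel S S} [IsMarkovKernel g] [Nonempty S]
    (hgap : HasSpectralGap g) :
    IsFiniteMultEigenvalue (transitionOp g : bddMeas S →ₗ[ℂ] bddMeas S) 1 := by
  obtain ⟨r, hr, E, hE, hspec⟩ := hgap
  have h1 : (1 : ℂ) ∈ spectrum ℂ (transitionOp g) := by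
    let c : bddMeas S := toBddMeas (fun _ => 1) measurable_const 1 (by simp)
    refine one_mem_spectrum (c := c) ?_ fun h2 => ?_
    · apply Subtype.ext
      apply lp.ext
      funext x
      change ∫ y, (1 : ℂ) ∂(g x) = 1
      simp
    · obtain ⟨x⟩ := ‹Nonempty S›
      have h3 : c.1 x = 0 := by rw [h2]; rfl
      exact one_ne_zero (α := ℂ) h3
  rcases hspec 1 h1 with h | h
  · simp only [norm_one] at h; linarith
  · exact (hE 1 h).2

/-- Evaluation at a point, as a functional on `L_∞(S)`. -/
noncomputable def evalBddMeas (x : S) : bddMeas S →L[ℂ] ℂ :=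
  LinearMap.mkContinuous
    { toFun := fun f => f.1 x
      map_add' := fun _ _ => rfl
      map_smul' := fun _ _ => rfl } 1
    fun f => (bddMeas_norm_le f x).trans_eq (one_mul _).symm

lemma evalBddMeas_apply (x : S) (f : bddMeas S) : evalBddMeas x f = f.1 x := rfl

/-- Under a spectral gap, if sets decrease to the empty set, then every chain spends asymptotically
at most the proportion `ε` of its time in a late set, with a uniform error. -/
lemma exists_forall_sum_pow_le {g : Kernel S S} [IsMarkovKernel g] [Nonempty S]
    (hgap : HasSpectralGap g) {D : ℕ → Set S} (hDm : ∀ k, MeasurableSet (D k)) (hD : Antitone D)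
    (hD0 : ⋂ k, D k = ∅) {ε : ℝ} (hε : 0 < ε) :
    ∃ (k : ℕ) (K : ℝ), ∀ (n : ℕ) y,
      ∑ i ∈ Finset.range n, ((g ^ i) y).real (D k) ≤ n * ε + K := by
  have hind : ∀ k y, ‖(D k).indicator (fun _ => (1 : ℂ)) y‖ ≤ 1 := fun k y => by
    refine (norm_indicator_le_norm_self _ _).trans ?_
    simp
  let F : ℕ → bddMeas S := fun k =>
    toBddMeas ((D k).indicator fun _ => 1) (measurable_const.indicator (hDm k)) 1 (hind k)
  have hpow : ∀ n y k, evalBddMeas y ((transitionOp g ^ n) (F k))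
      = (((g ^ n) y).real (D k) : ℂ) := by
    intro n y k
    rw [evalBddMeas_apply, transitionOp_pow_apply]
    change ∫ z, (D k).indicator (fun _ => (1 : ℂ)) z ∂((g ^ n) y) = _
    rw [integral_indicator_const _ (hDm k)]
    simp
  obtain ⟨k, K, hK⟩ := exists_forall_norm_sum_le (norm_transitionOp_le g)
    (isFiniteMultEigenvalue_one hgap) evalBddMeas (fun y v => bddMeas_norm_le v y)
    (fun v hv => Subtype.ext (lp.ext (funext hv))) (F := F)
    (fun k => norm_toBddMeas_le zero_le_one) (fun n y => by
      simp_rw [hpow]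
      have h1 := tendsto_measure_iInter_atTop (μ := (g ^ n) y)
        (fun k => (hDm k).nullMeasurableSet) hD ⟨0, measure_ne_top _ _⟩
      rw [hD0, measure_empty] at h1
      have h2 := (Complex.continuous_ofReal.tendsto _).comp
        ((ENNReal.tendsto_toReal ENNReal.zero_ne_top).comp h1)
      rw [ENNReal.toReal_zero, Complex.ofReal_zero] at h2
      exact h2) hε
  refine ⟨k, K, fun n y => ?_⟩
  have h1 := hK n y
  simp_rw [hpow] at h1
  rw [← Complex.ofReal_sum, Complex.norm_real, Real.norm_eq_abs] at h1
  exact (le_abs_self _).trans h1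

end Transition

end

section

/-! ### Bounded harmonic functions are constant -/

variable {S : Type*} [MeasurableSpace S]

lemma integral_pow_eq_of_harmonic {g : Kernel S S} [IsMarkovKernel g] {h : S → ℝ}
    (hm : Measurable h) {C : ℝ} (hC : ∀ x, |h x| ≤ C) (hh : ∀ x, ∫ y, h y ∂(g x) = h x) (n : ℕ)
    (x : S) : ∫ y, h y ∂((g ^ n) x) = h x := by
  induction n generalizing x with
  | zero =>
    rw [pow_zero]
    change ∫ y, h y ∂(Kernel.id x) = h x
    rw [Kernel.id_apply, integral_dirac' _ _ hm.stronglyMeasurable]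
  | succ n ih =>
    rw [integral_pow_succ g n x hm.stronglyMeasurable hC]
    simp_rw [ih]
    exact hh x

lemma integral_integral_of_invariant {g : Kernel S S} {ρ : Measure S}
    (hρ : Kernel.Invariant g ρ) {f : S → ℝ} (hf : Integrable f ρ) :
    ∫ x, ∫ y, f y ∂(g x) ∂ρ = ∫ x, f x ∂ρ := by
  have h1 : g ∘ₖ Kernel.const Unit ρ = Kernel.const Unit ρ := by
    rw [Kernel.comp_const, hρ.def]
  have h2 : Integrable f ((g ∘ₖ Kernel.const Unit ρ) ()) := by
    rwa [h1, Kernel.const_apply]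
  have h3 := Kernel.integral_comp h2
  rw [h1, Kernel.const_apply] at h3
  exact h3.symm

namespace Regeneration

variable {g : Kernel S S} (R : Regeneration g)

lemma smul_le {x : S} (hx : x ∈ R.B) : R.e • R.ν ≤ g x := by
  classical
  have h1 : R.r x = R.e • R.ν := by
    unfold r regenKernel
    simp [Kernel.piecewise_apply, hx]
  have h2 : g x = R.k x + R.r x := by
    conv_lhs => rw [R.eq_add']
    rfl
  rw [h2, h1]
  exact Measure.le_add_left le_rfl

lemma ae_ν_of_ae {x : S} (hx : x ∈ R.B) {p : S → Prop} (h : ∀ᵐ y ∂(g x), p y) :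
    ∀ᵐ y ∂(R.ν), p y :=
  by
  have h1 := ae_mono (R.smul_le hx) h
  rwa [Measure.ae_ennreal_smul_measure_eq R.e_ne_zero] at h1

/-- A stationary martingale does not move, so a bounded harmonic function is constant along the
stationary chain, and takes a single value after a regeneration. -/
lemma exists_ae_eq_const_of_harmonic [IsMarkovKernel g] {ρ : Measure S} [IsProbabilityMeasure ρ]
    (hρ : Kernel.Invariant g ρ) (hB : ρ R.B ≠ 0) {h : S → ℝ} (hm : Measurable h) {C : ℝ}
    (hC : ∀ x, |h x| ≤ C) (hh : ∀ x, ∫ y, h y ∂(g x) = h x) : ∃ c, ∀ᵐ y ∂(R.ν), h y = c := by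
  have hi : ∀ x, Integrable h (g x) := fun x =>
    Integrable.of_bound hm.aestronglyMeasurable C (ae_of_all _ hC)
  have hb2 : ∀ x, ‖h x ^ 2‖ ≤ C ^ 2 := fun x => by
    rw [norm_pow]; exact pow_le_pow_left₀ (norm_nonneg _) (hC x) 2
  have hi2 : ∀ (μ : Measure S) [IsFiniteMeasure μ], Integrable (fun y => h y ^ 2) μ := fun μ _ =>
    Integrable.of_bound (hm.pow_const 2).aestronglyMeasurable (C ^ 2) (ae_of_all _ hb2)
  have hvar : ∀ x, ∫ y, (h y - h x) ^ 2 ∂(g x) = ∫ y, h y ^ 2 ∂(g x) - h x ^ 2 := by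
    intro x
    have h1 : ∀ y, (h y - h x) ^ 2 = h y ^ 2 - (2 * h x * h y - h x ^ 2) := fun y => by ring
    simp_rw [h1]
    have h2 : Integrable (fun y => 2 * h x * h y - h x ^ 2) (g x) :=
      ((hi x).const_mul _).sub (integrable_const _)
    rw [integral_sub (hi2 _) h2,
      integral_sub ((hi x).const_mul _) (integrable_const _), integral_const_mul, hh x]
    simp only [integral_const, probReal_univ, one_smul]
    ring
  have hP2 : ∫ x, ∫ y, h y ^ 2 ∂(g x) ∂ρ = ∫ x, h x ^ 2 ∂ρ := by
    exact integral_integral_of_invariant hρ (hi2 ρ)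
  have hPm : Integrable (fun x => ∫ y, h y ^ 2 ∂(g x)) ρ :=
    Integrable.of_bound
      ((hm.pow_const 2).stronglyMeasurable.integral_kernel).aestronglyMeasurable (C ^ 2)
      (ae_of_all _ fun x => by
        have := norm_integral_le_of_norm_le_const (μ := g x) (ae_of_all _ hb2)
        simpa using this)
  have h0 : ∫ x, ∫ y, (h y - h x) ^ 2 ∂(g x) ∂ρ = 0 := by
    simp_rw [hvar]
    rw [integral_sub hPm (hi2 ρ), hP2, sub_self]
  have h1 : (fun x => ∫ y, (h y - h x) ^ 2 ∂(g x)) =ᵐ[ρ] 0 := by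
    refine (integral_eq_zero_iff_of_nonneg (fun x => integral_nonneg fun y => sq_nonneg _) ?_).1 h0
    simp_rw [hvar]
    exact hPm.sub (hi2 ρ)
  obtain ⟨x, hxB, hx⟩ : ∃ x ∈ R.B, ∫ y, (h y - h x) ^ 2 ∂(g x) = 0 := by
    by_contra! hcon
    exact hB (measure_mono_null (fun x hx => hcon x hx) h1)
  have h2 : (fun y => (h y - h x) ^ 2) =ᵐ[g x] 0 := by
    refine (integral_eq_zero_iff_of_nonneg (fun y => sq_nonneg _) ?_).1 hx
    refine Integrable.of_bound ((hm.sub measurable_const).pow_const 2).aestronglyMeasurable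
      ((C + C) ^ 2) (ae_of_all _ fun y => ?_)
    rw [norm_pow]
    refine pow_le_pow_left₀ (norm_nonneg _) ((norm_sub_le _ _).trans (add_le_add (hC y) (hC x))) 2
  refine ⟨h x, R.ae_ν_of_ae hxB (h2.mono fun y hy => ?_)⟩
  have : (h y - h x) ^ 2 = 0 := hy
  nlinarith [this]

/-- Maximum principle: since every state leads to a regeneration, a harmonic function that vanishes
after regenerations does not attain a positive maximum. -/
lemma lt_of_harmonic [IsMarkovKernel g] (hacc : ∀ z, ∃ n : ℕ, (g ^ n) z R.B ≠ 0) {h : S → ℝ}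
    (hm : Measurable h) {C : ℝ} (hC : ∀ x, |h x| ≤ C) (hh : ∀ x, ∫ y, h y ∂(g x) = h x)
    (h0 : ∀ᵐ y ∂(R.ν), h y = 0) {s : ℝ} (hs : 0 < s) (hle : ∀ x, h x ≤ s) (x : S) : h x < s := by
  refine lt_of_le_of_ne (hle x) fun heq => ?_
  obtain ⟨n, hn⟩ := hacc x
  have h1 : ∫ y, (s - h y) ∂((g ^ (n + 1)) x) = 0 := by
    rw [integral_sub (integrable_const _)
      (Integrable.of_bound hm.aestronglyMeasurable C (ae_of_all _ hC)),
      integral_pow_eq_of_harmonic hm hC hh, heq]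
    simp
  have h2 : (fun y => s - h y) =ᵐ[(g ^ (n + 1)) x] 0 := by
    refine (integral_eq_zero_iff_of_nonneg (fun y => sub_nonneg.2 (hle y)) ?_).1 h1
    exact (integrable_const _).sub
      (Integrable.of_bound hm.aestronglyMeasurable C (ae_of_all _ hC))
  rw [pow_succ'] at h2
  have h3 : ∀ᵐ y ∂((g ^ n) x), ∀ᵐ z ∂(g y), s - h z = 0 := Kernel.ae_ae_of_ae_comp h2
  obtain ⟨y, hyB, hy⟩ : ∃ y ∈ R.B, ∀ᵐ z ∂(g y), s - h z = 0 := by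
    by_contra hcon
    exact hn (measure_mono_null (fun y hy hy' => hcon ⟨y, hy, hy'⟩) h3)
  obtain ⟨z, hz1, hz2⟩ := (h0.and (R.ae_ν_of_ae hyB hy)).exists
  linarith

/-- The key step: a harmonic function that vanishes after regenerations is nonpositive. Otherwise
its supremum `s > 0` is not attained, so the sets `D = {h > s - 1/(k+1)}` decrease to the empty set,
while chains started deep inside `D` remain there most of the time. The ergodic decompositions of
the indicators of these sets contradict each other, because the harmonic parts live in a
finite-dimensional space. -/
lemma le_zero_of_harmonic [IsMarkovKernel g] (hgap : HasSpectralGap g)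
    (hacc : ∀ z, ∃ n : ℕ, (g ^ n) z R.B ≠ 0) {h : S → ℝ} (hm : Measurable h) {C : ℝ}
    (hC : ∀ x, |h x| ≤ C) (hh : ∀ x, ∫ y, h y ∂(g x) = h x) (h0 : ∀ᵐ y ∂(R.ν), h y = 0) (x : S) :
    h x ≤ 0 := by
  by_contra! hx
  have : Nonempty S := ⟨x⟩
  have hbdd : BddAbove (range h) := ⟨C, by rintro _ ⟨y, rfl⟩; exact (abs_le.1 (hC y)).2⟩
  set s := ⨆ y, h y with hs
  have hle : ∀ y, h y ≤ s := fun y => le_ciSup hbdd y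
  have hs0 : 0 < s := hx.trans_le (hle x)
  have hlt := R.lt_of_harmonic hacc hm hC hh h0 hs0 hle
  let D : ℕ → Set S := fun k => {y | s - 1 / (k + 1) < h y}
  have hDm : ∀ k, MeasurableSet (D k) := fun k => measurableSet_lt measurable_const hm
  have hDanti : Antitone D := by
    intro k l hkl y hy
    have h1 : (1 : ℝ) / (l + 1) ≤ 1 / (k + 1) := Nat.one_div_le_one_div hkl
    have h2 : s - 1 / (l + 1) < h y := hy
    change s - 1 / (k + 1) < h y
    linarith
  have hDempty : ⋂ k, D k = ∅ := by
    refine eq_empty_of_forall_notMem fun y hy => ?_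
    obtain ⟨k, hk⟩ := exists_nat_one_div_lt (sub_pos.2 (hlt y))
    have h2 : s - 1 / (k + 1) < h y := mem_iInter.1 hy k
    linarith
  obtain ⟨k, K, hK⟩ := exists_forall_sum_pow_le hgap hDm hDanti hDempty
    (show (0 : ℝ) < 1 / 4 by norm_num)
  -- a chain started where `h` is close to its supremum spends most of its time in `D k`
  have hk0 : (0 : ℝ) < k + 1 := by positivity
  obtain ⟨y, hy⟩ := exists_lt_of_lt_ciSup (show s - 1 / (4 * (k + 1)) < ⨆ y, h y by
    rw [← hs]; linarith [show (0 : ℝ) < 1 / (4 * (k + 1)) by positivity])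
  have hstay : ∀ n, 3 / 4 ≤ ((g ^ n) y).real (D k) := by
    intro n
    have hint : Integrable (fun z => s - h z) ((g ^ n) y) := (integrable_const _).sub
      (Integrable.of_bound hm.aestronglyMeasurable C (ae_of_all _ hC))
    have h1 := mul_meas_ge_le_integral_of_nonneg (ae_of_all _ fun z => sub_nonneg.2 (hle z)) hint
      (1 / (k + 1) : ℝ)
    have h2 : ∫ z, (s - h z) ∂((g ^ n) y) = s - h y := by
      rw [integral_sub (integrable_const _)
        (Integrable.of_bound hm.aestronglyMeasurable C (ae_of_all _ hC)),
        integral_pow_eq_of_harmonic hm hC hh]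
      simp
    have h3 : {z | 1 / ((k : ℝ) + 1) ≤ s - h z} = (D k)ᶜ := by
      ext z
      simp only [D, mem_ofPred_eq, mem_compl_iff, not_lt]
      constructor <;> intro h4 <;> linarith
    rw [h2, h3, probReal_compl_eq_one_sub (hDm k)] at h1
    have h5 : s - h y < 1 / (4 * (k + 1)) := by linarith
    have h6 : (1 : ℝ) / (4 * (k + 1)) = 1 / (k + 1) * (1 / 4) := by
      field_simp
    have h7 : 1 - ((g ^ n) y).real (D k) < 1 / 4 := by
      refine lt_of_mul_lt_mul_left ?_ (by positivity : (0 : ℝ) ≤ 1 / (k + 1))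
      linarith
    linarith
  obtain ⟨n, hn⟩ := exists_nat_gt (2 * K)
  have h1 := hK n y
  have h2 : (n : ℝ) * (3 / 4) ≤ ∑ i ∈ Finset.range n, ((g ^ i) y).real (D k) := by
    have := Finset.card_nsmul_le_sum (Finset.range n) (fun i => ((g ^ i) y).real (D k)) (3 / 4)
      fun i _ => hstay i
    simpa using this
  linarith

end Regeneration

end

section

variable {S : Type*} [MeasurableSpace S]

lemma lintegral_lintegral_of_invariant {g : Kernel S S} {ρ : Measure S}
    (hρ : Kernel.Invariant g ρ) {f : S → ℝ≥0∞} (hf : Measurable f) :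
    ∫⁻ x, ∫⁻ y, f y ∂(g x) ∂ρ = ∫⁻ x, f x ∂ρ := by
  conv_rhs => rw [← hρ.def]
  rw [Measure.lintegral_bind g.aemeasurable hf.aemeasurable]

lemma invariant_pow {g : Kernel S S} {ρ : Measure S} (hρ : Kernel.Invariant g ρ) (n : ℕ) :
    Kernel.Invariant (g ^ n) ρ := by
  induction n with
  | zero =>
    rw [pow_zero]
    change ρ.bind Kernel.id = ρ
    exact Measure.id_comp
  | succ n ih => rw [pow_succ]; exact ih.comp hρ

namespace Regeneration

variable {g : Kernel S S} (R : Regeneration g)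

lemma measure_B_ne_zero {ρ : Measure S} [IsProbabilityMeasure ρ] (hρ : Kernel.Invariant g ρ)
    (hacc : ∀ z, ∃ n : ℕ, (g ^ n) z R.B ≠ 0) : ρ R.B ≠ 0 := by
  intro h0
  have h1 : ∀ n : ℕ, ∀ᵐ z ∂ρ, (g ^ n) z R.B = 0 := by
    intro n
    have h2 : ρ.bind (g ^ n) R.B = 0 := by rw [(invariant_pow hρ n).def, h0]
    rw [Measure.bind_apply R.measurableSet_B (g ^ n).aemeasurable,
      lintegral_eq_zero_iff ((g ^ n).measurable_coe R.measurableSet_B)] at h2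
    exact h2
  obtain ⟨z, hz⟩ := (ae_all_iff.2 h1).exists
  obtain ⟨n, hn⟩ := hacc z
  exact hn (hz n)

lemma exists_eq_const_of_harmonic [IsMarkovKernel g] (hgap : HasSpectralGap g) {ρ : Measure S}
    [IsProbabilityMeasure ρ] (hρ : Kernel.Invariant g ρ)
    (hacc : ∀ z, ∃ n : ℕ, (g ^ n) z R.B ≠ 0) {h : S → ℝ} (hm : Measurable h) {C : ℝ}
    (hC : ∀ x, |h x| ≤ C) (hh : ∀ x, ∫ y, h y ∂(g x) = h x) :
    ∃ c, (∀ x, h x = c) := by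
  obtain ⟨c, hc⟩ := R.exists_ae_eq_const_of_harmonic hρ (R.measure_B_ne_zero hρ hacc) hm hC hh
  refine ⟨c, fun x => ?_⟩
  have hi : ∀ x, Integrable h (g x) := fun x =>
    Integrable.of_bound hm.aestronglyMeasurable C (ae_of_all _ hC)
  have h1 := R.le_zero_of_harmonic hgap hacc (h := fun x => h x - c) (hm.sub_const c)
    (C := C + |c|) (fun x => (abs_sub _ _).trans (add_le_add_left (hC x) _)) (fun x => by
      rw [integral_sub (hi x) (integrable_const _),
        hh x]; simp) (hc.mono fun y hy => by simp [hy]) x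
  have h2 := R.le_zero_of_harmonic hgap hacc (h := fun x => c - h x) (hm.const_sub c)
    (C := |c| + C) (fun x => (abs_sub _ _).trans (add_le_add_right (hC x) _)) (fun x => by
      rw [integral_sub (integrable_const _) (hi x),
        hh x]; simp) (hc.mono fun y hy => by simp [hy]) x
  linarith

/-- Solvability of the Poisson equation. -/
lemma exists_poisson [IsMarkovKernel g] (hgap : HasSpectralGap g) {ρ : Measure S}
    [IsProbabilityMeasure ρ] (hρ : Kernel.Invariant g ρ)
    (hacc : ∀ z, ∃ n : ℕ, (g ^ n) z R.B ≠ 0) {c : S → ℝ} (hc : Measurable c) {M : ℝ}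
    (hM : ∀ x, |c x| ≤ M) :
    ∃ (h : S → ℝ) (C : ℝ), Measurable h ∧ (∀ x, |h x| ≤ C) ∧
      ∀ x, c x - ∫ y, c y ∂ρ = h x - ∫ y, h y ∂(g x) := by
  have hne : Nonempty S := nonempty_of_isProbabilityMeasure ρ
  obtain ⟨K, hK⟩ := exists_ergodic_decomposition (norm_transitionOp_le g)
    (isFiniteMultEigenvalue_one hgap)
  obtain ⟨u, w, hu, hf, -, -⟩ := hK (toBddMeas (fun x => (c x : ℂ))
    (Complex.measurable_ofReal.comp hc) M (fun x => by simpa using hM x))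
  have hre : ∀ (v : bddMeas S), Measurable fun x => (v.1 x).re := fun v =>
    Complex.measurable_re.comp (bddMeas_measurable v)
  have hreb : ∀ (v : bddMeas S) x, |(v.1 x).re| ≤ ‖v‖ := fun v x =>
    (Complex.abs_re_le_norm _).trans (bddMeas_norm_le v x)
  have hreP : ∀ (v : bddMeas S) x, ((transitionOp g v).1 x).re = ∫ y, (v.1 y).re ∂(g x) := by
    intro v x
    rw [transitionOp_apply]
    exact (integral_re (bddMeas_integrable v (g x))).symm
  obtain ⟨a, ha⟩ := R.exists_eq_const_of_harmonic hgap hρ hacc (hre u) (hreb u)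
    (fun x => by rw [← hreP, hu])
  obtain ⟨v, hvm, hvb, hdec⟩ : ∃ v : S → ℝ, Measurable v ∧ (∀ x, |v x| ≤ ‖w‖) ∧
      ∀ x, c x = a + (∫ y, v y ∂(g x) - v x) := by
    refine ⟨fun x => (w.1 x).re, hre w, hreb w, fun x => ?_⟩
    have h1 : (c x : ℂ) = u.1 x + ((transitionOp g w).1 x - w.1 x) := by
      have h2 := congrArg (fun v : bddMeas S => v.1 x) hf
      exact h2
    have h2 := congrArg Complex.re h1
    rw [Complex.ofReal_re, Complex.add_re, Complex.sub_re, hreP, ha] at h2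
    exact h2
  have hvi : Integrable v ρ := Integrable.of_bound hvm.aestronglyMeasurable ‖w‖ (ae_of_all _ hvb)
  have hPvi : Integrable (fun x => ∫ y, v y ∂(g x)) ρ :=
    Integrable.of_bound (hvm.stronglyMeasurable.integral_kernel).aestronglyMeasurable ‖w‖
      (ae_of_all _ fun x => by
        have := norm_integral_le_of_norm_le_const (μ := g x) (f := v) (ae_of_all _ hvb)
        simpa using this)
  have hint : ∫ x, c x ∂ρ = a := by
    have h1 : Integrable (fun x => ∫ y, v y ∂(g x) - v x) ρ := hPvi.sub hvi
    simp_rw [hdec]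
    rw [integral_add (integrable_const _) h1, integral_sub hPvi hvi,
      integral_integral_of_invariant hρ hvi]
    simp
  refine ⟨fun x => -v x, ‖w‖, hvm.neg, fun x => by simpa using hvb x, fun x => ?_⟩
  rw [hint, hdec x, integral_neg]
  ring

/-! ### The chain regenerates almost surely -/

lemma lintegral_eq_add (x : S) (f : S → ℝ≥0∞) :
    ∫⁻ y, f y ∂(g x) = ∫⁻ y, f y ∂(R.k x) + R.B.indicator (fun _ => R.e) x * ∫⁻ y, f y ∂(R.ν) := by
  have h2 : g x = R.k x + R.r x := by
    conv_lhs => rw [R.eq_add']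
    rfl
  rw [h2, lintegral_add_measure, r, lintegral_regenKernel]

lemma k_univ_add [IsMarkovKernel g] (x : S) :
    R.k x univ + R.B.indicator (fun _ => R.e) x = 1 := by
  have h := R.lintegral_eq_add x (fun _ => 1)
  simpa using h.symm

lemma k_pow_univ_add_sum [IsMarkovKernel g] (x : S) (n : ℕ) :
    (R.k ^ n) x univ + ∑ i ∈ Finset.range n, ∫⁻ y, R.B.indicator (fun _ => R.e) y ∂((R.k ^ i) x)
      = 1 := by
  have hm : Measurable (R.B.indicator fun _ => R.e) := measurable_const.indicator R.measurableSet_B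
  induction n with
  | zero =>
    have : (R.k ^ 0) x univ = ∫⁻ _, 1 ∂((R.k ^ 0) x) := by simp
    rw [Finset.range_zero, Finset.sum_empty, add_zero, this,
      lintegral_pow_zero _ _ measurable_const]
  | succ n ih =>
    rw [Finset.sum_range_succ, add_comm (Finset.sum _ _), ← add_assoc]
    have h1 : (R.k ^ (n + 1)) x univ = ∫⁻ y, R.k y univ ∂((R.k ^ n) x) := by
      have h2 := lintegral_pow_succ' R.k n x (f := fun _ => 1) measurable_const
      simpa using h2
    rw [h1, ← lintegral_add_right _ hm]
    simp_rw [R.k_univ_add]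
    rw [lintegral_one]
    exact ih

lemma antitone_k_pow_univ [IsMarkovKernel g] (x : S) : Antitone fun n => (R.k ^ n) x univ := by
  refine antitone_nat_of_succ_le fun n => ?_
  have h2 := lintegral_pow_succ' R.k n x (f := fun _ => 1) measurable_const
  simp only [lintegral_one] at h2
  rw [h2]
  calc ∫⁻ y, R.k y univ ∂((R.k ^ n) x) ≤ ∫⁻ _, 1 ∂((R.k ^ n) x) :=
        lintegral_mono fun y => (self_le_add_right _ _).trans_eq (R.k_univ_add y)
    _ = (R.k ^ n) x univ := lintegral_one

/-- The probability never to regenerate is a harmonic function; it has mean zero after a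
regeneration by invariance of `ρ`, so it vanishes identically. -/
lemma iInf_k_pow_univ [IsMarkovKernel g] (hgap : HasSpectralGap g) {ρ : Measure S}
    [IsProbabilityMeasure ρ] (hρ : Kernel.Invariant g ρ)
    (hacc : ∀ z, ∃ n : ℕ, (g ^ n) z R.B ≠ 0) (x : S) : ⨅ n, (R.k ^ n) x univ = 0 := by
  set q : S → ℝ≥0∞ := fun x => ⨅ n, (R.k ^ n) x univ with hq
  have hpm : ∀ n, Measurable fun x => (R.k ^ n) x univ := fun n =>
    (R.k ^ n).measurable_coe MeasurableSet.univ
  have hqm : Measurable q := Measurable.iInf hpm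
  have hp1 : ∀ n x, (R.k ^ n) x univ ≤ 1 := fun n x =>
    (self_le_add_right _ _).trans_eq (R.k_pow_univ_add_sum x n)
  have hq1 : ∀ x, q x ≤ 1 := fun x => (iInf_le _ 0).trans (hp1 0 x)
  have hkq : ∀ x, ∫⁻ y, q y ∂(R.k x) = q x := by
    intro x
    have h1 : ∫⁻ y, q y ∂(R.k x) = ⨅ n, ∫⁻ y, (R.k ^ n) y univ ∂(R.k x) := by
      refine lintegral_iInf hpm (fun m n hmn y => R.antitone_k_pow_univ y hmn) ?_
      refine ne_top_of_le_ne_top (measure_ne_top (R.k x) univ) ?_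
      rw [← lintegral_one]
      exact lintegral_mono fun y => hp1 0 y
    have h2 : ∀ n, ∫⁻ y, (R.k ^ n) y univ ∂(R.k x) = (R.k ^ (n + 1)) x univ := by
      intro n
      have h3 := lintegral_pow_succ R.k n x (f := fun _ => 1) measurable_const
      simpa using h3.symm
    rw [h1]
    simp_rw [h2]
    refine le_antisymm (le_iInf fun n => ?_) (le_iInf fun n => iInf_le _ _)
    exact (iInf_le _ n).trans (R.antitone_k_pow_univ x (Nat.le_succ n))
  have hgq : ∀ x, ∫⁻ y, q y ∂(g x)
      = q x + R.B.indicator (fun _ => R.e) x * ∫⁻ y, q y ∂(R.ν) := fun x => by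
    rw [R.lintegral_eq_add, hkq]
  have hρq : ∫⁻ x, q x ∂ρ ≠ ∞ := by
    refine ne_top_of_le_ne_top ENNReal.one_ne_top ?_
    calc ∫⁻ x, q x ∂ρ ≤ ∫⁻ _, 1 ∂ρ := lintegral_mono hq1
      _ = 1 := by simp
  have hνq : ∫⁻ y, q y ∂(R.ν) = 0 := by
    have h1 := lintegral_lintegral_of_invariant hρ hqm
    simp_rw [hgq] at h1
    rw [lintegral_add_left hqm] at h1
    have h2 : ∫⁻ x, R.B.indicator (fun _ => R.e) x * ∫⁻ y, q y ∂(R.ν) ∂ρ = 0 := by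
      have h3 : ∫⁻ x, q x ∂ρ + ∫⁻ x, R.B.indicator (fun _ => R.e) x * ∫⁻ y, q y ∂(R.ν) ∂ρ
          = ∫⁻ x, q x ∂ρ + 0 := by rw [h1, add_zero]
      exact (ENNReal.add_right_inj hρq).1 h3
    rw [lintegral_mul_const _ (measurable_const.indicator R.measurableSet_B),
      lintegral_indicator_const R.measurableSet_B] at h2
    exact (mul_eq_zero.1 h2).resolve_left
      (mul_ne_zero R.e_ne_zero (R.measure_B_ne_zero hρ hacc))
  simp_rw [hνq, mul_zero, add_zero] at hgq
  have hqt : ∀ x, q x ≠ ∞ := fun x => ne_top_of_le_ne_top ENNReal.one_ne_top (hq1 x)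
  obtain ⟨c, hc⟩ := R.exists_eq_const_of_harmonic hgap hρ hacc (h := fun x => (q x).toReal)
    hqm.ennreal_toReal (C := 1) (fun x => by
      rw [abs_of_nonneg ENNReal.toReal_nonneg]
      exact ENNReal.toReal_le_of_le_ofReal zero_le_one (by simpa using hq1 x)) (fun x => by
      rw [integral_toReal hqm.aemeasurable (ae_of_all _ fun y => (hqt y).lt_top), hgq])
  have h0 : ∀ᵐ y ∂(R.ν), q y = 0 := (lintegral_eq_zero_iff hqm).1 hνq
  obtain ⟨y, hy⟩ := h0.exists
  have hc0 : c = 0 := by rw [← hc y, hy]; simp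
  have hx := hc x
  rw [hc0, ENNReal.toReal_eq_zero_iff] at hx
  exact hx.resolve_right (hqt x)

lemma tendsto_k_pow_univ [IsMarkovKernel g] (hgap : HasSpectralGap g) {ρ : Measure S}
    [IsProbabilityMeasure ρ] (hρ : Kernel.Invariant g ρ)
    (hacc : ∀ z, ∃ n : ℕ, (g ^ n) z R.B ≠ 0) (x : S) :
    Tendsto (fun n => (R.k ^ n) x univ) atTop (𝓝 0) := by
  rw [← R.iInf_k_pow_univ hgap hρ hacc x]
  exact tendsto_atTop_iInf (R.antitone_k_pow_univ x)

lemma lintegral_potential_indicator [IsMarkovKernel g] (hgap : HasSpectralGap g) {ρ : Measure S}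
    [IsProbabilityMeasure ρ] (hρ : Kernel.Invariant g ρ)
    (hacc : ∀ z, ∃ n : ℕ, (g ^ n) z R.B ≠ 0) (x : S) :
    ∫⁻ y, R.B.indicator (fun _ => R.e) y ∂(potential R.k x) = 1 := by
  rw [lintegral_potential]
  have h1 := ENNReal.tendsto_nat_tsum
    fun i => ∫⁻ y, R.B.indicator (fun _ => R.e) y ∂((R.k ^ i) x)
  have h2 := (R.tendsto_k_pow_univ hgap hρ hacc x).add h1
  simp_rw [R.k_pow_univ_add_sum, zero_add] at h2
  exact tendsto_nhds_unique h2 tendsto_const_nhds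

lemma isMarkovKernel_cycleKernel [IsMarkovKernel g] (hgap : HasSpectralGap g) {ρ : Measure S}
    [IsProbabilityMeasure ρ] (hρ : Kernel.Invariant g ρ)
    (hacc : ∀ z, ∃ n : ℕ, (g ^ n) z R.B ≠ 0) (κ : Kernel S ℝ) [IsMarkovKernel κ] :
    IsMarkovKernel (R.cycleKernel κ) :=
  ⟨fun l => ⟨by
    rw [R.cycleKernel_univ, R.lintegral_potential_indicator hgap hρ hacc]⟩⟩

/-- The expected occupation of a cycle is proportional to the invariant measure. -/
lemma lintegral_potential_k [IsMarkovKernel g] (hgap : HasSpectralGap g) {ρ : Measure S}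
    [IsProbabilityMeasure ρ] (hρ : Kernel.Invariant g ρ)
    (hacc : ∀ z, ∃ n : ℕ, (g ^ n) z R.B ≠ 0) {c : S → ℝ≥0∞} (hc : Measurable c)
    (hc1 : ∀ x, c x ≤ 1) :
    R.e * ρ R.B * ∫⁻ l, ∫⁻ y, c y ∂(potential R.k l) ∂(R.ν) = ∫⁻ l, c l ∂ρ := by
  have hstep : ∀ {f : S → ℝ≥0∞}, Measurable f → ∫⁻ l, f l ∂ρ
      = ∫⁻ l, ∫⁻ y, f y ∂(R.k l) ∂ρ + R.e * ρ R.B * ∫⁻ l, f l ∂(R.ν) := by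
    intro f hf
    rw [← lintegral_lintegral_of_invariant hρ hf]
    simp_rw [R.lintegral_eq_add]
    rw [lintegral_add_left hf.lintegral_kernel,
      lintegral_mul_const _ (measurable_const.indicator R.measurableSet_B),
      lintegral_indicator_const R.measurableSet_B]
  have hN : ∀ n, ∫⁻ l, ∫⁻ y, c y ∂((R.k ^ n) l) ∂ρ
      + ∑ i ∈ Finset.range n, R.e * ρ R.B * ∫⁻ l, ∫⁻ y, c y ∂((R.k ^ i) l) ∂(R.ν)
      = ∫⁻ l, c l ∂ρ := by
    intro n
    induction n with
    | zero =>
      simp_rw [lintegral_pow_zero R.k _ hc]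
      simp
    | succ n ih =>
      rw [Finset.sum_range_succ, add_comm (Finset.sum _ _), ← add_assoc]
      simp_rw [lintegral_pow_succ R.k _ _ hc]
      rw [← hstep hc.lintegral_kernel]
      exact ih
  have hlim : Tendsto (fun n => ∫⁻ l, ∫⁻ y, c y ∂((R.k ^ n) l) ∂ρ) atTop (𝓝 0) := by
    have h1 : Tendsto (fun n => ∫⁻ l, (R.k ^ n) l univ ∂ρ) atTop (𝓝 (∫⁻ _, 0 ∂ρ)) := by
      refine tendsto_lintegral_of_dominated_convergence (fun _ => 1)
        (fun n => (R.k ^ n).measurable_coe MeasurableSet.univ) (fun n => ae_of_all _ fun x =>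
          (self_le_add_right _ _).trans_eq (R.k_pow_univ_add_sum x n)) (by simp)
        (ae_of_all _ fun x => R.tendsto_k_pow_univ hgap hρ hacc x)
    rw [lintegral_zero] at h1
    refine tendsto_of_tendsto_of_tendsto_of_le_of_le tendsto_const_nhds h1 (fun _ => zero_le)
      fun n => lintegral_mono fun l => ?_
    calc ∫⁻ y, c y ∂((R.k ^ n) l) ≤ ∫⁻ _, 1 ∂((R.k ^ n) l) := lintegral_mono hc1
      _ = (R.k ^ n) l univ := lintegral_one
  have h2 := hlim.add (ENNReal.tendsto_nat_tsum
    fun i => R.e * ρ R.B * ∫⁻ l, ∫⁻ y, c y ∂((R.k ^ i) l) ∂(R.ν))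
  simp_rw [hN, zero_add] at h2
  have h3 := tendsto_nhds_unique h2 tendsto_const_nhds
  rw [← h3, ENNReal.tsum_mul_left]
  congr 1
  simp_rw [lintegral_potential]
  exact lintegral_tsum fun i => hc.lintegral_kernel.aemeasurable

end Regeneration

end

section

variable {S : Type*} [MeasurableSpace S]

/-! ### The law of the process at a fixed step -/

/-- The sum of the first `n` of a sequence of independent variables is independent of the next
one. -/
lemma lintegral_infinitePi_sum_range (μ : ℕ → Measure ℝ) [∀ i, IsProbabilityMeasure (μ i)] (n : ℕ)
    {w : ℝ → ℝ → ℝ≥0∞} (hw : Measurable fun p : ℝ × ℝ => w p.1 p.2) :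
    ∫⁻ x, w (∑ j ∈ Finset.range n, x j) (x n) ∂(Measure.infinitePi μ)
      = ∫⁻ x, ∫⁻ z, w (∑ j ∈ Finset.range n, x j) z ∂(μ n) ∂(Measure.infinitePi μ) := by
  have hi : iIndepFun (fun i (x : ℕ → ℝ) => x i) (Measure.infinitePi μ) :=
    iIndepFun_infinitePi (X := fun _ x => x) (by fun_prop)
  have h2 : IndepFun (fun x : ℕ → ℝ => ∑ j ∈ Finset.range n, x j) (fun x => x n)
      (Measure.infinitePi μ) := by
    have := hi.indepFun_finsetSum_of_notMem (by fun_prop) (s := Finset.range n) (i := n) (by simp)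
    convert this using 1
    ext x; simp
  have h3 : (Measure.infinitePi μ).map (fun x : ℕ → ℝ => (∑ j ∈ Finset.range n, x j, x n))
      = ((Measure.infinitePi μ).map fun x => ∑ j ∈ Finset.range n, x j).prod (μ n) := by
    rw [h2.map_prod_eq_prod_map_map (by fun_prop) (measurable_pi_apply n).aemeasurable,
      Measure.infinitePi_map_eval]
  calc ∫⁻ x, w (∑ j ∈ Finset.range n, x j) (x n) ∂(Measure.infinitePi μ)
      = ∫⁻ p, w p.1 p.2 ∂((Measure.infinitePi μ).map
          (fun x : ℕ → ℝ => (∑ j ∈ Finset.range n, x j, x n))) := by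
        rw [lintegral_map hw (by fun_prop)]
    _ = ∫⁻ x, ∫⁻ z, w (∑ j ∈ Finset.range n, x j) z ∂(μ n) ∂(Measure.infinitePi μ) := by
        rw [h3, lintegral_prod _ hw.aemeasurable,
          lintegral_map (hw.lintegral_prod_right') (by fun_prop)]

/-- The law of the sum of the first `n` waiting times depends on the first `n` types only. -/
lemma lintegral_infinitePi_congr (κ : Kernel S ℝ) [IsMarkovKernel κ] (n : ℕ) {l l' : ℕ → S}
    (h : ∀ j < n, l j = l' j) {w : ℝ → ℝ≥0∞} (hw : Measurable w) :
    ∫⁻ x, w (∑ j ∈ Finset.range n, x j) ∂(Measure.infinitePi fun j => κ (l j))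
      = ∫⁻ x, w (∑ j ∈ Finset.range n, x j) ∂(Measure.infinitePi fun j => κ (l' j)) := by
  induction n generalizing w with
  | zero => simp
  | succ n ih =>
    simp_rw [Finset.sum_range_succ]
    have hw2 : Measurable fun p : ℝ × ℝ => w (p.1 + p.2) := by fun_prop
    rw [lintegral_infinitePi_sum_range (fun j => κ (l j)) n (w := fun a b => w (a + b)) hw2,
      lintegral_infinitePi_sum_range (fun j => κ (l' j)) n (w := fun a b => w (a + b)) hw2,
      ← h n n.lt_succ_self]
    exact ih (fun j hj => h j (hj.trans n.lt_succ_self)) (w := fun a => ∫⁻ z, w (a + z) ∂(κ (l n)))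
      hw2.lintegral_prod_right'

variable (g : Kernel S S) [IsMarkovKernel g]

lemma lintegral_chainLaw_zero (μ₀ : Measure S) [IsProbabilityMeasure μ₀] {f : S → ℝ≥0∞}
    (hf : Measurable f) : ∫⁻ ω, f (ω 0) ∂(chainLaw g μ₀) = ∫⁻ x, f x ∂μ₀ := by
  have h : (chainLaw g μ₀).map (Preorder.frestrictLe (π := fun _ => S) 0)
      = μ₀.map (MeasurableEquiv.piUnique (fun _ : Finset.Iic 0 => S)).symm := by
    rw [chainLaw, Kernel.trajMeasure, Measure.map_comp _ _ (by fun_prop),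
      Kernel.traj_map_frestrictLe, Kernel.partialTraj_self]
    exact Measure.id_comp
  calc ∫⁻ ω, f (ω 0) ∂(chainLaw g μ₀)
      = ∫⁻ u, f (u ⟨0, by simp⟩) ∂((chainLaw g μ₀).map
        (Preorder.frestrictLe (π := fun _ => S) 0)) := by
        rw [lintegral_map (by fun_prop) (by fun_prop)]; rfl
    _ = ∫⁻ x, f x ∂μ₀ := by
        rw [h, lintegral_map (by fun_prop) (by fun_prop)]; rfl

/-- The Markov property of the chain of types at step `n`. -/
lemma lintegral_chainLaw_succ (μ₀ : Measure S) [IsProbabilityMeasure μ₀] (n : ℕ)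
    {ψ : (ℕ → S) → S → ℝ≥0∞} (hψ : Measurable fun p : (ℕ → S) × S => ψ p.1 p.2)
    (hc : ∀ l l' y, (∀ j ≤ n, l j = l' j) → ψ l y = ψ l' y) :
    ∫⁻ ω, ψ ω (ω (n + 1)) ∂(chainLaw g μ₀) = ∫⁻ ω, ∫⁻ y, ψ ω y ∂(g (ω n)) ∂(chainLaw g μ₀) := by
  -- extend a finite trajectory by its last state
  let ext : (Finset.Iic n → S) → ℕ → S := fun u j =>
    u ⟨min j n, Finset.mem_Iic.2 (min_le_right _ _)⟩
  have hext : Measurable ext := by fun_prop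
  have hr : ∀ ω y, ψ (ext (Preorder.frestrictLe (π := fun _ => S) n ω)) y = ψ ω y := by
    intro ω y
    refine hc _ _ _ fun j hj => ?_
    simp [ext, min_eq_left hj]
  have hm : Measurable fun p : (Finset.Iic n → S) × S => ψ (ext p.1) p.2 :=
    hψ.comp (by fun_prop : Measurable fun p : (Finset.Iic n → S) × S => (ext p.1, p.2))
  have h := Kernel.map_frestrictLe_trajMeasure_compProd_eq_map_trajMeasure (X := fun _ => S)
    (μ₀ := μ₀) (κ := fun n => g.comap (fun h : (Finset.Iic n → S) => h ⟨n, Finset.mem_Iic.2 le_rfl⟩)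
      (measurable_pi_apply _)) (a := n)
  calc ∫⁻ ω, ψ ω (ω (n + 1)) ∂(chainLaw g μ₀)
      = ∫⁻ p, ψ (ext p.1) p.2 ∂((chainLaw g μ₀).map
          fun x => (Preorder.frestrictLe (π := fun _ => S) n x, x (n + 1))) := by
        rw [lintegral_map hm (by fun_prop)]
        simp_rw [hr]
    _ = ∫⁻ ω, ∫⁻ y, ψ ω y ∂(g (ω n)) ∂(chainLaw g μ₀) := by
        rw [chainLaw, ← h, Measure.lintegral_compProd hm,
          lintegral_map (Measurable.lintegral_kernel_prod_right' hm) (by fun_prop)]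
        simp_rw [hr]
        rfl

variable (κ : Kernel S ℝ) [IsMarkovKernel κ]

lemma measurable_lintegral_waitKernel {T : Type*} [MeasurableSpace T]
    {f : T → (ℕ → S) → (ℕ → ℝ) → ℝ≥0∞}
    (hf : Measurable fun p : T × (ℕ → S) × (ℕ → ℝ) => f p.1 p.2.1 p.2.2) :
    Measurable fun q : T × (ℕ → S) =>
      ∫⁻ x, f q.1 q.2 x ∂(Measure.infinitePi fun j => κ (q.2 j)) := by
  have h : Measurable fun p : (T × (ℕ → S)) × (ℕ → ℝ) => f p.1.1 p.1.2 p.2 :=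
    hf.comp (by fun_prop : Measurable fun p : (T × (ℕ → S)) × (ℕ → ℝ) => (p.1.1, p.1.2, p.2))
  exact Measurable.lintegral_kernel_prod_right'
    (κ := (waitKernel κ).comap (Prod.snd : T × (ℕ → S) → _) measurable_snd) h

lemma lintegral_renewalLaw (l₀ : S) {f : (ℕ → S) → (ℕ → ℝ) → ℝ≥0∞}
    (hf : Measurable fun p : (ℕ → S) × (ℕ → ℝ) => f p.1 p.2) :
    ∫⁻ ω, f ω.1 ω.2 ∂(renewalLaw g κ l₀)
      = ∫⁻ l, ∫⁻ x, f l x ∂(Measure.infinitePi fun j => κ (l j))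
          ∂(chainLaw g (Measure.dirac l₀)) := by
  rw [renewalLaw, Measure.lintegral_compProd hf]
  rfl

/-- The type and the remaining time before step `n` follow the kernel `stepKernel g κ ^ n`. -/
lemma lintegral_renewalLaw_eq (l₀ : S) (t : ℝ) (n : ℕ) {f : S × ℝ → ℝ≥0∞} (hf : Measurable f) :
    ∫⁻ ω, f (ω.1 n, t - ∑ j ∈ Finset.range n, ω.2 j) ∂(renewalLaw g κ l₀)
      = ∫⁻ y, f y ∂((stepKernel g κ ^ n) (l₀, t)) := by
  induction n generalizing f with
  | zero =>
    rw [lintegral_renewalLaw g κ l₀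
      (f := fun l x => f (l 0, t - ∑ j ∈ Finset.range 0, x j)) (by fun_prop),
      lintegral_pow_zero _ _ hf]
    simp only [Finset.range_zero, Finset.sum_empty, sub_zero, lintegral_const, measure_univ,
      mul_one]
    rw [lintegral_chainLaw_zero g _ (f := fun l => f (l, t)) (by fun_prop),
      lintegral_dirac' _ (by fun_prop)]
  | succ n ih =>
    have hF : Measurable fun p : S × (ℕ → S) × (ℕ → ℝ) =>
        f (p.1, t - ∑ j ∈ Finset.range (n + 1), p.2.2 j) := by fun_prop
    have hm := (measurable_lintegral_waitKernel κ
      (f := fun y _ x => f (y, t - ∑ j ∈ Finset.range (n + 1), x j)) hF).comp measurable_swap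
    rw [lintegral_pow_succ' _ _ _ hf, ← ih hf.lintegral_kernel, lintegral_renewalLaw g κ l₀
      (f := fun l x => f (l (n + 1), t - ∑ j ∈ Finset.range (n + 1), x j)) (by fun_prop),
      lintegral_renewalLaw g κ l₀ (f := fun l x => ∫⁻ z, f z ∂(stepKernel g κ
        (l n, t - ∑ j ∈ Finset.range n, x j)))
        ((hf.lintegral_kernel (κ := stepKernel g κ)).comp (by fun_prop : Measurable
        fun p : (ℕ → S) × (ℕ → ℝ) => (p.1 n, t - ∑ j ∈ Finset.range n, p.2 j))),
      lintegral_chainLaw_succ g _ n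
        (ψ := fun l y => ∫⁻ x, f (y, t - ∑ j ∈ Finset.range (n + 1), x j)
        ∂(Measure.infinitePi fun j => κ (l j))) hm]
    · refine lintegral_congr fun l => ?_
      rw [lintegral_lintegral_swap (by
        exact (Measurable.aemeasurable (by fun_prop : Measurable fun p : S × (ℕ → ℝ) =>
          f (p.1, t - ∑ j ∈ Finset.range (n + 1), p.2 j))))]
      have h3 : Measurable fun p : ℝ × ℝ => ∫⁻ y, f (y, t - (p.1 + p.2)) ∂(g (l n)) :=
        Measurable.lintegral_prod_right' (f := fun q : (ℝ × ℝ) × S => f (q.2, t - (q.1.1 + q.1.2)))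
          (by fun_prop)
      simp_rw [Finset.sum_range_succ]
      rw [lintegral_infinitePi_sum_range (fun j => κ (l j)) n
        (w := fun a b => ∫⁻ y, f (y, t - (a + b)) ∂(g (l n))) h3]
      refine lintegral_congr fun x => ?_
      rw [lintegral_stepKernel _ _ _ hf]
      simp only [sub_sub]
    · intro l l' y h
      exact lintegral_infinitePi_congr κ (n + 1) (fun j hj => h j (Nat.lt_succ_iff.1 hj))
        (w := fun a => f (y, t - a)) (by fun_prop)

lemma lintegral_renewalLaw_next (l₀ : S) (t : ℝ) (n : ℕ) {f : S × ℝ → ℝ → ℝ≥0∞}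
    (hf : Measurable fun p : (S × ℝ) × ℝ => f p.1 p.2) :
    ∫⁻ ω, f (ω.1 n, t - ∑ j ∈ Finset.range n, ω.2 j) (ω.2 n) ∂(renewalLaw g κ l₀)
      = ∫⁻ y, ∫⁻ z, f y z ∂(κ y.1) ∂((stepKernel g κ ^ n) (l₀, t)) := by
  have hm : Measurable fun y : S × ℝ => ∫⁻ z, f y z ∂(κ y.1) :=
    Measurable.lintegral_kernel_prod_right' (κ := κ.comap (Prod.fst : S × ℝ → S) measurable_fst) hf
  have h1 : Measurable fun p : (ℕ → S) × (ℕ → ℝ) =>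
      ((p.1 n, t - ∑ j ∈ Finset.range n, p.2 j), p.2 n) := by fun_prop
  have h2 : Measurable fun p : (ℕ → S) × (ℕ → ℝ) =>
      (p.1 n, t - ∑ j ∈ Finset.range n, p.2 j) := by fun_prop
  rw [← lintegral_renewalLaw_eq g κ l₀ t n hm, lintegral_renewalLaw g κ l₀
    (f := fun l x => f (l n, t - ∑ j ∈ Finset.range n, x j) (x n)) (hf.comp h1),
    lintegral_renewalLaw g κ l₀
    (f := fun l x => ∫⁻ z, f (l n, t - ∑ j ∈ Finset.range n, x j) z ∂(κ (l n))) (hm.comp h2)]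
  refine lintegral_congr fun l => ?_
  have h3 : Measurable fun p : ℝ × ℝ => ((l n, t - p.1), p.2) := by fun_prop
  exact lintegral_infinitePi_sum_range (fun j => κ (l j)) n (w := fun a b => f (l n, t - a) b)
    (hf.comp h3)

lemma chainLaw_dirac_apply (l₀ : S) (n : ℕ) {B : Set S} (hB : MeasurableSet B) :
    chainLaw g (Measure.dirac l₀) {ω | ω n ∈ B} = (g ^ n) l₀ B := by
  have hc : Measurable (B.indicator fun _ => (1 : ℝ≥0∞)) := measurable_const.indicator hB
  have h := lintegral_renewalLaw_eq g (Kernel.const S (Measure.dirac (0 : ℝ))) l₀ 0 n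
    (f := fun y => B.indicator (fun _ => (1 : ℝ≥0∞)) y.1) (by fun_prop)
  rw [lintegral_fst_stepKernel_pow _ _ _ _ _ hc, lintegral_renewalLaw g _ l₀
    (f := fun l _ => B.indicator (fun _ => (1 : ℝ≥0∞)) (l n)) (by fun_prop),
    lintegral_indicator_const hB, one_mul] at h
  rw [← h]
  simp only [lintegral_const, measure_univ, mul_one]
  have hB' : MeasurableSet {ω : ℕ → S | ω n ∈ B} := hB.preimage (measurable_pi_apply n)
  rw [← lintegral_indicator_one hB']
  rfl

/-! ### Regeneration of a recurrent Harris chain -/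

/-- The minorization of a Harris chain splits off a regeneration. The state `l₀` rules out the empty
state space, on which the minorization constant could be infinite. -/
lemma IsRecurrentHarris.exists_regeneration (h : IsRecurrentHarris g) (l₀ : S) :
    ∃ R : Regeneration g, ∀ z, ∃ n : ℕ, (g ^ n) z R.B ≠ 0 := by
  obtain ⟨B, C, ε, ν, hν, hB, hC, hε, hνC, hacc, hmin, -⟩ := h
  have hacc' : ∀ z, ∃ n : ℕ, (g ^ n) z B ≠ 0 := by
    intro z
    by_contra! h0
    refine (hacc z).ne' ?_
    rw [ofPred_exists, measure_iUnion_null_iff]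
    intro n
    rw [chainLaw_dirac_apply g z n hB, h0 n]
  have hle : ∀ x ∈ B, ε • ν ≤ g x := by
    intro x hx
    refine Measure.le_iff.2 fun D hD => ?_
    have h1 : ν D = ν (D ∩ C) := by
      rw [← measure_inter_add_sdiff D hC, measure_mono_null (sdiff_subset_compl D C) hνC, add_zero]
    rw [Measure.smul_apply, smul_eq_mul, h1]
    exact (hmin x hx _ inter_subset_right (hD.inter hC)).trans (measure_mono inter_subset_left)
  have hεt : ε ≠ ∞ := by
    obtain ⟨n, hn⟩ := hacc' l₀
    obtain ⟨x, hx⟩ := nonempty_of_measure_ne_zero hn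
    intro h
    have := hle x hx univ
    simp [h] at this
  obtain ⟨k, hk, hg⟩ := exists_add_regenKernel g hB hεt ν hle
  exact ⟨⟨B, hB, ε, hε.ne', hεt, ν, hν, k, hk, hg⟩, hacc'⟩

end

section

variable {S : Type*} [MeasurableSpace S]

/-! ### The current type as a potential -/

/-- The probability that the current waiting time has a type in `A` and outlasts the remaining
time, provided that the remaining time is nonnegative. -/
noncomputable def survival (κ : Kernel S ℝ) (A : Set S) : S × ℝ → ℝ≥0∞ :=
  (A ×ˢ Ici (0 : ℝ)).indicator fun y => κ y.1 (Ioi y.2)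

variable (κ : Kernel S ℝ)

lemma measurable_apply_Ioi [IsMarkovKernel κ] : Measurable fun y : S × ℝ => κ y.1 (Ioi y.2) := by
  have h : MeasurableSet {p : (S × ℝ) × ℝ | p.1.2 < p.2} :=
    measurableSet_lt (by fun_prop) (by fun_prop)
  have h2 := Kernel.measurable_kernel_prodMk_left
    (κ := κ.comap (Prod.fst : S × ℝ → S) measurable_fst) h
  exact h2

@[fun_prop]
lemma measurable_survival [IsMarkovKernel κ] {A : Set S} (hA : MeasurableSet A) :
    Measurable (survival κ A) :=
  (measurable_apply_Ioi κ).indicator (hA.prod measurableSet_Ici)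

lemma survival_of_nonneg (A : Set S) (l : S) {t : ℝ} (ht : 0 ≤ t) :
    survival κ A (l, t) = A.indicator (fun l => κ l (Ioi t)) l := by
  by_cases h : l ∈ A <;> simp [survival, h, ht]

lemma survival_of_neg (A : Set S) (l : S) {t : ℝ} (ht : t < 0) : survival κ A (l, t) = 0 := by
  simp [survival, ht]

lemma survival_add_compl (A : Set S) (y : S × ℝ) :
    survival κ A y + survival κ Aᶜ y = survival κ univ y := by
  by_cases h : y.1 ∈ A <;> by_cases h2 : 0 ≤ y.2 <;> simp [survival, indicator, h, h2]

variable {κ}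

lemma BasicAssumptions.apply_Iic_of_neg (hκ : BasicAssumptions κ) (l : S) {t : ℝ} (ht : t < 0) :
    κ l (Iic t) = 0 := by
  refine measure_mono_null ?_ (ae_iff.1 (hκ.nonneg l))
  intro x hx
  simp only [mem_Iic, mem_ofPred_eq, not_le] at *
  linarith

variable [IsMarkovKernel κ]

/-- The Laplace transforms of the waiting times at `1` are bounded away from `1`. -/
lemma BasicAssumptions.exists_lintegral_exp_le (hκ : BasicAssumptions κ) :
    ∃ γ : ℝ≥0∞, γ < 1 ∧ ∀ l, ∫⁻ x, ENNReal.ofReal (Real.exp (-x)) ∂(κ l) ≤ γ := by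
  obtain ⟨δ, hδ, c, hc, h⟩ := hκ.not_small
  have he : Real.exp (-δ) < 1 := by rw [Real.exp_lt_one_iff]; linarith
  have he0 := Real.exp_pos (-δ)
  set c' := max c 0
  have hc' : c' < 1 := max_lt hc one_pos
  have hc0 : 0 ≤ c' := le_max_right _ _
  refine ⟨ENNReal.ofReal (c' * (1 - Real.exp (-δ)) + Real.exp (-δ)), ?_, fun l => ?_⟩
  · rw [ENNReal.ofReal_lt_one]
    nlinarith
  have hle : ∀ᵐ x ∂(κ l), ENNReal.ofReal (Real.exp (-x)) ≤
      (Iic δ).indicator (fun _ => ENNReal.ofReal (1 - Real.exp (-δ))) x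
        + ENNReal.ofReal (Real.exp (-δ)) := by
    filter_upwards [hκ.nonneg l] with x hx
    by_cases hxδ : x ≤ δ
    · rw [indicator_of_mem (by exact hxδ), ← ENNReal.ofReal_add (by linarith) he0.le]
      refine ENNReal.ofReal_le_ofReal ?_
      have : Real.exp (-x) ≤ 1 := by rw [Real.exp_le_one_iff]; linarith
      linarith
    · rw [indicator_of_notMem (by exact hxδ), zero_add]
      refine ENNReal.ofReal_le_ofReal (Real.exp_le_exp.2 ?_)
      push Not at hxδ
      linarith
  refine (lintegral_mono_ae hle).trans ?_
  rw [lintegral_add_right _ measurable_const, lintegral_indicator_const measurableSet_Iic,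
    lintegral_const, measure_univ, mul_one]
  have hcdf : κ l (Iic δ) ≤ ENNReal.ofReal c' := by
    rw [← ofReal_cdf]
    exact ENNReal.ofReal_le_ofReal ((h l).trans (le_max_left _ _))
  calc ENNReal.ofReal (1 - Real.exp (-δ)) * κ l (Iic δ) + ENNReal.ofReal (Real.exp (-δ))
      ≤ ENNReal.ofReal (1 - Real.exp (-δ)) * ENNReal.ofReal c'
        + ENNReal.ofReal (Real.exp (-δ)) := by
        gcongr
    _ = _ := by
        rw [← ENNReal.ofReal_mul (by linarith), ← ENNReal.ofReal_add (by nlinarith) he0.le,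
          mul_comm]

variable (g : Kernel S S) [IsMarkovKernel g]

/-- The remaining time is nonnegative for finitely many steps only. -/
lemma BasicAssumptions.tendsto_pow_apply_nonneg (hκ : BasicAssumptions κ) (y : S × ℝ) :
    Tendsto (fun n => (stepKernel g κ ^ n) y (univ ×ˢ Ici 0)) atTop (𝓝 0) := by
  obtain ⟨γ, hγ, h⟩ := hκ.exists_lintegral_exp_le
  -- the mean of the exponential of the remaining time decreases geometrically
  have hb : ∀ n (y : S × ℝ), ∫⁻ z, ENNReal.ofReal (Real.exp z.2) ∂((stepKernel g κ ^ n) y)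
      ≤ ENNReal.ofReal (Real.exp y.2) * γ ^ n := by
    intro n
    induction n with
    | zero =>
      intro y
      rw [lintegral_pow_zero _ _ (f := fun z : S × ℝ => ENNReal.ofReal (Real.exp z.2))
        (by fun_prop)]
      simp
    | succ n ih =>
      intro y
      rw [lintegral_pow_succ _ _ _ (f := fun z : S × ℝ => ENNReal.ofReal (Real.exp z.2))
        (by fun_prop)]
      refine (lintegral_mono ih).trans ?_
      rw [lintegral_stepKernel _ _ _
        (f := fun z : S × ℝ => ENNReal.ofReal (Real.exp z.2) * γ ^ n) (by fun_prop)]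
      simp only [lintegral_const, measure_univ, mul_one, sub_eq_add_neg, Real.exp_add]
      rw [lintegral_mul_const _ (by fun_prop), pow_succ, mul_comm (γ ^ n), ← mul_assoc]
      gcongr
      simp_rw [ENNReal.ofReal_mul (Real.exp_pos y.2).le]
      rw [lintegral_const_mul _ (by fun_prop)]
      gcongr
      exact h _
  have hlim : Tendsto (fun n : ℕ => ENNReal.ofReal (Real.exp y.2) * γ ^ n) atTop (𝓝 0) := by
    rw [← mul_zero (ENNReal.ofReal (Real.exp y.2))]
    exact ENNReal.Tendsto.const_mul (ENNReal.tendsto_pow_atTop_nhds_zero_of_lt_one hγ)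
      (Or.inr ENNReal.ofReal_ne_top)
  refine tendsto_of_tendsto_of_tendsto_of_le_of_le tendsto_const_nhds hlim (fun _ => zero_le)
    fun n => le_trans ?_ (hb n y)
  rw [← lintegral_indicator_one (MeasurableSet.univ.prod measurableSet_Ici)]
  refine lintegral_mono fun z => ?_
  by_cases hz : 0 ≤ z.2
  · simp [indicator, hz]
  · simp [indicator, hz]

/-- At every nonnegative time, there is a current type. -/
lemma BasicAssumptions.lintegral_survival_univ (hκ : BasicAssumptions κ) (y : S × ℝ) :
    ∫⁻ z, survival κ univ z ∂(potential (stepKernel g κ) y) = (Ici 0).indicator 1 y.2 := by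
  set J : S × ℝ → ℝ≥0∞ := fun y => (Ici (0 : ℝ)).indicator 1 y.2
  have hJ : Measurable J := (measurable_one.indicator measurableSet_Ici).comp measurable_snd
  have hs := measurable_survival κ (MeasurableSet.univ (α := S))
  -- either the current waiting time outlasts the remaining time, or the next remaining time is
  -- nonnegative
  have h1 : ∀ z, J z = survival κ univ z + ∫⁻ w, J w ∂(stepKernel g κ z) := by
    rintro ⟨l, t⟩
    rw [lintegral_stepKernel _ _ _ hJ]
    simp only [J, lintegral_const, measure_univ, mul_one]
    have h2 : ∀ x : ℝ, (Ici (0 : ℝ)).indicator (1 : ℝ → ℝ≥0∞) (t - x) = (Iic t).indicator 1 x := by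
      intro x; simp [indicator]
    simp_rw [h2]
    rw [lintegral_indicator_one measurableSet_Iic]
    rcases lt_or_ge t 0 with ht | ht
    · rw [survival_of_neg _ _ _ ht, hκ.apply_Iic_of_neg l ht]
      simp [ht]
    · rw [survival_of_nonneg _ _ _ ht, ← compl_Iic, indicator_of_mem (mem_univ l), add_comm,
        measure_add_measure_compl measurableSet_Iic, measure_univ]
      simp [ht]
  have h2 : ∀ n : ℕ, J y = ∑ i ∈ Finset.range n, ∫⁻ z, survival κ univ z ∂((stepKernel g κ ^ i) y)
      + (stepKernel g κ ^ n) y (univ ×ˢ Ici 0) := by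
    intro n
    have h3 : (stepKernel g κ ^ n) y (univ ×ˢ Ici 0) = ∫⁻ z, J z ∂((stepKernel g κ ^ n) y) := by
      rw [← lintegral_indicator_one (MeasurableSet.univ.prod measurableSet_Ici)]
      refine lintegral_congr fun z => ?_
      simp [J, indicator]
    rw [h3]
    clear h3
    induction n with
    | zero => rw [lintegral_pow_zero _ _ hJ]; simp
    | succ n ih =>
      rw [lintegral_pow_succ' _ _ _ hJ, Finset.sum_range_succ, add_assoc, ← lintegral_add_left hs]
      simp_rw [← h1]
      exact ih
  rw [lintegral_potential]
  have h3 := (ENNReal.tendsto_nat_tsum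
    (fun i => ∫⁻ z, survival κ univ z ∂((stepKernel g κ ^ i) y))).add
    (hκ.tendsto_pow_apply_nonneg g y)
  simp_rw [← h2] at h3
  rw [add_zero] at h3
  exact (tendsto_nhds_unique tendsto_const_nhds h3).symm

lemma BasicAssumptions.ae_renewalLaw_nonneg (hκ : BasicAssumptions κ) (l₀ : S) :
    ∀ᵐ ω ∂(renewalLaw g κ l₀), ∀ j, 0 ≤ ω.2 j := by
  rw [ae_all_iff]
  intro j
  have hm : MeasurableSet {ω : (ℕ → S) × (ℕ → ℝ) | ¬ 0 ≤ ω.2 j} := by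
    simp only [not_le]
    exact measurableSet_lt (by fun_prop) (by fun_prop)
  have hi : Measurable ((Iio (0 : ℝ)).indicator (1 : ℝ → ℝ≥0∞)) :=
    measurable_one.indicator measurableSet_Iio
  have h := lintegral_renewalLaw_next g κ l₀ 0 j
    (f := fun _ z => (Iio (0 : ℝ)).indicator (1 : ℝ → ℝ≥0∞) z) (by fun_prop)
  rw [ae_iff, ← lintegral_indicator_one hm]
  have h0 : ∀ l, ∫⁻ z, (Iio (0 : ℝ)).indicator (1 : ℝ → ℝ≥0∞) z ∂(κ l) = 0 := by
    intro l
    rw [lintegral_indicator_one measurableSet_Iio]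
    have := ae_iff.1 (hκ.nonneg l)
    simp only [not_le] at this
    exact this
  simp only [h0, lintegral_zero] at h
  rw [← h]
  refine lintegral_congr fun ω => ?_
  simp [indicator]

lemma renewalCount_eq {x : ℕ → ℝ} (hx : ∀ j, 0 ≤ x j) {t : ℝ} {n : ℕ}
    (h1 : ∑ j ∈ Finset.range n, x j ≤ t) (h2 : t < ∑ j ∈ Finset.range (n + 1), x j) :
    renewalCount x t = n + 1 := by
  refine le_antisymm (Nat.sInf_le h2) (le_csInf ⟨_, h2⟩ fun m hm => ?_)
  by_contra! hmn
  refine absurd (lt_of_lt_of_le hm ?_) (not_lt.2 h1)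
  exact Finset.sum_le_sum_of_subset_of_nonneg
    (Finset.range_subset_range.2 (Nat.lt_succ_iff.1 hmn)) fun i _ _ => hx i

/-- The law of the current type is the potential of the survival function. -/
lemma BasicAssumptions.renewalLaw_currentType (hκ : BasicAssumptions κ) {t : ℝ} (ht : 0 ≤ t)
    (l₀ : S) {A : Set S} (hA : MeasurableSet A) :
    renewalLaw g κ l₀ {ω | currentType t ω ∈ A}
      = ∫⁻ y, survival κ A y ∂(potential (stepKernel g κ) (l₀, t)) := by
  set P := renewalLaw g κ l₀
  -- the event that the current waiting time is number `n` and has type in `A`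
  let E : Set S → ℕ → Set ((ℕ → S) × (ℕ → ℝ)) := fun A n => {ω | ω.1 n ∈ A ∧
    ∑ j ∈ Finset.range n, ω.2 j ≤ t ∧ t < ∑ j ∈ Finset.range (n + 1), ω.2 j}
  have hEm : ∀ {A : Set S}, MeasurableSet A → ∀ n, MeasurableSet (E A n) := by
    intro A hA n
    have h1 : Measurable fun ω : (ℕ → S) × (ℕ → ℝ) => ω.1 n := by fun_prop
    have h2 : ∀ n, Measurable fun ω : (ℕ → S) × (ℕ → ℝ) => ∑ j ∈ Finset.range n, ω.2 j := by
      intro n; fun_prop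
    exact (h1 hA).inter ((measurableSet_le (h2 n) measurable_const).inter
      (measurableSet_lt measurable_const (h2 (n + 1))))
  have hE : ∀ {A : Set S}, MeasurableSet A → ∀ n,
      P (E A n) = ∫⁻ y, survival κ A y ∂((stepKernel g κ ^ n) (l₀, t)) := by
    intro A hA n
    have hs : MeasurableSet {p : (S × ℝ) × ℝ | p.1 ∈ A ×ˢ Ici (0 : ℝ) ∧ p.1.2 < p.2} :=
      (measurable_fst (hA.prod measurableSet_Ici)).inter
        (measurableSet_lt (measurable_snd.comp measurable_fst) measurable_snd)
    have h := lintegral_renewalLaw_next g κ l₀ t n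
      (f := fun y z => {p : (S × ℝ) × ℝ | p.1 ∈ A ×ˢ Ici (0 : ℝ) ∧ p.1.2 < p.2}.indicator
        (1 : (S × ℝ) × ℝ → ℝ≥0∞) (y, z)) (measurable_one.indicator hs)
    have h1 : ∀ y : S × ℝ, ∫⁻ z, {p : (S × ℝ) × ℝ | p.1 ∈ A ×ˢ Ici (0 : ℝ) ∧ p.1.2 < p.2}.indicator
        (1 : (S × ℝ) × ℝ → ℝ≥0∞) (y, z) ∂(κ y.1) = survival κ A y := by
      intro y
      by_cases hy : y ∈ A ×ˢ Ici (0 : ℝ)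
      · rw [survival, indicator_of_mem hy, ← lintegral_indicator_one measurableSet_Ioi]
        refine lintegral_congr fun z => ?_
        simp only [indicator, mem_ofPred_eq, hy, true_and, mem_Ioi, Pi.one_apply]
      · rw [survival, indicator_of_notMem hy]
        simp only [indicator, mem_ofPred_eq, hy, false_and, if_false, lintegral_zero]
    simp_rw [h1] at h
    rw [← h, ← lintegral_indicator_one (hEm hA n)]
    refine lintegral_congr fun ω => ?_
    have hiff : ω ∈ E A n ↔ ((ω.1 n, t - ∑ j ∈ Finset.range n, ω.2 j), ω.2 n) ∈
        {p : (S × ℝ) × ℝ | p.1 ∈ A ×ˢ Ici (0 : ℝ) ∧ p.1.2 < p.2} := by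
      simp only [E, mem_ofPred_eq, mem_prod, mem_Ici, sub_nonneg, Finset.sum_range_succ,
        and_assoc, sub_lt_iff_lt_add']
    by_cases hw : ω ∈ E A n
    · rw [indicator_of_mem hw, indicator_of_mem (hiff.1 hw)]; rfl
    · rw [indicator_of_notMem hw, indicator_of_notMem (fun h => hw (hiff.2 h))]
  have hnn := hκ.ae_renewalLaw_nonneg g l₀
  have hcount : ∀ᵐ ω ∂P, ∀ (A : Set S) n, ω ∈ E A n → renewalCount ω.2 t = n + 1 := by
    filter_upwards [hnn] with ω hω A n hn using renewalCount_eq hω hn.2.1 hn.2.2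
  have hdisj : ∀ {A : Set S}, Pairwise (Function.onFun (AEDisjoint P) (E A)) := by
    intro A m n hmn
    refine measure_mono_null ?_ (ae_iff.1 hcount)
    intro ω hω h
    exact hmn (Nat.succ_injective ((h A m hω.1).symm.trans (h A n hω.2)))
  have hsum : ∀ {A : Set S}, MeasurableSet A → P (⋃ n, E A n)
      = ∫⁻ y, survival κ A y ∂(potential (stepKernel g κ) (l₀, t)) := by
    intro A hA
    rw [measure_iUnion₀ hdisj fun n => (hEm hA n).nullMeasurableSet, lintegral_potential]
    exact tsum_congr fun n => hE hA n
  have hfull : ∀ᵐ ω ∂P, ω ∈ ⋃ n, E univ n := by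
    refine (mem_ae_iff_prob_eq_one (μ := P) (MeasurableSet.iUnion fun n => hEm .univ n)).2 ?_
    rw [hsum .univ, hκ.lintegral_survival_univ g]
    simp [ht]
  rw [← hsum hA]
  refine measure_congr ?_
  filter_upwards [hfull, hcount] with ω h1 h2
  obtain ⟨n, hn⟩ := mem_iUnion.1 h1
  refine propext ⟨fun h => mem_iUnion.2 ⟨n, ?_, hn.2⟩, fun h => ?_⟩
  · have : currentType t ω = ω.1 n := by rw [currentType, h2 univ n hn]; rfl
    rw [← this]; exact h
  · obtain ⟨m, hm⟩ := mem_iUnion.1 h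
    have : currentType t ω = ω.1 m := by rw [currentType, h2 A m hm]; rfl
    change currentType t ω ∈ A
    rw [this]; exact hm.1

end

section

variable {S : Type*} [MeasurableSpace S]

/-! ### Elapsed times are nonnegative -/

/-- A kernel on `S × ℝ` does not increase the remaining time. -/
def IsLowering (K : Kernel (S × ℝ) (S × ℝ)) : Prop := ∀ y, ∀ᵐ z ∂(K y), z.2 ≤ y.2

lemma IsLowering.comp {K L : Kernel (S × ℝ) (S × ℝ)} (hK : IsLowering K) (hL : IsLowering L) :
    IsLowering (K ∘ₖ L) := by
  intro y
  have hm : MeasurableSet {z : S × ℝ | ¬ z.2 ≤ y.2} :=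
    (measurableSet_le measurable_snd measurable_const).compl
  rw [ae_iff, Kernel.comp_apply' _ _ _ hm]
  refine lintegral_eq_zero_of_ae_eq_zero ?_
  filter_upwards [hL y] with b hb
  refine measure_mono_null (fun z hz => ?_) (ae_iff.1 (hK b))
  exact fun h => hz (h.trans hb)

lemma IsLowering.pow {K : Kernel (S × ℝ) (S × ℝ)} (hK : IsLowering K) (n : ℕ) :
    IsLowering (K ^ n) := by
  induction n with
  | zero =>
    intro y
    have hm : MeasurableSet {z : S × ℝ | z.2 ≤ y.2} :=
      measurableSet_le measurable_snd measurable_const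
    rw [pow_zero]
    exact (ae_dirac_iff hm).2 le_rfl
  | succ n ih => rw [pow_succ]; exact ih.comp hK

lemma IsLowering.potential {K : Kernel (S × ℝ) (S × ℝ)} (hK : IsLowering K) :
    IsLowering (potential K) := by
  intro y
  rw [MarkovRenewal.potential, Kernel.sum_apply, Measure.ae_sum_iff]
  exact fun n => hK.pow n y

lemma BasicAssumptions.isLowering_stepKernel {κ : Kernel S ℝ} [IsMarkovKernel κ]
    (hκ : BasicAssumptions κ) (k : Kernel S S) [IsFiniteKernel k] :
      IsLowering (stepKernel k κ) := by
  intro y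
  have hm : MeasurableSet {z : S × ℝ | ¬ z.2 ≤ y.2} :=
    (measurableSet_le measurable_snd measurable_const).compl
  rw [ae_iff, ← lintegral_indicator_one hm,
    lintegral_stepKernel _ _ _ (measurable_one.indicator hm)]
  refine lintegral_eq_zero_of_ae_eq_zero ?_
  filter_upwards [hκ.nonneg y.1] with x hx
  simp [indicator, hx]

lemma IsLowering.ae_elapsed_nonneg {K : Kernel (S × ℝ) (S × ℝ)} (hK : IsLowering K) (l : S) :
    ∀ᵐ x ∂(elapsed K l), 0 ≤ x := by
  rw [elapsed, Kernel.map_apply _ (by fun_prop), Kernel.comap_apply,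
    ae_map_iff (by fun_prop) measurableSet_Ici]
  filter_upwards [hK (l, 0)] with y hy
  simpa using hy

instance isSFiniteKernel_pow {E : Type*} [MeasurableSpace E] (K : Kernel E E) [IsSFiniteKernel K]
    (n : ℕ) : IsSFiniteKernel (K ^ n) := by
  induction n with
  | zero => rw [pow_zero]; exact inferInstanceAs (IsSFiniteKernel Kernel.id)
  | succ n ih => rw [pow_succ]; exact inferInstanceAs (IsSFiniteKernel ((K ^ n) ∘ₖ K))

instance isSFiniteKernel_potential {E : Type*} [MeasurableSpace E] (K : Kernel E E)
    [IsSFiniteKernel K] : IsSFiniteKernel (potential K) := by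
  unfold potential; infer_instance

instance isSFiniteKernel_elapsed (K : Kernel (S × ℝ) (S × ℝ)) [IsSFiniteKernel K] :
    IsSFiniteKernel (elapsed K) := by
  unfold elapsed; infer_instance

namespace Regeneration

variable {g : Kernel S S} (R : Regeneration g) (κ : Kernel S ℝ)

instance [IsMarkovKernel g] [IsMarkovKernel κ] : SFinite (R.renewalMeasure κ) := by
  unfold renewalMeasure regenMeasure; infer_instance

lemma ae_cycleKernel_nonneg [IsMarkovKernel κ] (hκ : BasicAssumptions κ) (l : S) :
    ∀ᵐ x ∂(R.cycleKernel κ l), 0 ≤ x :=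
  ((hκ.isLowering_stepKernel R.r).comp (hκ.isLowering_stepKernel R.k).potential).ae_elapsed_nonneg l

lemma ae_cycleLaw_nonneg [IsMarkovKernel κ] (hκ : BasicAssumptions κ) :
    ∀ᵐ x ∂(R.cycleLaw κ), 0 ≤ x := by
  rw [cycleLaw, ae_iff, Measure.bind_apply (s := {x : ℝ | ¬ 0 ≤ x}) measurableSet_Ici.compl
    (Kernel.aemeasurable _)]
  exact lintegral_eq_zero_of_ae_eq_zero
    (ae_of_all _ fun l => ae_iff.1 (R.ae_cycleKernel_nonneg κ hκ l))

/-! ### Occupation measures -/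

/-- The expected occupation measure in time of a cycle started from `ν`, weighted by a function `c`
of the type. -/
noncomputable def occupation (c : S → ℝ≥0∞) : Measure ℝ :=
  ((((potential (stepKernel R.k κ)).comap (fun l : S => (l, (0 : ℝ))) (by fun_prop)) ∘ₘ
    R.ν).withDensity fun y => c y.1).map fun y => -y.2

lemma lintegral_occupation {c : S → ℝ≥0∞} (hc : Measurable c) {w : ℝ → ℝ≥0∞} (hw : Measurable w) :
    ∫⁻ x, w x ∂(R.occupation κ c)
      = ∫⁻ l, ∫⁻ y, c y.1 * w (-y.2) ∂(potential (stepKernel R.k κ) (l, 0)) ∂(R.ν) := by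
  have hc' : Measurable fun y : S × ℝ => c y.1 := by fun_prop
  have hw' : Measurable fun y : S × ℝ => w (-y.2) := by fun_prop
  rw [occupation, lintegral_map hw (by fun_prop), lintegral_withDensity_eq_lintegral_mul _ hc' hw',
    Measure.lintegral_bind (Kernel.aemeasurable _) (hc'.mul hw').aemeasurable]
  rfl

variable [IsMarkovKernel κ]

lemma occupation_univ {c : S → ℝ≥0∞} (hc : Measurable c) :
    R.occupation κ c univ = ∫⁻ l, ∫⁻ x, c x ∂(potential R.k l) ∂(R.ν) := by
  rw [← lintegral_one, R.lintegral_occupation κ hc measurable_const]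
  refine lintegral_congr fun l => ?_
  rw [← lintegral_fst_potential R.k κ l 0 hc]
  simp

lemma avg_potential_k_mul (t : ℝ) {c : S → ℝ≥0∞} (hc : Measurable c) {w : ℝ → ℝ≥0∞}
    (hw : Measurable w) :
    ∫⁻ l, ∫⁻ y, c y.1 * w y.2 ∂(potential (stepKernel R.k κ) (l, t)) ∂(R.ν)
      = ∫⁻ z, w (t - z) ∂(R.occupation κ c) := by
  rw [R.lintegral_occupation κ hc (w := fun z => w (t - z)) (by fun_prop)]
  refine lintegral_congr fun l => ?_
  have h := R.isEquivariant_potential_k κ l 0 t (fun y => c y.1 * w y.2) (by fun_prop)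
  rw [zero_add] at h
  rw [h]
  refine lintegral_congr fun y => ?_
  rw [sub_neg_eq_add, add_comm t]

/-- The potential of a product, started from `ν`, is the convolution of the renewal measure with
the occupation measure of a cycle. -/
lemma avg_potential_mul [IsMarkovKernel g] (t : ℝ) {c : S → ℝ≥0∞} (hc : Measurable c) {w : ℝ → ℝ≥0∞}
    (hw : Measurable w) :
    ∫⁻ l, ∫⁻ y, c y.1 * w y.2 ∂(potential (stepKernel g κ) (l, t)) ∂(R.ν)
      = ∫⁻ z, ∫⁻ x, w (t - z - x) ∂(R.renewalMeasure κ) ∂(R.occupation κ c) := by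
  have hocc : SFinite (R.occupation κ c) := by
    unfold occupation
    infer_instance
  rw [R.avg_potential_eq_renewalMeasure κ t (f := fun y => c y.1 * w y.2) (by fun_prop)]
  simp_rw [R.avg_potential_k_mul κ _ hc hw]
  rw [lintegral_lintegral_swap (by fun_prop)]
  simp only [sub_right_comm]

end Regeneration

/-! ### Hat functions -/

/-- The hat function supported on `[-h, h]`. -/
noncomputable def hat (h t : ℝ) : ℝ≥0∞ := ENNReal.ofReal (1 - |t| / h)

@[fun_prop]
lemma measurable_hat (h : ℝ) : Measurable (hat h) := by unfold hat; fun_prop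

lemma hat_le_one {h : ℝ} (hh : 0 < h) (t : ℝ) : hat h t ≤ 1 := by
  rw [hat, ← ENNReal.ofReal_one]
  refine ENNReal.ofReal_le_ofReal ?_
  have : 0 ≤ |t| / h := by positivity
  linarith

lemma hat_eq_zero {h : ℝ} (hh : 0 < h) {t : ℝ} (ht : h ≤ |t|) : hat h t = 0 := by
  rw [hat, ENNReal.ofReal_eq_zero]
  have : 1 ≤ |t| / h := (one_le_div hh).2 ht
  linarith

lemma hat_add_hat {h : ℝ} (hh : 0 < h) {t : ℝ} {j : ℕ} (h1 : j * h ≤ t) (h2 : t ≤ (j + 1) * h) :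
    hat h (t - j * h) + hat h (t - (j + 1 : ℕ) * h) = 1 := by
  push_cast
  rw [hat, hat, abs_of_nonneg (by linarith), abs_of_nonpos (by linarith), ← ENNReal.ofReal_add]
  · rw [← ENNReal.ofReal_one]
    congr 1
    field_simp
    ring
  · rw [sub_nonneg, div_le_one hh]; linarith
  · rw [sub_nonneg, div_le_one hh]; linarith

lemma exists_nat_mul_le {h : ℝ} (hh : 0 < h) {t : ℝ} (ht : 0 ≤ t) :
    ∃ j : ℕ, j * h ≤ t ∧ t < (j + 1) * h :=
  ⟨⌊t / h⌋₊, (le_div_iff₀ hh).1 (Nat.floor_le (by positivity)),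
    (div_lt_iff₀ hh).1 (Nat.lt_floor_add_one _)⟩

lemma tsum_hat_le_one {h : ℝ} (hh : 0 < h) (t : ℝ) : ∑' k : ℕ, hat h (t - k * h) ≤ 1 := by
  rcases lt_or_ge t 0 with ht | ht
  · rw [tsum_eq_single 0]
    · exact hat_le_one hh _
    · intro k hk
      refine hat_eq_zero hh ?_
      have : (1 : ℝ) ≤ k := by exact_mod_cast Nat.one_le_iff_ne_zero.2 hk
      rw [abs_of_nonpos (by nlinarith)]
      nlinarith
  · obtain ⟨j, h1, h2⟩ := exists_nat_mul_le hh ht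
    rw [tsum_eq_sum (s := {j, j + 1}), Finset.sum_pair (by simp), hat_add_hat hh h1 h2.le]
    intro k hk
    refine hat_eq_zero hh ?_
    simp only [Finset.mem_insert, Finset.mem_singleton, not_or] at hk
    rcases lt_or_gt_of_ne hk.1 with h3 | h3
    · have : (k : ℝ) + 1 ≤ j := by exact_mod_cast h3
      rw [abs_of_nonneg (by nlinarith)]
      nlinarith
    · have : (j : ℝ) + 2 ≤ k := by
        have : j + 2 ≤ k := by omega
        exact_mod_cast this
      rw [abs_of_nonpos (by nlinarith)]
      nlinarith

lemma hat_le_add {h : ℝ} (hh : 0 < h) (s t : ℝ) :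
    hat h t ≤ hat h s + ENNReal.ofReal (|t - s| / h) * (Icc (-h) h).indicator 1 t := by
  by_cases ht : |t| ≤ h
  · have : t ∈ Icc (-h) h := abs_le.1 ht
    rw [indicator_of_mem this, Pi.one_apply, mul_one]
    refine (ENNReal.ofReal_le_ofReal ?_).trans (ENNReal.ofReal_add_le (p := 1 - |s| / h))
    have h1 : |s| ≤ |t| + |t - s| := by
      have := abs_sub_abs_le_abs_sub s t
      rw [abs_sub_comm] at this
      linarith
    have h2 : |s| / h ≤ (|t| + |t - s|) / h := by gcongr
    rw [add_div] at h2
    linarith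
  · rw [hat_eq_zero hh (not_le.1 ht).le]
    exact zero_le

namespace Regeneration

variable {g : Kernel S S} [IsMarkovKernel g] (R : Regeneration g) (κ : Kernel S ℝ)
  [IsMarkovKernel κ]

/-- The smoothed renewal density: the renewal measure convolved with a hat function. -/
noncomputable def renewalHat (h t : ℝ) : ℝ≥0∞ := ∫⁻ x, hat h (t - x) ∂(R.renewalMeasure κ)

@[fun_prop]
lemma measurable_renewalHat (h : ℝ) : Measurable (R.renewalHat κ h) := by
  have : Measurable fun p : ℝ × ℝ => hat h (p.1 - p.2) := by fun_prop
  exact this.lintegral_prod_right'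

end Regeneration

variable {κ : Kernel S ℝ} [IsMarkovKernel κ] {g : Kernel S S} [IsMarkovKernel g]

lemma BasicAssumptions.lintegral_survival_univ_le_one (hκ : BasicAssumptions κ) (y : S × ℝ) :
    ∫⁻ z, survival κ univ z ∂(potential (stepKernel g κ) y) ≤ 1 := by
  rw [hκ.lintegral_survival_univ g]
  exact indicator_le_self' (f := 1) (fun _ _ => zero_le) _

lemma le_lintegral_potential {E : Type*} [MeasurableSpace E] (K : Kernel E E) (x : E) {f : E → ℝ≥0∞}
    (hf : Measurable f) : f x ≤ ∫⁻ y, f y ∂(potential K x) := by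
  rw [lintegral_potential_eq_add K x hf]
  exact le_self_add

/-- The waiting times exceed some length with a probability bounded from below. -/
lemma BasicAssumptions.exists_le_apply_Ioi (hκ : BasicAssumptions κ) :
    ∃ δ : ℝ, 0 < δ ∧ ∃ p : ℝ≥0∞, p ≠ 0 ∧ p ≠ ∞ ∧ ∀ l, p ≤ κ l (Ioi δ) := by
  obtain ⟨δ, hδ, c, hc, h⟩ := hκ.not_small
  refine ⟨δ, hδ, ENNReal.ofReal (1 - c), by simpa using hc, ENNReal.ofReal_ne_top, fun l => ?_⟩
  rw [← compl_Iic, prob_compl_eq_one_sub measurableSet_Iic, ← ofReal_cdf, ← ENNReal.ofReal_one,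
    ← ENNReal.ofReal_sub _ (cdf_nonneg _ _)]
  exact ENNReal.ofReal_le_ofReal (by linarith [h l])

/-- The renewal measure of short intervals is bounded: after a regeneration shortly before time `t`,
the type chosen there is still current at time `t` with a probability bounded from below. -/
lemma BasicAssumptions.exists_renewalMeasure_Icc_le (hκ : BasicAssumptions κ) (R : Regeneration g) :
    ∃ δ : ℝ, 0 < δ ∧ ∃ C : ℝ≥0∞, C ≠ ∞ ∧ ∀ t, R.renewalMeasure κ (Icc (t - δ) t) ≤ C := by
  obtain ⟨δ, hδ, p, hp0, hpt, hp⟩ := hκ.exists_le_apply_Ioi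
  refine ⟨δ, hδ, p⁻¹, ENNReal.inv_ne_top.2 hp0, fun t => ?_⟩
  rw [ENNReal.le_inv_iff_mul_le, mul_comm]
  have hs := measurable_survival κ (MeasurableSet.univ (α := S))
  calc p * R.renewalMeasure κ (Icc (t - δ) t)
      = ∫⁻ x, p * (Icc (t - δ) t).indicator 1 x ∂(R.renewalMeasure κ) := by
        rw [lintegral_const_mul _ (measurable_one.indicator measurableSet_Icc),
          lintegral_indicator_one measurableSet_Icc]
    _ ≤ ∫⁻ x, ∫⁻ l, ∫⁻ y, survival κ univ y ∂(potential (stepKernel R.k κ) (l, t - x)) ∂(R.ν)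
          ∂(R.renewalMeasure κ) := by
        refine lintegral_mono fun x => ?_
        by_cases hx : x ∈ Icc (t - δ) t
        · rw [indicator_of_mem hx, Pi.one_apply, mul_one]
          calc p = ∫⁻ _, p ∂(R.ν) := by simp
            _ ≤ _ := by
              refine lintegral_mono fun l => ?_
              refine le_trans ?_ (le_lintegral_potential _ _ hs)
              rw [survival_of_nonneg _ _ _ (by linarith [hx.2]), indicator_of_mem (mem_univ l)]
              exact (hp l).trans (measure_mono (Ioi_subset_Ioi (by linarith [hx.1])))
        · simp [hx]
    _ = ∫⁻ l, ∫⁻ y, survival κ univ y ∂(potential (stepKernel g κ) (l, t)) ∂(R.ν) :=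
        (R.avg_potential_eq_renewalMeasure κ t hs).symm
    _ ≤ ∫⁻ _, 1 ∂(R.ν) := lintegral_mono fun l => hκ.lintegral_survival_univ_le_one _
    _ = 1 := by simp

end

section

variable {S : Type*} [MeasurableSpace S]

/-! ### The key renewal theorem -/

/-- The standing assumptions of the renewal theorems. -/
structure RenewalSetting {g : Kernel S S} [IsMarkovKernel g] (R : Regeneration g) (κ : Kernel S ℝ)
    (ρ : Measure S) : Prop where
  basic : BasicAssumptions κ
  gap : HasSpectralGap g
  invariant : Kernel.Invariant g ρ
  accessible : ∀ z, ∃ n : ℕ, (g ^ n) z R.B ≠ 0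
  nonarithmetic : ¬ IsArithmetic (R.cycleLaw κ)

variable {κ : Kernel S ℝ} [IsMarkovKernel κ] {g : Kernel S S} [IsMarkovKernel g]
  {R : Regeneration g} {ρ : Measure S} [IsProbabilityMeasure ρ]

lemma RenewalSetting.isMarkovKernel_cycleKernel (P : RenewalSetting R κ ρ) :
    IsMarkovKernel (R.cycleKernel κ) :=
  R.isMarkovKernel_cycleKernel P.gap P.invariant P.accessible κ

lemma RenewalSetting.isProbabilityMeasure_cycleLaw (P : RenewalSetting R κ ρ) :
    IsProbabilityMeasure (R.cycleLaw κ) := by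
  have := P.isMarkovKernel_cycleKernel
  unfold Regeneration.cycleLaw; infer_instance

omit [IsMarkovKernel κ] in
lemma RenewalSetting.e_mul_ne_zero (P : RenewalSetting R κ ρ) : R.e * ρ R.B ≠ 0 :=
  mul_ne_zero R.e_ne_zero (R.measure_B_ne_zero P.invariant P.accessible)

omit [IsMarkovKernel g] in
lemma e_mul_ne_top (R : Regeneration g) (ρ : Measure S) [IsProbabilityMeasure ρ] :
    R.e * ρ R.B ≠ ∞ :=
  ENNReal.mul_ne_top R.e_ne_top (measure_ne_top _ _)

lemma RenewalSetting.occupation_univ (P : RenewalSetting R κ ρ) {c : S → ℝ≥0∞}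
    (hc : Measurable c) (hc1 : ∀ x, c x ≤ 1) :
    R.occupation κ c univ = (R.e * ρ R.B)⁻¹ * ∫⁻ l, c l ∂ρ := by
  rw [R.occupation_univ κ hc, ← R.lintegral_potential_k P.gap P.invariant P.accessible hc hc1,
    ← mul_assoc, ENNReal.inv_mul_cancel P.e_mul_ne_zero (e_mul_ne_top R ρ), one_mul]

/-- The smoothed renewal density is bounded and asymptotically translation invariant. -/
lemma RenewalSetting.exists_renewalHat (P : RenewalSetting R κ ρ) :
    ∃ h₀ : ℝ, 0 < h₀ ∧ ∀ h, 0 < h → h ≤ h₀ → ∃ C : ℝ, 0 ≤ C ∧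
      (∀ t, R.renewalHat κ h t ≤ ENNReal.ofReal C) ∧
      ∀ s, Tendsto (fun t => (R.renewalHat κ h (t + s)).toReal - (R.renewalHat κ h t).toReal)
        atTop (𝓝 0) := by
  obtain ⟨δ, hδ, C, hC, hRm⟩ := P.basic.exists_renewalMeasure_Icc_le R
  have := P.isProbabilityMeasure_cycleLaw
  refine ⟨δ / 2, by positivity, fun h hh hhδ => ⟨C.toReal, ENNReal.toReal_nonneg, ?_⟩⟩
  rw [ENNReal.ofReal_toReal hC]
  have hRm' : ∀ t, R.renewalMeasure κ (Icc (t - h) (t + h)) ≤ C := fun t =>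
    (measure_mono (Icc_subset_Icc_left (by linarith))).trans (hRm (t + h))
  have hind : ∀ t x : ℝ, (Icc (-h) h).indicator (1 : ℝ → ℝ≥0∞) (t - x)
      = (Icc (t - h) (t + h)).indicator 1 x := by
    intro t x
    have : t - x ∈ Icc (-h) h ↔ x ∈ Icc (t - h) (t + h) := by
      constructor <;> rintro ⟨h1, h2⟩ <;> constructor <;> linarith
    by_cases hx : x ∈ Icc (t - h) (t + h)
    · rw [indicator_of_mem hx, indicator_of_mem (this.2 hx)]; rfl
    · rw [indicator_of_notMem hx, indicator_of_notMem fun h => hx (this.1 h)]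
  have hZle : ∀ t, R.renewalHat κ h t ≤ C := by
    intro t
    refine le_trans ?_ (hRm' t)
    rw [← lintegral_indicator_one measurableSet_Icc]
    refine lintegral_mono fun x => ?_
    rw [← hind]
    by_cases hx : t - x ∈ Icc (-h) h
    · rw [indicator_of_mem hx]; exact hat_le_one hh _
    · rw [hat_eq_zero hh (le_of_not_ge fun h => hx (abs_le.1 h))]
      exact zero_le
  refine ⟨hZle, fun s => ?_⟩
  set Z : ℝ → ℝ := fun t => (R.renewalHat κ h t).toReal with hZ
  have hZt : ∀ t, R.renewalHat κ h t ≠ ∞ := fun t => ne_top_of_le_ne_top hC (hZle t)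
  have hb : ∀ t, |Z t| ≤ C.toReal := by
    intro t
    rw [hZ, abs_of_nonneg ENNReal.toReal_nonneg]
    exact ENNReal.toReal_mono hC (hZle t)
  have hlip1 : ∀ t s, Z t ≤ Z s + C.toReal / h * |t - s| := by
    intro t s
    have h1 : R.renewalHat κ h t ≤ R.renewalHat κ h s + ENNReal.ofReal (|t - s| / h) * C := by
      calc R.renewalHat κ h t
          ≤ ∫⁻ x, (hat h (s - x) + ENNReal.ofReal (|t - s| / h) *
              (Icc (t - h) (t + h)).indicator 1 x) ∂(R.renewalMeasure κ) := by
            refine lintegral_mono fun x => ?_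
            have := hat_le_add hh (s - x) (t - x)
            rwa [hind, sub_sub_sub_cancel_right] at this
        _ ≤ _ := by
            rw [lintegral_add_left (by fun_prop), lintegral_const_mul _
              (measurable_one.indicator measurableSet_Icc),
              lintegral_indicator_one measurableSet_Icc]
            gcongr
            · exact le_rfl
            · exact hRm' t
    have h2 := ENNReal.toReal_mono (ENNReal.add_ne_top.2 ⟨hZt s,
      ENNReal.mul_ne_top ENNReal.ofReal_ne_top hC⟩) h1
    rw [ENNReal.toReal_add (hZt s) (ENNReal.mul_ne_top ENNReal.ofReal_ne_top hC),
      ENNReal.toReal_mul, ENNReal.toReal_ofReal (by positivity)] at h2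
    refine h2.trans_eq ?_
    simp only [hZ]
    ring
  have huc : UniformContinuous Z := by
    refine LipschitzWith.uniformContinuous (K := (C.toReal / h).toNNReal) ?_
    refine LipschitzWith.of_le_add_mul _ fun x y => ?_
    rw [Real.coe_toNNReal _ (by positivity), Real.dist_eq]
    exact hlip1 x y
  refine tendsto_shift_sub (R.ae_cycleLaw_nonneg κ P.basic) P.nonarithmetic hb huc ?_ s
  -- the right side of the renewal equation for `Z` vanishes after `h`
  have h0 : ∀ t, Z t - ∫ x, Z (t - x) ∂(R.cycleLaw κ) = (hat h t).toReal := by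
    intro t
    have h1 := R.lintegral_renewalMeasure_eq κ t (measurable_hat h)
    have h2 : ∫⁻ x, R.renewalHat κ h (t - x) ∂(R.cycleLaw κ) ≠ ∞ := by
      refine ne_top_of_le_ne_top hC ?_
      calc ∫⁻ x, R.renewalHat κ h (t - x) ∂(R.cycleLaw κ) ≤ ∫⁻ _, C ∂(R.cycleLaw κ) :=
            lintegral_mono fun x => hZle _
        _ = C := by simp
    have h3 : R.renewalHat κ h t = hat h t + ∫⁻ x, R.renewalHat κ h (t - x) ∂(R.cycleLaw κ) := h1
    have h4 : ∫ x, Z (t - x) ∂(R.cycleLaw κ)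
        = (∫⁻ x, R.renewalHat κ h (t - x) ∂(R.cycleLaw κ)).toReal :=
      integral_toReal (by fun_prop) (ae_of_all _ fun x => (hZt _).lt_top)
    rw [h4, hZ]
    simp only
    rw [h3, ENNReal.toReal_add (ne_top_of_le_ne_top ENNReal.one_ne_top (hat_le_one hh t)) h2]
    ring
  refine Tendsto.congr' ?_ tendsto_const_nhds
  filter_upwards [eventually_ge_atTop h] with t ht
  rw [h0, hat_eq_zero hh (ht.trans (le_abs_self t)), ENNReal.toReal_zero]

lemma tendsto_integral_shift_sub {Z : ℝ → ℝ} (hZm : Measurable Z) {C : ℝ} (hb : ∀ t, |Z t| ≤ C)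
    (hs : ∀ s, Tendsto (fun t => Z (t + s) - Z t) atTop (𝓝 0)) (m : Measure ℝ)
    [IsFiniteMeasure m] :
    Tendsto (fun t => ∫ x, Z (t - x) ∂m - m.real univ * Z t) atTop (𝓝 0) := by
  have h1 : Tendsto (fun t => ∫ x, (Z (t - x) - Z t) ∂m) atTop (𝓝 (∫ _, (0 : ℝ) ∂m)) := by
    refine tendsto_integral_filter_of_dominated_convergence (fun _ => C + C)
      (Eventually.of_forall fun t => (by fun_prop : Measurable _).aestronglyMeasurable)
      (Eventually.of_forall fun t => ae_of_all _ fun x => ?_) (integrable_const _)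
      (ae_of_all _ fun x => ?_)
    · exact (abs_sub _ _).trans (add_le_add (hb _) (hb _))
    · simpa [sub_eq_add_neg] using hs (-x)
  rw [integral_zero] at h1
  refine h1.congr fun t => ?_
  have hi : Integrable (fun x => Z (t - x)) m :=
    Integrable.of_bound (by fun_prop : Measurable _).aestronglyMeasurable C
      (ae_of_all _ fun x => hb _)
  rw [integral_sub hi (integrable_const _), integral_const, smul_eq_mul]

/-- For superpositions of hat functions of width `h` with weights depending on the type, the
potentials started from `ν` are asymptotically proportional to `W`, with the integrals of the
weights with respect to `ρ` as factors of proportionality. -/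
def IsDensity (R : Regeneration g) (κ : Kernel S ℝ) (ρ : Measure S) (h : ℝ) (W : ℝ → ℝ) : Prop :=
  (∀ t, 0 ≤ W t) ∧
    ∀ (c : ℕ → S → ℝ≥0∞) (s : ℕ → ℝ), (∀ k, Measurable (c k)) → (∀ k x, c k x ≤ 1) →
      ∑' k, ∫⁻ l, c k l ∂ρ ≠ ∞ →
      (∀ t, ∫⁻ l, ∫⁻ y, ∑' k, c k y.1 * hat h (y.2 - s k) ∂(potential (stepKernel g κ) (l, t))
        ∂(R.ν) ≠ ∞) ∧
      Tendsto (fun t => (∫⁻ l, ∫⁻ y, ∑' k, c k y.1 * hat h (y.2 - s k)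
        ∂(potential (stepKernel g κ) (l, t)) ∂(R.ν)).toReal -
        (∑' k, ∫⁻ l, c k l ∂ρ).toReal * W t) atTop (𝓝 0)

/-- The key renewal theorem. -/
lemma RenewalSetting.exists_isDensity (P : RenewalSetting R κ ρ) :
    ∃ h₀ : ℝ, 0 < h₀ ∧ ∀ h, 0 < h → h ≤ h₀ → ∃ W : ℝ → ℝ, IsDensity R κ ρ h W := by
  obtain ⟨h₀, hh₀, H⟩ := P.exists_renewalHat
  refine ⟨h₀, hh₀, fun h hh hh0 => ?_⟩
  obtain ⟨C, hC, hZle, hshift⟩ := H h hh hh0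
  set Z : ℝ → ℝ := fun t => (R.renewalHat κ h t).toReal with hZ
  have hZm : Measurable Z := (R.measurable_renewalHat κ h).ennreal_toReal
  have hZt : ∀ t, R.renewalHat κ h t ≠ ∞ :=
    fun t => ne_top_of_le_ne_top ENNReal.ofReal_ne_top (hZle t)
  have hb : ∀ t, |Z t| ≤ C := fun t => by
    rw [hZ, abs_of_nonneg ENNReal.toReal_nonneg]
    exact ENNReal.toReal_le_of_le_ofReal hC (hZle t)
  refine ⟨fun t => (R.e * ρ R.B)⁻¹.toReal * Z t,
    fun t => mul_nonneg ENNReal.toReal_nonneg ENNReal.toReal_nonneg, fun c s hc hc1 hsum => ?_⟩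
  -- the superposition of the shifted occupation measures
  set m : Measure ℝ := Measure.sum fun k => (R.occupation κ (c k)).map (· + s k) with hm
  have hmu : m univ = (R.e * ρ R.B)⁻¹ * ∑' k, ∫⁻ l, c k l ∂ρ := by
    rw [hm, Measure.sum_apply _ MeasurableSet.univ, ← ENNReal.tsum_mul_left]
    refine tsum_congr fun k => ?_
    rw [Measure.map_apply (by fun_prop) MeasurableSet.univ, preimage_univ,
      P.occupation_univ (hc k) (hc1 k)]
  have : IsFiniteMeasure m := ⟨by
    rw [hmu]
    exact (ENNReal.mul_ne_top (ENNReal.inv_ne_top.2 P.e_mul_ne_zero) hsum).lt_top⟩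
  have havg : ∀ t, ∫⁻ l, ∫⁻ y, ∑' k, c k y.1 * hat h (y.2 - s k)
      ∂(potential (stepKernel g κ) (l, t)) ∂(R.ν) = ∫⁻ x, R.renewalHat κ h (t - x) ∂m := by
    intro t
    have hmk : ∀ k, Measurable fun y : S × ℝ => c k y.1 * hat h (y.2 - s k) := fun k => by
      have := hc k
      fun_prop
    simp_rw [lintegral_tsum fun k => (hmk k).aemeasurable]
    rw [lintegral_tsum fun k => (Regeneration.measurable_avg_potential _ (hmk k) t).aemeasurable,
      hm,
      lintegral_sum_measure]
    refine tsum_congr fun k => ?_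
    rw [R.avg_potential_mul κ t (hc k) (w := fun x => hat h (x - s k)) (by fun_prop),
      lintegral_map (by fun_prop) (by fun_prop)]
    refine lintegral_congr fun z => ?_
    rw [Regeneration.renewalHat]
    refine lintegral_congr fun x => ?_
    congr 1
    ring
  have hfin : ∀ t, ∫⁻ x, R.renewalHat κ h (t - x) ∂m ≠ ∞ := by
    intro t
    refine ne_top_of_le_ne_top ?_ (lintegral_mono fun x => hZle (t - x))
    rw [lintegral_const]
    exact ENNReal.mul_ne_top ENNReal.ofReal_ne_top (measure_ne_top _ _)
  simp_rw [havg]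
  refine ⟨hfin, (tendsto_integral_shift_sub hZm hb hshift m).congr fun t => ?_⟩
  have h4 : ∫ x, Z (t - x) ∂m = (∫⁻ x, R.renewalHat κ h (t - x) ∂m).toReal :=
    integral_toReal (by fun_prop) (ae_of_all _ fun x => (hZt _).lt_top)
  rw [h4, measureReal_def, hmu, ENNReal.toReal_mul]
  ring

/-! ### Starting from an arbitrary type -/

/-- The probability that, for a chain started from `ν`, the current type lies in `A`. -/
noncomputable def avgSurvival (R : Regeneration g) (κ : Kernel S ℝ) (A : Set S) (t : ℝ) : ℝ≥0∞ :=
  ∫⁻ l, ∫⁻ y, survival κ A y ∂(potential (stepKernel g κ) (l, t)) ∂(R.ν)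

lemma survival_mono (κ : Kernel S ℝ) {A A' : Set S} (h : A ⊆ A') (y : S × ℝ) :
    survival κ A y ≤ survival κ A' y :=
  indicator_le_indicator_of_subset (prod_mono_left h) (fun _ => zero_le) y

lemma avgSurvival_le_one (hκ : BasicAssumptions κ) (R : Regeneration g) (A : Set S) (t : ℝ) :
    avgSurvival R κ A t ≤ 1 :=
  calc avgSurvival R κ A t ≤ ∫⁻ _, 1 ∂(R.ν) := lintegral_mono fun l =>
        (lintegral_mono fun y => survival_mono κ (subset_univ A) y).trans
          (hκ.lintegral_survival_univ_le_one _)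
    _ = 1 := by simp

lemma avgSurvival_add_compl (hκ : BasicAssumptions κ) (R : Regeneration g) {A : Set S}
    (hA : MeasurableSet A) {t : ℝ} (ht : 0 ≤ t) :
    avgSurvival R κ A t + avgSurvival R κ Aᶜ t = 1 := by
  rw [avgSurvival, avgSurvival, ← lintegral_add_left
    (Regeneration.measurable_avg_potential _ (measurable_survival κ hA) t)]
  simp_rw [← lintegral_add_left (measurable_survival κ hA), survival_add_compl,
    hκ.lintegral_survival_univ g]
  simp [ht]

omit [IsMarkovKernel g] in
lemma measurable_avgSurvival (R : Regeneration g) {A : Set S} (hA : MeasurableSet A) :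
    Measurable (avgSurvival R κ A) :=
  R.measurable_avg _ (measurable_survival κ hA)

lemma tendsto_measure_Iic_atTop_one (m : Measure ℝ) [IsProbabilityMeasure m] :
    Tendsto (fun t => m (Iic t)) atTop (𝓝 1) := by
  have h := tendsto_measure_iUnion_atTop (μ := m) (s := fun t : ℝ => Iic t)
    (fun s t hst => Iic_subset_Iic.2 hst)
  rwa [iUnion_Iic, measure_univ] at h

/-- Until the first regeneration, the process is only relevant up to a finite time. -/
lemma RenewalSetting.tendsto_survival_potential_k (P : RenewalSetting R κ ρ) (l : S) :
    Tendsto (fun t => ∫⁻ y, survival κ univ y ∂(potential (stepKernel R.k κ) (l, t))) atTop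
      (𝓝 0) := by
  have := P.isMarkovKernel_cycleKernel
  have hs := measurable_survival κ (MeasurableSet.univ (α := S))
  have h1 : ∀ t, 0 ≤ t → ∫⁻ y, survival κ univ y ∂(potential (stepKernel R.k κ) (l, t))
      = 1 - R.cycleKernel κ l (Iic t) := by
    intro t ht
    have h2 := R.lintegral_potential_eq κ l t hs
    simp_rw [P.basic.lintegral_survival_univ g, lintegral_const, measure_univ, mul_one] at h2
    have h3 : ∀ x : ℝ, (Ici (0 : ℝ)).indicator (1 : ℝ → ℝ≥0∞) (t - x) = (Iic t).indicator 1 x := by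
      intro x; simp [indicator]
    simp_rw [h3] at h2
    rw [lintegral_indicator_one measurableSet_Iic, indicator_of_mem (by exact ht),
      Pi.one_apply] at h2
    rw [h2, ENNReal.add_sub_cancel_right (measure_ne_top _ _)]
  have h2 := ENNReal.Tendsto.sub (tendsto_const_nhds (x := (1 : ℝ≥0∞)))
    (tendsto_measure_Iic_atTop_one (R.cycleKernel κ l)) (Or.inl ENNReal.one_ne_top)
  rw [tsub_self] at h2
  refine h2.congr' ?_
  filter_upwards [eventually_ge_atTop 0] with t ht using (h1 t ht).symm

/-- A limit law for the current type that holds when starting from `ν` holds for every initial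
type. -/
lemma RenewalSetting.tendsto_currentTypeProb (P : RenewalSetting R κ ρ) {A : Set S}
    (hA : MeasurableSet A) {L : ℝ≥0∞} (h : Tendsto (avgSurvival R κ A) atTop (𝓝 L)) (l₀ : S) :
    Tendsto (fun t => currentTypeProb g κ t l₀ A) atTop (𝓝 L.toReal) := by
  have := P.isMarkovKernel_cycleKernel
  have hm := measurable_survival κ hA
  have hL : L ≠ ∞ := ne_top_of_le_ne_top ENNReal.one_ne_top
    (le_of_tendsto h (Eventually.of_forall (avgSurvival_le_one P.basic R A)))
  have h1 : Tendsto (fun t => ∫⁻ y, survival κ A y ∂(potential (stepKernel g κ) (l₀, t))) atTop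
      (𝓝 L) := by
    have h2 : Tendsto (fun t => ∫⁻ y, survival κ A y ∂(potential (stepKernel R.k κ) (l₀, t)))
        atTop (𝓝 0) :=
      tendsto_of_tendsto_of_tendsto_of_le_of_le tendsto_const_nhds
        (P.tendsto_survival_potential_k l₀) (fun _ => zero_le)
        fun t => lintegral_mono fun y => survival_mono κ (subset_univ A) y
    have h3 : Tendsto (fun t => ∫⁻ x, avgSurvival R κ A (t - x) ∂(R.cycleKernel κ l₀)) atTop
        (𝓝 (∫⁻ _, L ∂(R.cycleKernel κ l₀))) := by
      have hma := measurable_avgSurvival (κ := κ) R hA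
      refine tendsto_lintegral_filter_of_dominated_convergence (fun _ => 1)
        (Eventually.of_forall fun t => by fun_prop)
        (Eventually.of_forall fun t => ae_of_all _ fun x => avgSurvival_le_one P.basic R A _)
        (by simp) (ae_of_all _ fun x => ?_)
      exact h.comp (tendsto_atTop_add_const_right _ (-x) tendsto_id)
    rw [lintegral_const, measure_univ, mul_one] at h3
    have h4 := h2.add h3
    rw [zero_add] at h4
    exact h4.congr fun t => (R.lintegral_potential_eq κ l₀ t hm).symm
  refine ((ENNReal.tendsto_toReal hL).comp h1).congr' ?_
  filter_upwards [eventually_ge_atTop 0] with t ht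
  rw [Function.comp_apply, ← P.basic.renewalLaw_currentType g ht l₀ hA]
  rfl

end

section

variable {S : Type*} [MeasurableSpace S]

/-! ### Riemann sums of the tails -/

/-- The Riemann sum, without the factor `h`, of the tail of the waiting time of type `l`. -/
noncomputable def tailSum (κ : Kernel S ℝ) (h : ℝ) (l : S) : ℝ≥0∞ := ∑' k : ℕ, κ l (Ioi (k * h))

lemma measurable_tail (κ : Kernel S ℝ) (t : ℝ) : Measurable fun l => κ l (Ioi t) :=
  κ.measurable_coe measurableSet_Ioi

lemma tailSum_eq {κ : Kernel S ℝ} {h : ℝ} (hh : 0 < h) (l : S) :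
    tailSum κ h l = ∫⁻ x, (⌈x / h⌉₊ : ℝ≥0∞) ∂(κ l) := by
  have h1 : ∀ k : ℕ, κ l (Ioi (k * h)) = ∫⁻ x, (Ioi (k * h)).indicator 1 x ∂(κ l) := fun k =>
    (lintegral_indicator_one measurableSet_Ioi).symm
  simp_rw [tailSum, h1]
  rw [← lintegral_tsum fun k => (measurable_one.indicator measurableSet_Ioi).aemeasurable]
  refine lintegral_congr fun x => ?_
  have h2 : ∀ k : ℕ, (Ioi (k * h)).indicator (1 : ℝ → ℝ≥0∞) x = if k < ⌈x / h⌉₊ then 1 else 0 := by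
    intro k
    have : x ∈ Ioi (k * h) ↔ k < ⌈x / h⌉₊ := by rw [Nat.lt_ceil, lt_div_iff₀ hh, mem_Ioi]
    simp only [indicator, this, Pi.one_apply]
  simp_rw [h2]
  rw [tsum_eq_sum (s := Finset.range ⌈x / h⌉₊) (fun k hk => by simpa using hk),
    Finset.sum_congr rfl fun k hk => if_pos (Finset.mem_range.1 hk)]
  simp

lemma meanWait_le_tailSum (κ : Kernel S ℝ) {h : ℝ} (hh : 0 < h) (l : S) :
    meanWait κ l ≤ ENNReal.ofReal h * tailSum κ h l := by
  rw [tailSum_eq hh, ← lintegral_const_mul _ (by fun_prop), meanWait]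
  refine lintegral_mono fun x => ?_
  rw [← ENNReal.ofReal_natCast, ← ENNReal.ofReal_mul hh.le]
  refine ENNReal.ofReal_le_ofReal ?_
  rw [mul_comm, ← div_le_iff₀ hh]
  exact Nat.le_ceil _

lemma tailSum_le_meanWait {κ : Kernel S ℝ} [IsMarkovKernel κ] (hκ : BasicAssumptions κ) {h : ℝ}
    (hh : 0 < h) (l : S) :
    ENNReal.ofReal h * tailSum κ h l ≤ meanWait κ l + ENNReal.ofReal h := by
  calc ENNReal.ofReal h * tailSum κ h l
      = ∫⁻ x, ENNReal.ofReal h * (⌈x / h⌉₊ : ℝ≥0∞) ∂(κ l) := by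
        rw [tailSum_eq hh, ← lintegral_const_mul _ (by fun_prop)]
    _ ≤ ∫⁻ x, (ENNReal.ofReal x + ENNReal.ofReal h) ∂(κ l) := by
        refine lintegral_mono_ae ?_
        filter_upwards [hκ.nonneg l] with x hx
        rw [← ENNReal.ofReal_natCast, ← ENNReal.ofReal_mul hh.le, ← ENNReal.ofReal_add hx hh.le]
        refine ENNReal.ofReal_le_ofReal ?_
        have h1 := (Nat.ceil_lt_add_one (a := x / h) (by positivity)).le
        calc h * ⌈x / h⌉₊ ≤ h * (x / h + 1) := by gcongr
          _ = x + h := by field_simp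
    _ = meanWait κ l + ENNReal.ofReal h := by
        rw [lintegral_add_right _ measurable_const, meanWait]
        simp

variable {κ : Kernel S ℝ} [IsMarkovKernel κ]

/-- Weights of a superposition of hat functions above the survival function. -/
noncomputable def upperWeight (κ : Kernel S ℝ) (A : Set S) (h : ℝ) (k : ℕ) (l : S) : ℝ≥0∞ :=
  A.indicator (fun l => κ l (Ioi ((k - 1 : ℕ) * h))) l

/-- Weights of a superposition of hat functions, centred at `h, 2h, …`, below the survival
function. -/
noncomputable def lowerWeight (κ : Kernel S ℝ) (h : ℝ) (k : ℕ) (l : S) : ℝ≥0∞ :=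
  κ l (Ioi ((k + 2 : ℕ) * h))

lemma measurable_upperWeight (κ : Kernel S ℝ) {A : Set S} (hA : MeasurableSet A) (h : ℝ) (k : ℕ) :
    Measurable (upperWeight κ A h k) :=
  (measurable_tail κ _).indicator hA

lemma measurable_lowerWeight (κ : Kernel S ℝ) (h : ℝ) (k : ℕ) : Measurable (lowerWeight κ h k) :=
  measurable_tail κ _

lemma upperWeight_le_one (A : Set S) (h : ℝ) (k : ℕ) (l : S) : upperWeight κ A h k l ≤ 1 :=
  (indicator_le_self _ _ _).trans prob_le_one

omit [IsMarkovKernel κ] in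
lemma survival_le_tsum_hat (A : Set S) {h : ℝ} (hh : 0 < h) (y : S × ℝ) :
    survival κ A y ≤ ∑' k : ℕ, upperWeight κ A h k y.1 * hat h (y.2 - k * h) := by
  obtain ⟨l, t⟩ := y
  rcases lt_or_ge t 0 with ht | ht
  · rw [survival_of_neg _ _ _ ht]; exact zero_le
  rw [survival_of_nonneg _ _ _ ht]
  by_cases hl : l ∈ A
  swap
  · rw [indicator_of_notMem hl]; exact zero_le
  obtain ⟨j, h1, h2⟩ := exists_nat_mul_le hh ht
  refine le_trans ?_ (ENNReal.sum_le_tsum {j, j + 1})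
  rw [Finset.sum_pair (by simp)]
  simp only [upperWeight, indicator_of_mem hl]
  have h3 : ((j - 1 : ℕ) : ℝ) ≤ j := by exact_mod_cast Nat.sub_le j 1
  calc κ l (Ioi t) = κ l (Ioi t) * (hat h (t - j * h) + hat h (t - (j + 1 : ℕ) * h)) := by
        rw [hat_add_hat hh h1 h2.le, mul_one]
    _ ≤ _ := by
        rw [mul_add]
        gcongr
        · nlinarith
        · simpa using h1

omit [IsMarkovKernel κ] in
lemma tsum_hat_le_survival {h : ℝ} (hh : 0 < h) (y : S × ℝ) :
    ∑' k : ℕ, lowerWeight κ h k y.1 * hat h (y.2 - (k + 1 : ℕ) * h) ≤ survival κ univ y := by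
  obtain ⟨l, t⟩ := y
  rcases le_or_gt t 0 with ht | ht
  · refine le_of_eq_of_le ?_ zero_le
    rw [ENNReal.tsum_eq_zero]
    intro k
    rw [hat_eq_zero hh, mul_zero]
    push_cast
    have : 0 ≤ (k : ℝ) * h := by positivity
    rw [abs_of_nonpos (by linarith)]
    linarith
  rw [survival_of_nonneg _ _ _ ht.le, indicator_of_mem (mem_univ l)]
  calc ∑' k : ℕ, lowerWeight κ h k l * hat h (t - (k + 1 : ℕ) * h)
      ≤ ∑' k : ℕ, κ l (Ioi t) * hat h (t - (k + 1 : ℕ) * h) := by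
        refine ENNReal.tsum_le_tsum fun k => ?_
        rcases le_or_gt t ((k + 2 : ℕ) * h) with h1 | h1
        · gcongr
          exact measure_mono (Ioi_subset_Ioi h1)
        · push_cast at h1
          rw [hat_eq_zero hh, mul_zero, mul_zero]
          push_cast
          rw [abs_of_nonneg (by linarith)]
          linarith
    _ ≤ κ l (Ioi t) * 1 := by
        rw [ENNReal.tsum_mul_left]
        gcongr
        exact (ENNReal.tsum_comp_le_tsum_of_injective (add_left_injective 1)
          (fun k : ℕ => hat h (t - k * h))).trans (tsum_hat_le_one hh t)
    _ = κ l (Ioi t) := mul_one _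

lemma tsum_upperWeight_le (hκ : BasicAssumptions κ) (A : Set S) {h : ℝ} (hh : 0 < h) (l : S) :
    ENNReal.ofReal h * ∑' k : ℕ, upperWeight κ A h k l
      ≤ A.indicator (fun l => meanWait κ l + 2 * ENNReal.ofReal h) l := by
  by_cases hl : l ∈ A
  swap
  · simp [upperWeight, hl]
  simp only [upperWeight, indicator_of_mem hl]
  rw [tsum_eq_zero_add' ENNReal.summable, mul_add, two_mul, ← add_assoc, add_comm]
  simp only [Nat.add_sub_cancel]
  gcongr
  · exact tailSum_le_meanWait hκ hh l
  · exact mul_le_of_le_one_right' prob_le_one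

lemma meanWait_le_tsum_lowerWeight {h : ℝ} (hh : 0 < h) (l : S) :
    meanWait κ l ≤ ENNReal.ofReal h * ∑' k : ℕ, lowerWeight κ h k l + 2 * ENNReal.ofReal h := by
  refine (meanWait_le_tailSum κ hh l).trans ?_
  have h1 : tailSum κ h l ≤ 1 + (1 + ∑' k : ℕ, lowerWeight κ h k l) := by
    rw [tailSum, tsum_eq_zero_add' ENNReal.summable, tsum_eq_zero_add' ENNReal.summable]
    exact add_le_add prob_le_one (add_le_add prob_le_one le_rfl)
  calc ENNReal.ofReal h * tailSum κ h l
      ≤ ENNReal.ofReal h * (1 + (1 + ∑' k : ℕ, lowerWeight κ h k l)) := mul_le_mul_right h1 _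
    _ = _ := by ring

/-! ### Finite stationary mean -/

variable {g : Kernel S S} [IsMarkovKernel g] {R : Regeneration g} {ρ : Measure S}
  [IsProbabilityMeasure ρ]

omit [IsMarkovKernel κ] in
lemma measurable_meanWait : Measurable (meanWait κ) :=
  Measurable.lintegral_kernel (κ := κ) (f := fun x => ENNReal.ofReal x) (by fun_prop)

lemma lintegral_meanWait_pos (hκ : BasicAssumptions κ) : 0 < ∫⁻ l, meanWait κ l ∂ρ := by
  obtain ⟨δ, hδ, p, hp0, hpt, hp⟩ := hκ.exists_le_apply_Ioi
  have h1 : ∀ l, ENNReal.ofReal δ * p ≤ meanWait κ l := by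
    intro l
    calc ENNReal.ofReal δ * p ≤ ENNReal.ofReal δ * κ l (Ioi δ) := by gcongr; exact hp l
      _ = ∫⁻ x, (Ioi δ).indicator (fun _ => ENNReal.ofReal δ) x ∂(κ l) :=
        (lintegral_indicator_const measurableSet_Ioi _).symm
      _ ≤ meanWait κ l := by
        refine lintegral_mono fun x => ?_
        by_cases hx : x ∈ Ioi δ
        · rw [indicator_of_mem hx]; exact ENNReal.ofReal_le_ofReal (le_of_lt hx)
        · rw [indicator_of_notMem hx]; exact zero_le
  calc 0 < ENNReal.ofReal δ * p := pos_iff_ne_zero.2 (mul_ne_zero (by simpa using hδ) hp0)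
    _ = ∫⁻ _, ENNReal.ofReal δ * p ∂ρ := by simp
    _ ≤ _ := lintegral_mono h1

/-- Asymptotic upper bound for the law of the current type, for a fixed mesh `h`. -/
lemma RenewalSetting.eventually_avgSurvival_le (P : RenewalSetting R κ ρ)
    (hfin : ∫⁻ l, meanWait κ l ∂ρ ≠ ∞) {A : Set S} (hA : MeasurableSet A) {h : ℝ} (hh : 0 < h)
    (hhM : 2 * h < (∫⁻ l, meanWait κ l ∂ρ).toReal)
    {W : ℝ → ℝ} (H : IsDensity R κ ρ h W) {ε : ℝ} (hε : 0 < ε) :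
    ∀ᶠ t in atTop, (avgSurvival R κ A t).toReal ≤
      ((∫⁻ l in A, meanWait κ l ∂ρ).toReal + 2 * h) / ((∫⁻ l, meanWait κ l ∂ρ).toReal - 2 * h)
        + ε := by
  obtain ⟨-, HW⟩ := H
  have hh' : ENNReal.ofReal h ≠ 0 := by simpa using hh
  have hm := measurable_meanWait (κ := κ)
  set M := (∫⁻ l, meanWait κ l ∂ρ).toReal with hM
  set MA := (∫⁻ l in A, meanWait κ l ∂ρ).toReal with hMA
  have hfinA : ∫⁻ l in A, meanWait κ l ∂ρ ≠ ∞ :=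
    ne_top_of_le_ne_top hfin (setLIntegral_le_lintegral _ _)
  -- the weights of the two superpositions
  set a := ∑' k, ∫⁻ l, upperWeight κ A h k l ∂ρ with ha
  set d := ∑' k, ∫⁻ l, lowerWeight κ h k l ∂ρ with hd
  have hau : ENNReal.ofReal h * a ≤ ∫⁻ l in A, meanWait κ l ∂ρ + 2 * ENNReal.ofReal h := by
    rw [ha, ← lintegral_tsum fun k => (measurable_upperWeight κ hA h k).aemeasurable,
      ← lintegral_const_mul _ (Measurable.tsum fun k => measurable_upperWeight κ hA h k)]
    refine (lintegral_mono fun l => tsum_upperWeight_le P.basic A hh l).trans ?_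
    rw [lintegral_indicator hA, lintegral_add_right _ measurable_const]
    gcongr
    rw [lintegral_const, Measure.restrict_apply_univ]
    exact mul_le_of_le_one_right' prob_le_one
  have hdl : ∫⁻ l, meanWait κ l ∂ρ ≤ ENNReal.ofReal h * d + 2 * ENNReal.ofReal h := by
    rw [hd, ← lintegral_tsum fun k => (measurable_lowerWeight κ h k).aemeasurable,
      ← lintegral_const_mul _ (Measurable.tsum fun k => measurable_lowerWeight κ h k)]
    refine (lintegral_mono fun l => meanWait_le_tsum_lowerWeight hh l).trans ?_
    rw [lintegral_add_right _ measurable_const, lintegral_const, measure_univ, mul_one]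
  have hdu : ENNReal.ofReal h * d ≤ ∫⁻ l, meanWait κ l ∂ρ + ENNReal.ofReal h := by
    rw [hd, ← lintegral_tsum fun k => (measurable_lowerWeight κ h k).aemeasurable,
      ← lintegral_const_mul _ (Measurable.tsum fun k => measurable_lowerWeight κ h k)]
    calc _ ≤ ∫⁻ l, (meanWait κ l + ENNReal.ofReal h) ∂ρ := by
          refine lintegral_mono fun l => ?_
          refine le_trans ?_ (tailSum_le_meanWait P.basic hh l)
          gcongr
          exact ENNReal.tsum_comp_le_tsum_of_injective (add_left_injective 2)
            (fun k : ℕ => κ l (Ioi (k * h)))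
      _ = _ := by rw [lintegral_add_right _ measurable_const]; simp
  have h2h : 2 * ENNReal.ofReal h ≠ ∞ := ENNReal.mul_ne_top (by simp) ENNReal.ofReal_ne_top
  have haf : a ≠ ∞ := by
    intro h1
    rw [h1, ENNReal.mul_top hh'] at hau
    exact (ENNReal.add_ne_top.2 ⟨hfinA, h2h⟩) (top_le_iff.1 hau)
  have hdt : d ≠ ∞ := by
    intro h1
    rw [h1, ENNReal.mul_top hh'] at hdu
    exact (ENNReal.add_ne_top.2 ⟨hfin, ENNReal.ofReal_ne_top⟩) (top_le_iff.1 hdu)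
  have hau' : h * a.toReal ≤ MA + 2 * h := by
    have := ENNReal.toReal_mono (ENNReal.add_ne_top.2 ⟨hfinA, h2h⟩) hau
    rwa [ENNReal.toReal_add hfinA h2h, ENNReal.toReal_mul, ENNReal.toReal_mul,
      ENNReal.toReal_ofReal hh.le, ENNReal.toReal_ofNat] at this
  have hdl' : M ≤ h * d.toReal + 2 * h := by
    have h3 : ENNReal.ofReal h * d ≠ ∞ := ENNReal.mul_ne_top ENNReal.ofReal_ne_top hdt
    have := ENNReal.toReal_mono (ENNReal.add_ne_top.2 ⟨h3, h2h⟩) hdl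
    rwa [ENNReal.toReal_add h3 h2h, ENNReal.toReal_mul, ENNReal.toReal_mul,
      ENNReal.toReal_ofReal hh.le, ENNReal.toReal_ofNat] at this
  have hd0 : 0 < d.toReal := by
    by_contra! h1
    nlinarith
  obtain ⟨hU1, hU2⟩ := HW (fun k => upperWeight κ A h k) (fun k => k * h)
    (measurable_upperWeight κ hA h) (upperWeight_le_one A h) haf
  obtain ⟨hD1, hD2⟩ := HW (fun k => lowerWeight κ h k) (fun k => (k + 1 : ℕ) * h)
    (fun k => measurable_tail κ _) (fun k x => prob_le_one) hdt
  set U : ℝ → ℝ≥0∞ := fun t => ∫⁻ l, ∫⁻ y, ∑' k : ℕ, upperWeight κ A h k y.1 * hat h (y.2 - k * h)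
    ∂(potential (stepKernel g κ) (l, t)) ∂(R.ν) with hU
  set D : ℝ → ℝ≥0∞ := fun t => ∫⁻ l, ∫⁻ y, ∑' k : ℕ, lowerWeight κ h k y.1 *
    hat h (y.2 - (k + 1 : ℕ) * h) ∂(potential (stepKernel g κ) (l, t)) ∂(R.ν) with hD
  have hAU : ∀ t, (avgSurvival R κ A t).toReal ≤ (U t).toReal := fun t =>
    ENNReal.toReal_mono (hU1 t) (lintegral_mono fun l => lintegral_mono fun y =>
      survival_le_tsum_hat A hh y)
  have hDone : ∀ t, (D t).toReal ≤ 1 := fun t => by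
    refine ENNReal.toReal_le_of_le_ofReal zero_le_one ?_
    rw [ENNReal.ofReal_one]
    exact (lintegral_mono fun l => lintegral_mono fun y => tsum_hat_le_survival hh y).trans
      (avgSurvival_le_one P.basic R univ t)
  -- compare both superpositions with the common density
  have hlim := (hU2.const_mul d.toReal).sub (hD2.const_mul a.toReal)
  rw [mul_zero, mul_zero, sub_zero] at hlim
  filter_upwards [hlim.eventually_lt_const (mul_pos hd0 hε)] with t ht
  have h5 : d.toReal * (U t).toReal ≤ a.toReal + d.toReal * ε := by
    have := mul_le_mul_of_nonneg_left (hDone t) (ENNReal.toReal_nonneg (a := a))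
    nlinarith
  have h6 : (U t).toReal ≤ a.toReal / d.toReal + ε := by
    have h7 : d.toReal * (a.toReal / d.toReal + ε) = a.toReal + d.toReal * ε := by
      field_simp
    rw [← h7] at h5
    exact le_of_mul_le_mul_left h5 hd0
  have h8 : a.toReal / d.toReal ≤ (MA + 2 * h) / (M - 2 * h) := by
    rw [div_le_div_iff₀ hd0 (by linarith)]
    have h9 : 0 ≤ a.toReal := ENNReal.toReal_nonneg
    have h10 : a.toReal * (M - 2 * h) ≤ a.toReal * (h * d.toReal) :=
      mul_le_mul_of_nonneg_left (by linarith) h9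
    nlinarith
  linarith [hAU t]

/-- If the stationary mean is finite, then the law of the current type is asymptotically the
invariant measure biased by the mean waiting times. -/
theorem RenewalSetting.tendsto_avgSurvival (P : RenewalSetting R κ ρ)
    (hfin : ∫⁻ l, meanWait κ l ∂ρ ≠ ∞) {A : Set S} (hA : MeasurableSet A) :
    Tendsto (fun t => (avgSurvival R κ A t).toReal) atTop
      (𝓝 ((∫⁻ l in A, meanWait κ l ∂ρ).toReal / (∫⁻ l, meanWait κ l ∂ρ).toReal)) := by
  obtain ⟨h₀, hh₀, H⟩ := P.exists_isDensity
  set M := (∫⁻ l, meanWait κ l ∂ρ).toReal with hM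
  have hMpos : 0 < M := ENNReal.toReal_pos (lintegral_meanWait_pos P.basic).ne' hfin
  have hupper : ∀ {A : Set S}, MeasurableSet A → ∀ ε > 0, ∀ᶠ t in atTop,
      (avgSurvival R κ A t).toReal ≤ (∫⁻ l in A, meanWait κ l ∂ρ).toReal / M + ε := by
    intro A hA ε hε
    set MA := (∫⁻ l in A, meanWait κ l ∂ρ).toReal
    have hcont : Tendsto (fun h : ℝ => (MA + 2 * h) / (M - 2 * h)) (𝓝 0) (𝓝 (MA / M)) := by
      have : ContinuousAt (fun h : ℝ => (MA + 2 * h) / (M - 2 * h)) 0 :=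
        ContinuousAt.div (by fun_prop) (by fun_prop) (by simpa using hMpos.ne')
      simpa [ContinuousAt] using this
    have h1 : ∀ᶠ h in 𝓝[>] (0 : ℝ), (MA + 2 * h) / (M - 2 * h) < MA / M + ε / 2 :=
      (hcont.mono_left nhdsWithin_le_nhds).eventually_lt_const (by linarith)
    have h2 : ∀ᶠ h in 𝓝[>] (0 : ℝ), h < min h₀ (M / 2) :=
      (tendsto_id.mono_left nhdsWithin_le_nhds).eventually_lt_const (by positivity)
    obtain ⟨h, h3, h4, h5⟩ := (h1.and (h2.and self_mem_nhdsWithin)).exists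
    have h6 := lt_min_iff.1 h4
    obtain ⟨W, hW⟩ := H h h5 h6.1.le
    filter_upwards [P.eventually_avgSurvival_le hfin hA h5 (by linarith [h6.2])
      hW (half_pos hε)] with t ht
    linarith
  have hMsum : (∫⁻ l in A, meanWait κ l ∂ρ).toReal + (∫⁻ l in Aᶜ, meanWait κ l ∂ρ).toReal = M := by
    rw [← ENNReal.toReal_add (ne_top_of_le_ne_top hfin (setLIntegral_le_lintegral _ _))
      (ne_top_of_le_ne_top hfin (setLIntegral_le_lintegral _ _)), lintegral_add_compl _ hA]
  -- the upper bounds for `A` and its complement add up to `1`, so both are sharp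
  rw [tendsto_order]
  constructor
  · intro b hb
    filter_upwards [hupper hA.compl (((∫⁻ l in A, meanWait κ l ∂ρ).toReal / M - b) / 2)
      (by linarith), eventually_ge_atTop 0] with t ht ht0
    have h1 := congrArg ENNReal.toReal (avgSurvival_add_compl P.basic R hA ht0)
    rw [ENNReal.toReal_add (ne_top_of_le_ne_top ENNReal.one_ne_top
      (avgSurvival_le_one P.basic R _ _))
      (ne_top_of_le_ne_top ENNReal.one_ne_top (avgSurvival_le_one P.basic R _ _)),
      ENNReal.toReal_one] at h1
    have h2 : (∫⁻ l in A, meanWait κ l ∂ρ).toReal / M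
        + (∫⁻ l in Aᶜ, meanWait κ l ∂ρ).toReal / M = 1 := by
      rw [← add_div, hMsum, div_self hMpos.ne']
    linarith
  · intro b hb
    filter_upwards [hupper hA ((b - (∫⁻ l in A, meanWait κ l ∂ρ).toReal / M) / 2)
      (by linarith)] with t ht
    linarith

end

section

variable {S : Type*} [MeasurableSpace S]

/-! ### Infinite stationary mean -/

variable {κ : Kernel S ℝ} [IsMarkovKernel κ] {g : Kernel S S} [IsMarkovKernel g]
  {R : Regeneration g} {ρ : Measure S} [IsProbabilityMeasure ρ]

/-- If the stationary mean is infinite, there are superpositions of hat functions below the survival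
function with weights of arbitrarily large total mass. As their potentials are at most `1`, the
density `W` tends to zero. -/
lemma IsDensity.tendsto_zero (hκ : BasicAssumptions κ) {h : ℝ} (hh : 0 < h) {W : ℝ → ℝ}
    (H : IsDensity R κ ρ h W) (hinf : ∫⁻ l, meanWait κ l ∂ρ = ∞) : Tendsto W atTop (𝓝 0) := by
  obtain ⟨hW, HW⟩ := H
  have hdl : ∑' k, ∫⁻ l, lowerWeight κ h k l ∂ρ = ∞ := by
    by_contra h1
    have h2 : ∫⁻ l, meanWait κ l ∂ρ ≤
        ENNReal.ofReal h * ∑' k, ∫⁻ l, lowerWeight κ h k l ∂ρ + 2 * ENNReal.ofReal h := by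
      rw [← lintegral_tsum fun k => (measurable_lowerWeight κ h k).aemeasurable,
        ← lintegral_const_mul _ (Measurable.tsum fun k => measurable_lowerWeight κ h k)]
      refine (lintegral_mono fun l => meanWait_le_tsum_lowerWeight hh l).trans ?_
      rw [lintegral_add_right _ measurable_const, lintegral_const, measure_univ, mul_one]
    rw [hinf] at h2
    exact (ENNReal.add_ne_top.2 ⟨ENNReal.mul_ne_top ENNReal.ofReal_ne_top h1,
      ENNReal.mul_ne_top (by simp) ENNReal.ofReal_ne_top⟩) (top_le_iff.1 h2)
  rw [Metric.tendsto_atTop']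
  intro ε hε
  -- truncated lower weights with a large total mass
  have hlim := ENNReal.tendsto_nat_tsum fun k => ∫⁻ l, lowerWeight κ h k l ∂ρ
  rw [hdl] at hlim
  obtain ⟨M, hM⟩ := (hlim.eventually_const_lt (ENNReal.ofReal_lt_top (r := 2 / ε))).exists
  set c : ℕ → S → ℝ≥0∞ := fun k => if k < M then lowerWeight κ h k else 0 with hc
  have hcp : ∀ k ∈ Finset.range M, c k = lowerWeight κ h k := fun k hk =>
    if_pos (Finset.mem_range.1 hk)
  have hcn : ∀ k, k ∉ Finset.range M → c k = 0 := fun k hk =>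
    if_neg fun h => hk (Finset.mem_range.2 h)
  have hcl : ∀ k l, c k l ≤ lowerWeight κ h k l := by
    intro k l
    by_cases hk : k < M <;> simp [hc, hk]
  have hcm : ∀ k, Measurable (c k) := by
    intro k
    by_cases hk : k < M
    · simp only [hc, hk, if_true]; exact measurable_lowerWeight κ h k
    · simp only [hc, hk, if_false]; exact measurable_zero
  have hsum : ∑' k, ∫⁻ l, c k l ∂ρ = ∑ k ∈ Finset.range M, ∫⁻ l, lowerWeight κ h k l ∂ρ := by
    rw [tsum_eq_sum (s := Finset.range M)]
    · refine Finset.sum_congr rfl fun k hk => ?_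
      rw [hcp k hk]
    · intro k hk
      rw [hcn k hk]
      simp
  have hfin : ∑' k, ∫⁻ l, c k l ∂ρ ≠ ∞ := by
    rw [hsum]
    refine (ENNReal.sum_lt_top.2 fun k _ => ?_).ne
    calc ∫⁻ l, lowerWeight κ h k l ∂ρ ≤ ∫⁻ _, 1 ∂ρ := lintegral_mono fun l => prob_le_one
      _ < ∞ := by simp
  obtain ⟨h1, h2⟩ := HW c (fun k => (k + 1 : ℕ) * h) hcm
    (fun k l => (hcl k l).trans prob_le_one) hfin
  have hd : 2 / ε < (∑' k, ∫⁻ l, c k l ∂ρ).toReal := by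
    rw [← hsum] at hM
    exact (ENNReal.ofReal_lt_iff_lt_toReal (by positivity) hfin).1 hM
  set d := (∑' k, ∫⁻ l, c k l ∂ρ).toReal
  obtain ⟨T, hT⟩ := eventually_atTop.1 (h2.eventually_const_lt (show (-1 : ℝ) < 0 by norm_num))
  refine ⟨T, fun t ht => ?_⟩
  have h3 := hT t ht.le
  have h4 : (∫⁻ l, ∫⁻ y, ∑' k : ℕ, c k y.1 * hat h (y.2 - (k + 1 : ℕ) * h)
      ∂(potential (stepKernel g κ) (l, t)) ∂(R.ν)).toReal ≤ 1 := by
    refine ENNReal.toReal_le_of_le_ofReal zero_le_one ?_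
    rw [ENNReal.ofReal_one]
    refine le_trans (lintegral_mono fun l => lintegral_mono fun y => ?_)
      (avgSurvival_le_one hκ R univ t)
    refine le_trans (ENNReal.tsum_le_tsum fun k => ?_) (tsum_hat_le_survival hh y)
    gcongr
    exact hcl k y.1
  have h5 : d * W t < 2 := by linarith
  rw [Real.dist_eq, sub_zero, abs_of_nonneg (hW t)]
  by_contra! h6
  have h7 : 2 < d * ε := by rwa [div_lt_iff₀ hε] at hd
  have h8 : d * ε ≤ d * W t := by
    have : 0 ≤ d := ENNReal.toReal_nonneg
    gcongr
  linarith

/-- A bounded range of remaining times is covered by finitely many translates of a range in which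
the current waiting time is likely to survive. -/
lemma BasicAssumptions.exists_indicator_le (hκ : BasicAssumptions κ) {T : ℝ} :
    ∃ (C : ℝ≥0∞) (_ : C ≠ ∞) (δ : ℝ) (J : ℕ), ∀ y : S × ℝ, (Icc 0 T).indicator 1 y.2 ≤
      ∑ j ∈ Finset.range J, C * survival κ univ (y.1, y.2 + -(j * δ)) := by
  obtain ⟨δ, hδ, p, hp0, hpt, hp⟩ := hκ.exists_le_apply_Ioi
  obtain ⟨J, hJ⟩ := exists_nat_gt (T / δ)
  refine ⟨p⁻¹, ENNReal.inv_ne_top.2 hp0, δ, J, fun y => ?_⟩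
  by_cases hy : y.2 ∈ Icc 0 T
  swap
  · rw [indicator_of_notMem hy]; exact zero_le
  rw [indicator_of_mem hy, Pi.one_apply]
  obtain ⟨j, h1, h2⟩ := exists_nat_mul_le hδ hy.1
  have hj : j ∈ Finset.range J := by
    rw [Finset.mem_range]
    have : (j : ℝ) < J := by
      refine lt_of_le_of_lt ?_ hJ
      rw [le_div_iff₀ hδ]
      exact h1.trans hy.2
    exact_mod_cast this
  refine le_trans ?_ (Finset.single_le_sum (f := fun j : ℕ =>
    p⁻¹ * survival κ univ (y.1, y.2 + -(j * δ))) (fun _ _ => zero_le) hj)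
  rw [survival_of_nonneg _ _ _ (by linarith), indicator_of_mem (mem_univ _),
    ← ENNReal.inv_mul_cancel hp0 hpt]
  gcongr
  exact (hp y.1).trans (measure_mono (Ioi_subset_Ioi (by linarith)))

lemma measurable_indicator_snd (T : ℝ) :
    Measurable fun y : S × ℝ => (Icc (0 : ℝ) T).indicator (1 : ℝ → ℝ≥0∞) y.2 :=
  (measurable_one.indicator measurableSet_Icc).comp measurable_snd

/-- With infinite stationary mean, the process becomes sparse: the expected number of steps in a
bounded window of remaining times tends to zero. -/
lemma RenewalSetting.tendsto_potential_Icc (P : RenewalSetting R κ ρ)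
    (hinf : ∫⁻ l, meanWait κ l ∂ρ = ∞) (l₀ : S) (T : ℝ) :
    Tendsto (fun t => ∫⁻ y, (Icc (0 : ℝ) T).indicator 1 y.2 ∂(potential (stepKernel g κ) (l₀, t)))
      atTop (𝓝 0) := by
  have := P.isMarkovKernel_cycleKernel
  have hm := measurable_indicator_snd (S := S) T
  have hs := measurable_survival κ (MeasurableSet.univ (α := S))
  obtain ⟨C, hC, δ, J, hJ⟩ := P.basic.exists_indicator_le (T := T)
  have hK : ∀ {K : Kernel (S × ℝ) (S × ℝ)}, IsEquivariant K → ∀ l t,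
      ∫⁻ y, (Icc (0 : ℝ) T).indicator 1 y.2 ∂(K (l, t)) ≤
        ∑ j ∈ Finset.range J, C * ∫⁻ y, survival κ univ y ∂(K (l, t + -(j * δ))) := by
    intro K hK l t
    refine (lintegral_mono fun y => hJ y).trans_eq ?_
    rw [lintegral_finsetSum _ fun j _ => by fun_prop]
    refine Finset.sum_congr rfl fun j _ => ?_
    rw [lintegral_const_mul _ (by fun_prop), hK l t _ _ hs]
  have hV : Tendsto (fun t => ∫⁻ y, (Icc (0 : ℝ) T).indicator 1 y.2
      ∂(potential (stepKernel R.k κ) (l₀, t))) atTop (𝓝 0) := by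
    have h1 : Tendsto (fun t => ∑ j ∈ Finset.range J, C * ∫⁻ y, survival κ univ y
        ∂(potential (stepKernel R.k κ) (l₀, t + -(j * δ)))) atTop
        (𝓝 (∑ j ∈ Finset.range J, C * 0)) := by
      refine tendsto_finsetSum _ fun j _ => ENNReal.Tendsto.const_mul ?_ (Or.inr hC)
      exact (P.tendsto_survival_potential_k l₀).comp (tendsto_atTop_add_const_right _ _ tendsto_id)
    simp only [mul_zero, Finset.sum_const_zero] at h1
    exact tendsto_of_tendsto_of_tendsto_of_le_of_le tendsto_const_nhds h1 (fun _ => zero_le)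
      fun t => hK (R.isEquivariant_potential_k κ) l₀ t
  set u : ℝ → ℝ≥0∞ := fun t => ∫⁻ l, ∫⁻ y, (Icc (0 : ℝ) T).indicator 1 y.2
    ∂(potential (stepKernel g κ) (l, t)) ∂(R.ν) with hu
  have hum : Measurable u := R.measurable_avg _ hm
  have hub : ∀ t, u t ≤ J * C := by
    intro t
    calc u t ≤ ∫⁻ _, J * C ∂(R.ν) := by
          refine lintegral_mono fun l => (hK (R.isEquivariant_potential κ) l t).trans ?_
          refine (Finset.sum_le_sum fun j _ => mul_le_mul_right
            (P.basic.lintegral_survival_univ_le_one _) C).trans_eq ?_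
          simp
      _ = J * C := by simp
  have hJC : (J : ℝ≥0∞) * C ≠ ∞ := ENNReal.mul_ne_top (by simp) hC
  have hu0 : Tendsto u atTop (𝓝 0) := by
    obtain ⟨h₀, hh₀, H⟩ := P.exists_isDensity
    obtain ⟨W, hW⟩ := H h₀ hh₀ le_rfl
    have hW0 := hW.tendsto_zero P.basic hh₀ hinf
    obtain ⟨N, hN⟩ := exists_nat_gt (T / h₀)
    set c : ℕ → S → ℝ≥0∞ := fun k _ => if k < N + 1 then 1 else 0 with hc
    have hcp : ∀ k, k < N + 1 → ∀ l, c k l = 1 := fun k hk _ => if_pos hk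
    have hcn : ∀ k, ¬ k < N + 1 → ∀ l, c k l = 0 := fun k hk _ => if_neg hk
    have hfin : ∑' k, ∫⁻ l, c k l ∂ρ ≠ ∞ := by
      rw [tsum_eq_sum (s := Finset.range (N + 1))]
      · refine (ENNReal.sum_lt_top.2 fun k hk => ?_).ne
        simp_rw [hcp k (Finset.mem_range.1 hk)]
        simp
      · intro k hk
        simp_rw [hcn k (fun h => hk (Finset.mem_range.2 h))]
        simp
    obtain ⟨h1, h2⟩ := hW.2 c (fun k => k * h₀) (fun k => measurable_const)
      (fun k l => by
        by_cases hk : k < N + 1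
        · exact (hcp k hk l).le
        · exact (hcn k hk l).le.trans zero_le) hfin
    have h3 := h2.add (hW0.const_mul (∑' k, ∫⁻ l, c k l ∂ρ).toReal)
    simp only [sub_add_cancel, mul_zero, add_zero] at h3
    have h4 := (ENNReal.tendsto_toReal_iff h1 ENNReal.zero_ne_top).1 (by simpa using h3)
    refine tendsto_of_tendsto_of_tendsto_of_le_of_le tendsto_const_nhds h4 (fun _ => zero_le)
      fun t => lintegral_mono fun l => lintegral_mono fun y => ?_
    by_cases hy : y.2 ∈ Icc 0 T
    swap
    · rw [indicator_of_notMem hy]; exact zero_le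
    rw [indicator_of_mem hy, Pi.one_apply]
    obtain ⟨j, h5, h6⟩ := exists_nat_mul_le hh₀ hy.1
    have hj : j < N := by
      have : (j : ℝ) < N := by
        refine lt_of_le_of_lt ?_ hN
        rw [le_div_iff₀ hh₀]
        exact h5.trans hy.2
      exact_mod_cast this
    refine le_trans ?_ (ENNReal.sum_le_tsum {j, j + 1})
    rw [Finset.sum_pair (by simp), ← hat_add_hat hh₀ h5 h6.le, hcp j (by omega) y.1,
      hcp (j + 1) (by omega) y.1, one_mul, one_mul]
  have hH : Tendsto (fun t => ∫⁻ x, u (t - x) ∂(R.cycleKernel κ l₀)) atTop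
      (𝓝 (∫⁻ _, 0 ∂(R.cycleKernel κ l₀))) := by
    refine tendsto_lintegral_filter_of_dominated_convergence (fun _ => J * C)
      (Eventually.of_forall fun t => by fun_prop)
      (Eventually.of_forall fun t => ae_of_all _ fun x => hub _)
      (by simpa using hJC) (ae_of_all _ fun x => ?_)
    exact hu0.comp (tendsto_atTop_add_const_right _ (-x) tendsto_id)
  rw [lintegral_zero] at hH
  have h4 := hV.add hH
  rw [zero_add] at h4
  exact h4.congr fun t => (R.lintegral_potential_eq κ l₀ t hm).symm

end

section

variable {S : Type*} [MeasurableSpace S]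

/-! ### Comparison with a common tail -/

/-- A reference tail `T` with which the tails of all waiting times are comparable: the tail of
type `l` is asymptotically `p l * T`, uniformly in `l`, and convolution with the waiting time laws
does not change `T` asymptotically. -/
structure IsReferenceTail (κ : Kernel S ℝ) (T : ℝ → ℝ) (p : S → ℝ) : Prop where
  measurable : Measurable T
  nonneg : ∀ t, 0 ≤ T t
  le_one : ∀ t, T t ≤ 1
  tendsto : Tendsto T atTop (𝓝 0)
  measurable_factor : Measurable p
  bounded_factor : ∃ M, ∀ l, |p l| ≤ M
  le_survival : ∃ C : ℝ≥0∞, C ≠ ∞ ∧ ∀ y : S × ℝ, ENNReal.ofReal (T y.2) ≤ C * survival κ univ y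
  tail : ∀ η > 0, ∃ t₀, ∀ l t, t₀ ≤ t → |(κ l).real (Ioi t) - p l * T t| ≤ η * T t
  conv : ∀ η > 0, ∃ t₀, ∀ l t, t₀ ≤ t → |∫ x, T (t - x) ∂(κ l) - T t| ≤ η * T t

variable {κ : Kernel S ℝ} [IsMarkovKernel κ] {g : Kernel S S} [IsMarkovKernel g]
  {R : Regeneration g} {ρ : Measure S} [IsProbabilityMeasure ρ] {T : ℝ → ℝ} {p : S → ℝ}

omit [IsMarkovKernel κ] in
lemma IsReferenceTail.eq_zero_of_neg [Nonempty S] (H : IsReferenceTail κ T p) {t : ℝ} (ht : t < 0) :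
    T t = 0 := by
  obtain ⟨C, hC, h⟩ := H.le_survival
  have h1 := h (Classical.arbitrary S, t)
  rw [survival_of_neg _ _ _ ht, mul_zero, nonpos_iff_eq_zero, ENNReal.ofReal_eq_zero] at h1
  exact le_antisymm h1 (H.nonneg t)

lemma IsReferenceTail.integrable (hκ : BasicAssumptions κ) (H : IsReferenceTail κ T p)
    (y₀ : S × ℝ) : Integrable (fun y => T y.2) (potential (stepKernel g κ) y₀) := by
  obtain ⟨C, hC, h⟩ := H.le_survival
  have hm := H.measurable
  refine ⟨(by fun_prop : Measurable _).aestronglyMeasurable, ?_⟩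
  rw [hasFiniteIntegral_iff_ofReal (ae_of_all _ fun y => H.nonneg _)]
  refine (lintegral_mono fun y => h y).trans_lt ?_
  rw [lintegral_const_mul _ (measurable_survival κ .univ)]
  exact ENNReal.mul_lt_top hC.lt_top
    ((hκ.lintegral_survival_univ_le_one y₀).trans_lt ENNReal.one_lt_top)

lemma IsReferenceTail.exists_integral_le (hκ : BasicAssumptions κ) (H : IsReferenceTail κ T p) :
    ∃ C : ℝ, 0 ≤ C ∧ ∀ y₀, ∫ y, T y.2 ∂(potential (stepKernel g κ) y₀) ≤ C := by
  obtain ⟨C, hC, h⟩ := H.le_survival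
  have hm := H.measurable
  refine ⟨C.toReal, ENNReal.toReal_nonneg, fun y₀ => ?_⟩
  rw [integral_eq_lintegral_of_nonneg_ae (ae_of_all _ fun y => H.nonneg _)
    (by fun_prop : Measurable _).aestronglyMeasurable]
  refine ENNReal.toReal_mono hC ((lintegral_mono fun y => h y).trans ?_)
  rw [lintegral_const_mul _ (measurable_survival κ .univ)]
  exact mul_le_of_le_one_right' (hκ.lintegral_survival_univ_le_one y₀)

lemma indicator_one_nonneg (s : Set ℝ) (x : ℝ) : 0 ≤ s.indicator (1 : ℝ → ℝ) x :=
  indicator_nonneg (fun _ _ => zero_le_one) x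

omit [IsProbabilityMeasure ρ] in
lemma RenewalSetting.integrable_indicator (P : RenewalSetting R κ ρ) (s : ℝ) (y₀ : S × ℝ) :
    Integrable (fun y : S × ℝ => (Icc 0 s).indicator (1 : ℝ → ℝ) y.2)
      (potential (stepKernel g κ) y₀) := by
  obtain ⟨C, hC, δ, J, hJ⟩ := P.basic.exists_indicator_le (T := s)
  have hs := measurable_survival κ (MeasurableSet.univ (α := S))
  refine ⟨((measurable_one.indicator measurableSet_Icc).comp
    measurable_snd).aestronglyMeasurable, ?_⟩
  rw [hasFiniteIntegral_iff_ofReal (ae_of_all _ fun y => indicator_one_nonneg _ _)]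
  have h1 : ∀ y : S × ℝ, ENNReal.ofReal ((Icc 0 s).indicator (1 : ℝ → ℝ) y.2)
      = (Icc 0 s).indicator (1 : ℝ → ℝ≥0∞) y.2 := by
    intro y
    by_cases hy : y.2 ∈ Icc 0 s
    · simp only [indicator_of_mem hy, Pi.one_apply, ENNReal.ofReal_one]
    · simp only [indicator_of_notMem hy, ENNReal.ofReal_zero]
  simp_rw [h1]
  refine (lintegral_mono fun y => hJ y).trans_lt ?_
  rw [lintegral_finsetSum _ fun j _ => by fun_prop]
  refine ENNReal.sum_lt_top.2 fun j _ => ?_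
  rw [lintegral_const_mul _ (by fun_prop)]
  refine ENNReal.mul_lt_top hC.lt_top ?_
  have h2 := R.isEquivariant_potential κ y₀.1 y₀.2 (-(j * δ)) _ hs
  rw [← h2]
  exact (P.basic.lintegral_survival_univ_le_one _).trans_lt ENNReal.one_lt_top

lemma RenewalSetting.tendsto_integral_indicator (P : RenewalSetting R κ ρ)
    (hinf : ∫⁻ l, meanWait κ l ∂ρ = ∞) (l₀ : S) (s : ℝ) :
    Tendsto (fun t => ∫ y, (Icc 0 s).indicator (1 : ℝ → ℝ) y.2
      ∂(potential (stepKernel g κ) (l₀, t))) atTop (𝓝 0) := by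
  have h1 := (ENNReal.tendsto_toReal ENNReal.zero_ne_top).comp
    (P.tendsto_potential_Icc hinf l₀ s)
  rw [ENNReal.toReal_zero] at h1
  refine h1.congr fun t => ?_
  rw [integral_eq_lintegral_of_nonneg_ae
    (ae_of_all _ fun y => indicator_one_nonneg _ _)
    ((measurable_one.indicator measurableSet_Icc).comp measurable_snd).aestronglyMeasurable]
  simp only [Function.comp_apply]
  congr 1
  refine lintegral_congr fun y => ?_
  by_cases hy : y.2 ∈ Icc 0 s
  · simp only [indicator_of_mem hy, Pi.one_apply, ENNReal.ofReal_one]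
  · simp only [indicator_of_notMem hy, ENNReal.ofReal_zero]

/-- Functions that are small with respect to the reference tail after some time do not contribute
to the limit. -/
lemma RenewalSetting.tendsto_integral_zero (P : RenewalSetting R κ ρ)
    (hinf : ∫⁻ l, meanWait κ l ∂ρ = ∞) (H : IsReferenceTail κ T p) (l₀ : S) {f : S × ℝ → ℝ}
    {M : ℝ} (hM : ∀ y, |f y| ≤ M) (h0 : ∀ y : S × ℝ, y.2 < 0 → f y = 0)
    (hf : ∀ η > 0, ∃ t₀, ∀ l t, t₀ ≤ t → |f (l, t)| ≤ η * T t) :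
    Tendsto (fun t => ∫ y, f y ∂(potential (stepKernel g κ) (l₀, t))) atTop (𝓝 0) := by
  obtain ⟨C, hC, hTC⟩ := H.exists_integral_le (g := g) P.basic
  have hM0 : 0 ≤ M := (abs_nonneg _).trans (hM (l₀, 0))
  rw [Metric.tendsto_atTop']
  intro ε hε
  obtain ⟨t₀, ht₀⟩ := hf (ε / (2 * (C + 1))) (by positivity)
  have hlim := (P.tendsto_integral_indicator hinf l₀ t₀).const_mul M
  rw [mul_zero] at hlim
  obtain ⟨t₁, ht₁⟩ := eventually_atTop.1 (hlim.eventually_lt_const (half_pos hε))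
  refine ⟨t₁, fun t ht => ?_⟩
  rw [Real.dist_eq, sub_zero]
  have hi1 := (H.integrable (g := g) P.basic (l₀, t)).const_mul (ε / (2 * (C + 1)))
  have hi2 := (P.integrable_indicator t₀ (l₀, t)).const_mul M
  calc |∫ y, f y ∂(potential (stepKernel g κ) (l₀, t))|
      ≤ ∫ y, (ε / (2 * (C + 1)) * T y.2 + M * (Icc 0 t₀).indicator (1 : ℝ → ℝ) y.2)
          ∂(potential (stepKernel g κ) (l₀, t)) := by
        rw [← Real.norm_eq_abs]
        refine norm_integral_le_of_norm_le (hi1.add hi2) (ae_of_all _ fun y => ?_)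
        rw [Real.norm_eq_abs]
        have h1 : 0 ≤ ε / (2 * (C + 1)) * T y.2 := mul_nonneg (by positivity) (H.nonneg _)
        have h2 : 0 ≤ M * (Icc 0 t₀).indicator (1 : ℝ → ℝ) y.2 :=
          mul_nonneg hM0 (indicator_one_nonneg _ _)
        rcases lt_or_ge y.2 0 with hy | hy
        · rw [h0 y hy, abs_zero]; positivity
        · rcases le_total t₀ y.2 with hy' | hy'
          · exact (ht₀ y.1 y.2 hy').trans (le_add_of_nonneg_right h2)
          · rw [indicator_of_mem (show y.2 ∈ Icc 0 t₀ from ⟨hy, hy'⟩), Pi.one_apply, mul_one]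
            exact (hM y).trans (le_add_of_nonneg_left h1)
    _ = ε / (2 * (C + 1)) * ∫ y, T y.2 ∂(potential (stepKernel g κ) (l₀, t))
        + M * ∫ y, (Icc 0 t₀).indicator (1 : ℝ → ℝ) y.2
          ∂(potential (stepKernel g κ) (l₀, t)) := by
        rw [integral_add hi1 hi2, integral_const_mul, integral_const_mul]
    _ < ε := by
        have h1 : ε / (2 * (C + 1)) * ∫ y, T y.2 ∂(potential (stepKernel g κ) (l₀, t))
            ≤ ε / (2 * (C + 1)) * (C + 1) := by
          gcongr
          linarith [hTC (l₀, t)]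
        have h2 : ε / (2 * (C + 1)) * (C + 1) = ε / 2 := by field_simp
        linarith [ht₁ t ht.le]

/-- The potential of a product of a bounded function of the type and the reference tail depends
on the function through its stationary mean only, asymptotically. -/
lemma RenewalSetting.tendsto_integral_mul_sub (P : RenewalSetting R κ ρ)
    (hinf : ∫⁻ l, meanWait κ l ∂ρ = ∞) (H : IsReferenceTail κ T p) (l₀ : S) {c : S → ℝ}
    (hc : Measurable c) {M : ℝ} (hM : ∀ l, |c l| ≤ M) :
    Tendsto (fun t => ∫ y, c y.1 * T y.2 ∂(potential (stepKernel g κ) (l₀, t))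
      - (∫ l, c l ∂ρ) * ∫ y, T y.2 ∂(potential (stepKernel g κ) (l₀, t))) atTop (𝓝 0) := by
  have hne : Nonempty S := ⟨l₀⟩
  have hTm := H.measurable
  obtain ⟨h', C', hh'm, hC', hpois'⟩ := R.exists_poisson P.gap P.invariant P.accessible hc hM
  -- shift the solution of the Poisson equation to make it nonnegative
  set h : S → ℝ := fun l => h' l + C' with hh
  set C := C' + C' with hCC
  have hhm : Measurable h := hh'm.add_const _
  have hi' : ∀ l, Integrable h' (g l) := fun l => Integrable.of_bound hh'm.aestronglyMeasurable C'
    (ae_of_all _ hC')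
  have hh0 : ∀ l, 0 ≤ h l := fun l => by have := (abs_le.1 (hC' l)).1; simp only [hh]; linarith
  have hhC : ∀ l, h l ≤ C := fun l => by have := (abs_le.1 (hC' l)).2; simp only [hh, hCC]; linarith
  have hC0 : 0 ≤ C := (hh0 l₀).trans (hhC l₀)
  have hi : ∀ l, Integrable h (g l) := fun l => (hi' l).add (integrable_const _)
  set Ph : S → ℝ := fun l => ∫ y, h y ∂(g l) with hPh
  have hPhm : Measurable Ph := hhm.stronglyMeasurable.integral_kernel.measurable
  have hPh0 : ∀ l, 0 ≤ Ph l := fun l => integral_nonneg hh0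
  have hPhC : ∀ l, Ph l ≤ C := fun l => by
    calc Ph l ≤ ∫ _, C ∂(g l) := integral_mono (hi l) (integrable_const _) hhC
      _ = C := by simp
  have hpois : ∀ l, c l - ∫ y, c y ∂ρ = h l - Ph l := by
    intro l
    rw [hpois' l, hPh]
    simp only [hh]
    rw [integral_add (hi' l) (integrable_const _)]
    simp
  -- the convolution of the reference tail with the waiting time laws
  set Tc : S × ℝ → ℝ := fun y => ∫ x, T (y.2 - x) ∂(κ y.1) with hTc
  have hTi : ∀ (l : S) t, Integrable (fun x => T (t - x)) (κ l) := fun l t =>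
    Integrable.of_bound (by fun_prop : Measurable _).aestronglyMeasurable 1
      (ae_of_all _ fun x => by rw [Real.norm_eq_abs, abs_of_nonneg (H.nonneg _)]; exact H.le_one _)
  have hTcm : Measurable Tc := by
    have h1 : StronglyMeasurable fun q : (S × ℝ) × ℝ => T (q.1.2 - q.2) :=
      (by fun_prop : Measurable _).stronglyMeasurable
    exact (h1.integral_kernel_prod_right'
      (κ := κ.comap (Prod.fst : S × ℝ → S) measurable_fst)).measurable
  have hTc0 : ∀ y, 0 ≤ Tc y := fun y => integral_nonneg fun x => H.nonneg _
  have hTc1 : ∀ y, Tc y ≤ 1 := fun y => by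
    calc Tc y ≤ ∫ _, 1 ∂(κ y.1) := integral_mono (hTi _ _) (integrable_const _) fun x => H.le_one _
      _ = 1 := by simp
  have hTcneg : ∀ y : S × ℝ, y.2 < 0 → Tc y = 0 := by
    intro y hy
    refine integral_eq_zero_of_ae ?_
    filter_upwards [P.basic.nonneg y.1] with x hx
    exact H.eq_zero_of_neg (by linarith)
  -- the error term of the Poisson equation
  have herr := P.tendsto_integral_zero hinf H l₀ (f := fun y => Ph y.1 * (Tc y - T y.2)) (M := C)
    (fun y => by
      rw [abs_mul, abs_of_nonneg (hPh0 _)]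
      have h1 : |Tc y - T y.2| ≤ 1 := by
        rw [abs_le]
        constructor <;> linarith [hTc0 y, hTc1 y, H.nonneg y.2, H.le_one y.2]
      exact (mul_le_mul (hPhC _) h1 (abs_nonneg _) hC0).trans_eq (mul_one C))
    (fun y hy => by rw [hTcneg y hy, H.eq_zero_of_neg hy]; simp)
    (fun η hη => by
      obtain ⟨t₀, ht₀⟩ := H.conv (η / (C + 1)) (by positivity)
      refine ⟨t₀, fun l t ht => ?_⟩
      rw [abs_mul, abs_of_nonneg (hPh0 _)]
      have h1 : (C + 1) * (η / (C + 1) * T t) = η * T t := by field_simp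
      rw [← h1]
      exact mul_le_mul (by linarith [hPhC l]) (ht₀ l t ht) (abs_nonneg _) (by linarith))
  have h0 := (H.tendsto.const_mul (h l₀)).add herr
  rw [mul_zero, add_zero] at h0
  refine h0.congr fun t => ?_
  set m := potential (stepKernel g κ) (l₀, t) with hm
  have hTint : Integrable (fun y => T y.2) m := H.integrable P.basic _
  have hb : ∀ {f : S → ℝ}, Measurable f → (∀ l, |f l| ≤ C) →
      Integrable (fun y : S × ℝ => f y.1 * T y.2) m := fun hf hfC =>
    hTint.bdd_mul (hf.comp measurable_fst).aestronglyMeasurable (ae_of_all _ fun y => hfC y.1)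
  have hhT : Integrable (fun y => h y.1 * T y.2) m :=
    hb hhm fun l => by rw [abs_of_nonneg (hh0 l)]; exact hhC l
  have hPhT : Integrable (fun y => Ph y.1 * T y.2) m :=
    hb hPhm fun l => by rw [abs_of_nonneg (hPh0 l)]; exact hPhC l
  have hmeas1 : Measurable fun y : S × ℝ => ENNReal.ofReal (h y.1 * T y.2) := by fun_prop
  have hmeas2 : Measurable fun y : S × ℝ => Ph y.1 * Tc y := by fun_prop
  have hstep : ∀ y : S × ℝ, ∫⁻ z, ENNReal.ofReal (h z.1 * T z.2) ∂(stepKernel g κ y)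
      = ENNReal.ofReal (Ph y.1 * Tc y) := by
    intro y
    rw [lintegral_stepKernel _ _ _ hmeas1]
    simp_rw [ENNReal.ofReal_mul (hh0 _)]
    have h1 : ∀ x, ∫⁻ l, ENNReal.ofReal (h l) * ENNReal.ofReal (T (y.2 - x)) ∂(g y.1)
        = ENNReal.ofReal (Ph y.1) * ENNReal.ofReal (T (y.2 - x)) := by
      intro x
      rw [lintegral_mul_const _ (by fun_prop), hPh,
        ofReal_integral_eq_lintegral_ofReal (hi _) (ae_of_all _ hh0)]
    simp_rw [h1]
    rw [lintegral_const_mul _ (by fun_prop), ENNReal.ofReal_mul (hPh0 _), hTc,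
      ofReal_integral_eq_lintegral_ofReal (hTi _ _) (ae_of_all _ fun x => H.nonneg _)]
  have hU := lintegral_potential_eq_add' (stepKernel g κ) (l₀, t) hmeas1
  simp_rw [hstep] at hU
  have hfin : ∫⁻ y, ENNReal.ofReal (h y.1 * T y.2) ∂m ≠ ∞ :=
    ((hasFiniteIntegral_iff_ofReal (ae_of_all _ fun y => mul_nonneg (hh0 _) (H.nonneg _))).1
      hhT.2).ne
  have hPhTc : Integrable (fun y => Ph y.1 * Tc y) m := by
    refine ⟨hmeas2.aestronglyMeasurable, ?_⟩
    rw [hasFiniteIntegral_iff_ofReal (ae_of_all _ fun y => mul_nonneg (hPh0 _) (hTc0 _))]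
    refine lt_of_le_of_lt ?_ hfin.lt_top
    rw [hm, hU]
    exact le_add_self
  have hUreal : ∫ y, h y.1 * T y.2 ∂m = h l₀ * T t + ∫ y, Ph y.1 * Tc y ∂m := by
    rw [integral_eq_lintegral_of_nonneg_ae (ae_of_all _ fun y => mul_nonneg (hh0 _) (H.nonneg _))
      hhT.1, integral_eq_lintegral_of_nonneg_ae (ae_of_all _ fun y => mul_nonneg (hPh0 _) (hTc0 _))
      hPhTc.1, hm, hU, ENNReal.toReal_add ENNReal.ofReal_ne_top, ENNReal.toReal_ofReal
      (mul_nonneg (hh0 _) (H.nonneg _))]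
    exact ((hasFiniteIntegral_iff_ofReal (ae_of_all _ fun y => mul_nonneg (hPh0 _) (hTc0 _))).1
      hPhTc.2).ne
  have h1 : ∫ y, Ph y.1 * (Tc y - T y.2) ∂m
      = ∫ y, Ph y.1 * Tc y ∂m - ∫ y, Ph y.1 * T y.2 ∂m := by
    rw [← integral_sub hPhTc hPhT]
    simp only [mul_sub]
  have h2 : ∀ y : S × ℝ, c y.1 * T y.2
      = h y.1 * T y.2 - Ph y.1 * T y.2 + (∫ l, c l ∂ρ) * T y.2 := by
    intro y
    have := hpois y.1
    linear_combination (T y.2) * this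
  have h3 : ∫ y, c y.1 * T y.2 ∂m = ∫ y, h y.1 * T y.2 ∂m - ∫ y, Ph y.1 * T y.2 ∂m
      + (∫ l, c l ∂ρ) * ∫ y, T y.2 ∂m := by
    simp_rw [h2]
    have hsub : Integrable (fun y => h y.1 * T y.2 - Ph y.1 * T y.2) m := hhT.sub hPhT
    rw [integral_add hsub (hTint.const_mul _), integral_sub hhT hPhT, integral_const_mul]
  rw [h3, hUreal, h1]
  ring

/-- If the stationary mean is infinite and the tails of the waiting times are comparable, then the
law of the current type is asymptotically the invariant measure biased by the comparison factor. -/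
theorem RenewalSetting.tendsto_currentTypeProb_of_isReferenceTail (P : RenewalSetting R κ ρ)
    (hinf : ∫⁻ l, meanWait κ l ∂ρ = ∞) (H : IsReferenceTail κ T p) (hp : 0 < ∫ l, p l ∂ρ)
    {A : Set S} (hA : MeasurableSet A) (l₀ : S) :
    Tendsto (fun t => currentTypeProb g κ t l₀ A) atTop
      (𝓝 ((∫ l in A, p l ∂ρ) / ∫ l, p l ∂ρ)) := by
  have hne : Nonempty S := ⟨l₀⟩
  have hTm := H.measurable
  have hpm := H.measurable_factor
  obtain ⟨M, hM⟩ := H.bounded_factor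
  have hM0 : 0 ≤ M := (abs_nonneg _).trans (hM l₀)
  set W : ℝ → ℝ := fun t => ∫ y, T y.2 ∂(potential (stepKernel g κ) (l₀, t)) with hW
  have key : ∀ {A : Set S}, MeasurableSet A → Tendsto (fun t => currentTypeProb g κ t l₀ A
      - (∫ l in A, p l ∂ρ) * W t) atTop (𝓝 0) := by
    intro A hA
    have hAp : Measurable (A.indicator p) := hpm.indicator hA
    have hApM : ∀ l, |A.indicator p l| ≤ M := fun l => by
      by_cases hl : l ∈ A
      · rw [indicator_of_mem hl]; exact hM l
      · rw [indicator_of_notMem hl, abs_zero]; exact hM0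
    have hs := measurable_survival κ hA
    have hs1 : ∀ y, survival κ A y ≤ 1 := fun y => (indicator_le_self _ _ y).trans prob_le_one
    have h1 := P.tendsto_integral_mul_sub hinf H l₀ hAp hApM
    have h2 := P.tendsto_integral_zero hinf H l₀
      (f := fun y => (survival κ A y).toReal - A.indicator p y.1 * T y.2) (M := 1 + M)
      (fun y => by
        refine (abs_sub _ _).trans (add_le_add ?_ ?_)
        · rw [abs_of_nonneg ENNReal.toReal_nonneg]
          exact ENNReal.toReal_le_of_le_ofReal zero_le_one (by simpa using hs1 y)
        · rw [abs_mul, abs_of_nonneg (H.nonneg _)]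
          exact (mul_le_mul (hApM _) (H.le_one _) (H.nonneg _) hM0).trans_eq (mul_one M))
      (fun y hy => by
        obtain ⟨l, t⟩ := y
        rw [survival_of_neg _ _ _ hy, H.eq_zero_of_neg hy]; simp)
      (fun η hη => by
        obtain ⟨t₀, ht₀⟩ := H.tail η hη
        refine ⟨max t₀ 0, fun l t ht => ?_⟩
        rw [survival_of_nonneg _ _ _ ((le_max_right _ _).trans ht)]
        by_cases hl : l ∈ A
        · rw [indicator_of_mem hl, indicator_of_mem hl]
          exact ht₀ l t ((le_max_left _ _).trans ht)
        · rw [indicator_of_notMem hl, indicator_of_notMem hl]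
          simpa using mul_nonneg hη.le (H.nonneg t))
    have h3 := h1.add h2
    rw [add_zero] at h3
    refine h3.congr' ?_
    filter_upwards [eventually_ge_atTop 0] with t ht
    set m := potential (stepKernel g κ) (l₀, t) with hm
    have hsfin : ∫⁻ y, survival κ A y ∂m ≠ ∞ :=
      ne_top_of_le_ne_top ENNReal.one_ne_top ((lintegral_mono fun y =>
        survival_mono κ (subset_univ A) y).trans (P.basic.lintegral_survival_univ_le_one _))
    have hsi : Integrable (fun y => (survival κ A y).toReal) m :=
      integrable_toReal_of_lintegral_ne_top hs.aemeasurable hsfin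
    have hTi : Integrable (fun y : S × ℝ => A.indicator p y.1 * T y.2) m :=
      (H.integrable P.basic _).bdd_mul (hAp.comp measurable_fst).aestronglyMeasurable
        (ae_of_all _ fun y => hApM y.1)
    have h4 : currentTypeProb g κ t l₀ A = ∫ y, (survival κ A y).toReal ∂m := by
      rw [integral_toReal hs.aemeasurable (ae_of_all _ fun y =>
        (hs1 y).trans_lt ENNReal.one_lt_top), ← P.basic.renewalLaw_currentType g ht l₀ hA]
      rfl
    rw [integral_sub hsi hTi, h4, integral_indicator hA]
    ring
  have huniv := key MeasurableSet.univ
  have hone : ∀ t, currentTypeProb g κ t l₀ univ = 1 := by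
    intro t
    simp [currentTypeProb]
  simp_rw [hone, setIntegral_univ] at huniv
  have h1 : Tendsto (fun t => (∫ l, p l ∂ρ) * W t) atTop (𝓝 1) := by
    have := (tendsto_const_nhds (x := (1 : ℝ))).sub huniv
    simpa using this
  have h2 : Tendsto W atTop (𝓝 (1 / ∫ l, p l ∂ρ)) := by
    refine (h1.div_const (∫ l, p l ∂ρ)).congr fun t => ?_
    field_simp
  have h3 := (key hA).add (h2.const_mul (∫ l in A, p l ∂ρ))
  simp only [sub_add_cancel, zero_add, mul_one_div] at h3
  exact h3

end

section

variable {S : Type*} [MeasurableSpace S]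

/-! ### The cycle law is not arithmetic -/

lemma measurableSet_zmultiples (d : ℝ) : MeasurableSet (AddSubgroup.zmultiples d : Set ℝ) := by
  have : (AddSubgroup.zmultiples d : Set ℝ) = range fun k : ℤ => k • d := rfl
  rw [this]
  exact (countable_range _).measurableSet

lemma exists_int_iff_mem_zmultiples (d x : ℝ) :
    (∃ k : ℤ, x = k * d) ↔ x ∈ AddSubgroup.zmultiples d := by
  simp only [AddSubgroup.mem_zmultiples_iff, zsmul_eq_mul, eq_comm]

namespace Regeneration

variable {g : Kernel S S} (R : Regeneration g) (κ : Kernel S ℝ)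

/-- The probability to regenerate in the next step, at a remaining time outside `dℤ`. -/
noncomputable def missStep (d : ℝ) (y : S × ℝ) : ℝ≥0∞ :=
  R.B.indicator (fun _ => R.e) y.1 * κ y.1 {x | y.2 - x ∉ AddSubgroup.zmultiples d}

/-- The probability that the remaining time at the next regeneration lies outside `dℤ`. -/
noncomputable def missProb (d : ℝ) (y : S × ℝ) : ℝ≥0∞ :=
  ∫⁻ z, R.missStep κ d z ∂(potential (stepKernel R.k κ) y)

variable [IsMarkovKernel κ]

@[fun_prop]
lemma measurable_missStep (d : ℝ) : Measurable (R.missStep κ d) := by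
  have h : MeasurableSet {p : (S × ℝ) × ℝ | p.1.2 - p.2 ∉ AddSubgroup.zmultiples d} :=
    ((measurableSet_zmultiples d).preimage (by fun_prop :
      Measurable fun p : (S × ℝ) × ℝ => p.1.2 - p.2)).compl
  have h2 := Kernel.measurable_kernel_prodMk_left
    (κ := κ.comap (Prod.fst : S × ℝ → S) measurable_fst) h
  exact ((measurable_const.indicator R.measurableSet_B).comp measurable_fst).mul h2

@[fun_prop]
lemma measurable_missProb (d : ℝ) : Measurable (R.missProb κ d) :=
  (R.measurable_missStep κ d).lintegral_kernel

lemma lintegral_stepKernel_r_indicator (d : ℝ) (y : S × ℝ) :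
    ∫⁻ z, (AddSubgroup.zmultiples d : Set ℝ)ᶜ.indicator 1 z.2 ∂(stepKernel R.r κ y)
      = R.missStep κ d y := by
  have hD := (measurableSet_zmultiples d).compl
  have h2 : Measurable fun x : ℝ => y.2 - x := by fun_prop
  have h3 : Measurable fun x : ℝ =>
      (AddSubgroup.zmultiples d : Set ℝ)ᶜ.indicator (1 : ℝ → ℝ≥0∞) (y.2 - x) :=
    (measurable_one.indicator hD).comp h2
  rw [lintegral_stepKernel _ _ _ (f := fun z : S × ℝ =>
    (AddSubgroup.zmultiples d : Set ℝ)ᶜ.indicator (1 : ℝ → ℝ≥0∞) z.2)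
    ((measurable_one.indicator hD).comp measurable_snd), missStep]
  simp only [r, lintegral_regenKernel]
  simp only [lintegral_const, measure_univ, mul_one]
  rw [lintegral_const_mul _ h3]
  exact congrArg _ (lintegral_indicator_one (hD.preimage h2))

lemma exists_missProb_eq_zero [IsMarkovKernel (R.cycleKernel κ)] {d : ℝ}
    (h : ∀ᵐ x ∂(R.cycleLaw κ), ∃ k : ℤ, x = k * d) : ∃ l, R.missProb κ d (l, 0) = 0 := by
  simp_rw [exists_int_iff_mem_zmultiples] at h
  obtain ⟨l, hl⟩ := (Measure.ae_ae_of_ae_comp h).exists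
  refine ⟨l, ?_⟩
  have hD := (measurableSet_zmultiples d).compl
  have h1 := lintegral_elapsed (stepKernel R.r κ ∘ₖ potential (stepKernel R.k κ)) l
    (w := (AddSubgroup.zmultiples d : Set ℝ)ᶜ.indicator 1) (measurable_one.indicator hD)
  rw [lintegral_indicator_one hD] at h1
  have h2 : elapsed (stepKernel R.r κ ∘ₖ potential (stepKernel R.k κ)) l
      (AddSubgroup.zmultiples d : Set ℝ)ᶜ = 0 := ae_iff.1 hl
  rw [h2] at h1
  have h3 : ∀ y : S × ℝ, (AddSubgroup.zmultiples d : Set ℝ)ᶜ.indicator (1 : ℝ → ℝ≥0∞) (-y.2)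
      = (AddSubgroup.zmultiples d : Set ℝ)ᶜ.indicator 1 y.2 := by
    intro y
    simp [indicator]
  simp_rw [h3] at h1
  rw [Kernel.lintegral_comp _ _ _ (g := fun y : S × ℝ =>
    (AddSubgroup.zmultiples d : Set ℝ)ᶜ.indicator (1 : ℝ → ℝ≥0∞) y.2)
    ((measurable_one.indicator hD).comp measurable_snd)] at h1
  simp_rw [R.lintegral_stepKernel_r_indicator] at h1
  exact h1.symm

/-- If the next regeneration occurs at a multiple of `d`, then the waiting time at the regeneration,
which is independent of the remaining time before it, is concentrated on an arithmetic
progression. -/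
lemma exists_isLattice_of_missProb_eq_zero {d : ℝ} (hd : 0 < d) {l : S}
    (hl : ∫⁻ x, R.B.indicator (fun _ => R.e) x ∂(potential R.k l) ≠ 0)
    (h : R.missProb κ d (l, 0) = 0) : ∃ l', IsLattice (κ l') := by
  have hB : Measurable (R.B.indicator fun _ => R.e) := measurable_const.indicator R.measurableSet_B
  have h1 := (lintegral_eq_zero_iff (R.measurable_missStep κ d)).1 h
  rw [← lintegral_fst_potential R.k κ l 0 hB] at hl
  have h2 : ∃ y : S × ℝ, R.B.indicator (fun _ => R.e) y.1 ≠ 0 ∧ R.missStep κ d y = 0 := by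
    by_contra! h3
    refine hl (lintegral_eq_zero_of_ae_eq_zero ?_)
    filter_upwards [h1] with y hy
    by_contra h4
    exact h3 y h4 hy
  obtain ⟨y, hy1, hy2⟩ := h2
  refine ⟨y.1, y.2, d, hd, ?_⟩
  have h5 : ∀ᵐ x ∂(κ y.1), y.2 - x ∈ AddSubgroup.zmultiples d :=
    ae_iff.2 ((mul_eq_zero.1 hy2).resolve_left hy1)
  filter_upwards [h5] with x hx
  obtain ⟨k, hk⟩ := (exists_int_iff_mem_zmultiples d _).2 hx
  exact ⟨-k, by push_cast; linarith⟩

lemma missProb_eq_add (d : ℝ) (l : S) (s : ℝ) : R.missProb κ d (l, s) = R.missStep κ d (l, s) +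
    ∫⁻ x, ∫⁻ l', R.missProb κ d (l', s - x) ∂(R.k l) ∂(κ l) := by
  have h := lintegral_potential_eq_add (stepKernel R.k κ) (l, s) (R.measurable_missStep κ d)
  change R.missProb κ d (l, s) = R.missStep κ d (l, s) +
    ∫⁻ y, R.missProb κ d y ∂(stepKernel R.k κ (l, s)) at h
  rw [h, lintegral_stepKernel _ _ _ (R.measurable_missProb κ d)]

end Regeneration

/-- If the waiting times started from the atoms of `ν`, scaled by `c`, all lead to the same class
modulo `d`, then `c` is commensurable with the generator `d₀` of the differences of the atoms. -/
lemma exists_nat_of_forall_atom {T : Set ℝ} {y d₀ d c s r : ℝ} (hy : y ∈ T) (hd₀ : 0 < d₀)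
    (hd : 0 < d) (hc : 0 < c)
    (hT : d₀ ∈ AddSubgroup.closure {z | ∃ x ∈ T, ∃ x' ∈ T, z = x - x'})
    (h : ∀ x ∈ T, s - x / c - r ∈ AddSubgroup.zmultiples d) :
    ∃ m : ℕ, 0 < m ∧ d₀ / c = m * d ∧ s - (r + m * (y * d / d₀)) ∈ AddSubgroup.zmultiples d := by
  have h1 : AddSubgroup.closure {z | ∃ x ∈ T, ∃ x' ∈ T, z = x - x'} ≤
      (AddSubgroup.zmultiples d).comap (AddMonoidHom.mulRight c⁻¹) := by
    rw [AddSubgroup.closure_le]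
    rintro z ⟨x, hx, x', hx', rfl⟩
    have h2 := sub_mem (h x' hx') (h x hx)
    simp only [AddSubgroup.coe_comap, mem_preimage, AddMonoidHom.coe_mulRight, SetLike.mem_coe]
    convert h2 using 1
    ring
  obtain ⟨m, hm⟩ := (exists_int_iff_mem_zmultiples d _).2 (h1 hT)
  replace hm : d₀ * c⁻¹ = m * d := hm
  rw [← div_eq_mul_inv] at hm
  have hm0 : 0 < m := by
    have h2 : 0 < (m : ℝ) * d := by rw [← hm]; positivity
    have h3 := pos_of_mul_pos_left h2 hd.le
    exact_mod_cast h3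
  lift m to ℕ using hm0.le
  refine ⟨m, by exact_mod_cast hm0, by exact_mod_cast hm, ?_⟩
  have h2 : y / c = m * (y * d / d₀) := by
    have h3 : (m : ℝ) * d = d₀ / c := by exact_mod_cast hm.symm
    calc y / c = y * (d₀ / c) / d₀ := by field_simp
      _ = _ := by rw [← h3]; ring
  have h4 := h y hy
  rw [h2] at h4
  convert h4 using 1
  ring

namespace Regeneration

variable {g : Kernel S S} (R : Regeneration g) {κ : Kernel S ℝ} [IsMarkovKernel κ]

/-- For scaled waiting times with a lattice law, the remaining times from which the next
regeneration occurs in `dℤ` form a single class modulo `d`, which is a positive multiple of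
`y * d / d₀`. -/
lemma exists_nat_of_missProb {ν : Measure ℝ} {c : S → ℝ} (hc : ∀ l, 0 < c l)
    (hκ : ∀ l, κ l = ν.map (fun x => x / c l)) {T : Set ℝ} (hTc : T.Countable)
    (hTν : ∀ x ∈ T, ν {x} ≠ 0) {y d₀ d : ℝ} (hy : y ∈ T) (hd₀ : 0 < d₀) (hd : 0 < d)
    (hT : d₀ ∈ AddSubgroup.closure {z | ∃ x ∈ T, ∃ x' ∈ T, z = x - x'}) (n : ℕ) :
    ∀ l, ∫⁻ x, R.B.indicator (fun _ => R.e) x ∂((R.k ^ n) l) ≠ 0 →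
      ∃ K : ℕ, 0 < K ∧ ∀ s, R.missProb κ d (l, s) = 0 →
        s - K * (y * d / d₀) ∈ AddSubgroup.zmultiples d := by
  have hB : Measurable (R.B.indicator fun _ => R.e) := measurable_const.indicator R.measurableSet_B
  have hatom : ∀ (l : S) {p : ℝ → Prop}, MeasurableSet {x | p x} → (∀ᵐ x ∂(κ l), p x) →
      ∀ x ∈ T, p (x / c l) := by
    intro l p hp h x hx
    rw [hκ l, ae_map_iff (by fun_prop) hp] at h
    by_contra h1
    refine hTν x hx (measure_mono_null ?_ (ae_iff.1 h))
    rintro _ rfl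
    exact h1
  -- it is enough to treat two remaining times at once
  have hpair : ∀ l, (∀ s₁ s₂, R.missProb κ d (l, s₁) = 0 → R.missProb κ d (l, s₂) = 0 →
      ∃ K : ℕ, 0 < K ∧ s₁ - K * (y * d / d₀) ∈ AddSubgroup.zmultiples d ∧
        s₂ - K * (y * d / d₀) ∈ AddSubgroup.zmultiples d) →
      ∃ K : ℕ, 0 < K ∧ ∀ s, R.missProb κ d (l, s) = 0 →
        s - K * (y * d / d₀) ∈ AddSubgroup.zmultiples d := by
    intro l h
    by_cases hs : ∃ s, R.missProb κ d (l, s) = 0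
    · obtain ⟨s₁, hs₁⟩ := hs
      obtain ⟨K, hK, h1, -⟩ := h s₁ s₁ hs₁ hs₁
      refine ⟨K, hK, fun s hs => ?_⟩
      obtain ⟨K', -, h2, h3⟩ := h s₁ s hs₁ hs
      have h4 := add_mem (sub_mem h3 h2) h1
      convert h4 using 1
      ring
    · exact ⟨1, one_pos, fun s h => absurd ⟨s, h⟩ hs⟩
  induction n with
  | zero =>
    intro l hl
    rw [lintegral_pow_zero _ _ hB] at hl
    refine hpair l fun s₁ s₂ h₁ h₂ => ?_
    have h3 : ∀ s, R.missProb κ d (l, s) = 0 →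
        ∀ x ∈ T, s - x / c l - 0 ∈ AddSubgroup.zmultiples d := by
      intro s hs x hx
      rw [R.missProb_eq_add, add_eq_zero] at hs
      have h4 : ∀ᵐ x ∂(κ l), s - x ∈ AddSubgroup.zmultiples d :=
        ae_iff.2 ((mul_eq_zero.1 hs.1).resolve_left hl)
      rw [sub_zero]
      exact hatom l ((measurableSet_zmultiples d).preimage
          (by fun_prop : Measurable fun x => s - x))
        h4 x hx
    obtain ⟨m, hm, hmd, hm1⟩ := exists_nat_of_forall_atom hy hd₀ hd (hc l) hT (h3 s₁ h₁)
    obtain ⟨m', -, hmd', hm2⟩ := exists_nat_of_forall_atom hy hd₀ hd (hc l) hT (h3 s₂ h₂)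
    have : m' = m := by
      have h5 : (m' : ℝ) = m := mul_right_cancel₀ hd.ne' (hmd'.symm.trans hmd)
      exact_mod_cast h5
    subst this
    rw [zero_add] at hm1 hm2
    exact ⟨m', hm, hm1, hm2⟩
  | succ n ih =>
    intro l hl
    rw [lintegral_pow_succ _ _ _ hB] at hl
    refine hpair l fun s₁ s₂ h₁ h₂ => ?_
    have h3 : ∀ s, R.missProb κ d (l, s) = 0 →
        ∀ᵐ l' ∂(R.k l), ∀ x ∈ T, R.missProb κ d (l', s - x / c l) = 0 := by
      intro s hs
      rw [R.missProb_eq_add, add_eq_zero] at hs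
      have hm : Measurable fun p : ℝ × S => R.missProb κ d (p.2, s - p.1) :=
        (R.measurable_missProb κ d).comp (by fun_prop)
      have hm2 : Measurable fun x => ∫⁻ l', R.missProb κ d (l', s - x) ∂(R.k l) :=
        hm.lintegral_prod_right'
      have h4 : ∀ᵐ x ∂(κ l), ∫⁻ l', R.missProb κ d (l', s - x) ∂(R.k l) = 0 :=
        (lintegral_eq_zero_iff hm2).1 hs.2
      rw [ae_ball_iff hTc]
      intro x hx
      have h5 := hatom l (hm2 (measurableSet_singleton 0)) h4 x hx
      exact (lintegral_eq_zero_iff ((R.measurable_missProb κ d).comp (by fun_prop))).1 h5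
    -- a state that is good for both remaining times and may still reach a regeneration
    have h4 : ∃ l', ∫⁻ x, R.B.indicator (fun _ => R.e) x ∂((R.k ^ n) l') ≠ 0 ∧
        (∀ x ∈ T, R.missProb κ d (l', s₁ - x / c l) = 0) ∧
        ∀ x ∈ T, R.missProb κ d (l', s₂ - x / c l) = 0 := by
      by_contra! h5
      refine hl (lintegral_eq_zero_of_ae_eq_zero ?_)
      filter_upwards [h3 s₁ h₁, h3 s₂ h₂] with l' h6 h7
      by_contra h8
      obtain ⟨x, hx, hx'⟩ := h5 l' h8 h6
      exact hx' (h7 x hx)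
    obtain ⟨l', h5, h6, h7⟩ := h4
    obtain ⟨K, hK, hKs⟩ := ih l' h5
    obtain ⟨m, hm, hmd, hm1⟩ := exists_nat_of_forall_atom hy hd₀ hd (hc l) hT
      (r := K * (y * d / d₀)) fun x hx => hKs _ (h6 x hx)
    obtain ⟨m', -, hmd', hm2⟩ := exists_nat_of_forall_atom hy hd₀ hd (hc l) hT
      (r := K * (y * d / d₀)) fun x hx => hKs _ (h7 x hx)
    have : m' = m := by
      have h8 : (m' : ℝ) = m := mul_right_cancel₀ hd.ne' (hmd'.symm.trans hmd)
      exact_mod_cast h8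
    subst this
    refine ⟨K + m', by omega, ?_, ?_⟩ <;> push_cast <;> rw [add_mul] <;> assumption

/-- Waiting times that are not concentrated on arithmetic progressions have a cycle law that is
not arithmetic. -/
lemma not_isArithmetic_cycleLaw_of_not_isLattice [IsMarkovKernel (R.cycleKernel κ)]
    (hκ : ∀ l, ¬ IsLattice (κ l)) : ¬ IsArithmetic (R.cycleLaw κ) := by
  rintro ⟨d, hd, h⟩
  obtain ⟨l, hl⟩ := R.exists_missProb_eq_zero κ h
  obtain ⟨l', hl'⟩ := R.exists_isLattice_of_missProb_eq_zero κ hd (by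
    rw [← R.cycleKernel_univ κ l, measure_univ]; exact one_ne_zero) hl
  exact hκ l' hl'

/-- Non-arithmetic waiting times of scaled type have a cycle law that is not arithmetic, even if
the waiting times of each type are concentrated on an arithmetic progression. -/
lemma not_isArithmetic_cycleLaw_of_scaled [IsMarkovKernel (R.cycleKernel κ)] {ν : Measure ℝ}
    [IsProbabilityMeasure ν] {c : S → ℝ} (hc : ∀ l, 0 < c l)
    (hκν : ∀ l, κ l = ν.map (fun x => x / c l)) (hκ : ∀ l, ¬ IsArithmetic (κ l)) :
    ¬ IsArithmetic (R.cycleLaw κ) := by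
  rintro ⟨d, hd, h⟩
  obtain ⟨l, hl⟩ := R.exists_missProb_eq_zero κ h
  have hB : ∫⁻ x, R.B.indicator (fun _ => R.e) x ∂(potential R.k l) ≠ 0 := by
    rw [← R.cycleKernel_univ κ l, measure_univ]; exact one_ne_zero
  have hmul : ∀ (l : S) {d : ℝ}, 0 < d → (∀ᵐ x ∂ν, x ∈ AddSubgroup.zmultiples d) →
      IsArithmetic (κ l) := by
    intro l d hd h
    refine ⟨d / c l, div_pos hd (hc l), ?_⟩
    simp_rw [exists_int_iff_mem_zmultiples]
    rw [hκν l, ae_map_iff (f := fun x => x / c l)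
      (p := fun x => x ∈ AddSubgroup.zmultiples (d / c l)) (by fun_prop)
      (measurableSet_zmultiples _)]
    filter_upwards [h] with x hx
    rw [← exists_int_iff_mem_zmultiples] at hx ⊢
    obtain ⟨k, rfl⟩ := hx
    exact ⟨k, by ring⟩
  obtain ⟨l', y₀, d₁, hd₁, h₁⟩ := R.exists_isLattice_of_missProb_eq_zero κ hd hB hl
  have hcl := hc l'
  have h₂ : ∀ᵐ x ∂ν, x / c l' - y₀ ∈ AddSubgroup.zmultiples d₁ := by
    have h3 : ∀ᵐ x ∂(κ l'), x - y₀ ∈ AddSubgroup.zmultiples d₁ := by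
      filter_upwards [h₁] with x hx
      obtain ⟨k, rfl⟩ := hx
      exact (exists_int_iff_mem_zmultiples _ _).1 ⟨k, by ring⟩
    rw [hκν l', ae_map_iff (f := fun x => x / c l')
      (p := fun x => x - y₀ ∈ AddSubgroup.zmultiples d₁) (by fun_prop)
      ((measurableSet_zmultiples d₁).preimage (by fun_prop : Measurable fun x => x - y₀))] at h3
    exact h3
  -- the atoms carry the whole mass
  set T : Set ℝ := {x | ν {x} ≠ 0} with hT
  have hTl : ∀ x ∈ T, x / c l' - y₀ ∈ AddSubgroup.zmultiples d₁ := by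
    intro x hx
    by_contra h3
    refine hx (measure_mono_null ?_ (ae_iff.1 h₂))
    rintro _ rfl
    exact h3
  have hLc : {x | x / c l' - y₀ ∈ AddSubgroup.zmultiples d₁}.Countable := by
    refine (countable_range fun k : ℤ => (k * d₁ + y₀) * c l').mono fun x hx => ?_
    obtain ⟨k, hk⟩ := (exists_int_iff_mem_zmultiples _ _).2 hx
    refine ⟨k, ?_⟩
    simp only
    rw [← hk]
    field_simp
    ring
  have hTc : T.Countable := hLc.mono hTl
  have hTae : ∀ᵐ x ∂ν, x ∈ T := by
    have h3 : ν ({x | x / c l' - y₀ ∈ AddSubgroup.zmultiples d₁} \ T) = 0 := by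
      have h4 : ({x | x / c l' - y₀ ∈ AddSubgroup.zmultiples d₁} \ T).Countable :=
        hLc.mono sdiff_subset
      refine (measure_null_iff_singleton h4).2 fun x hx => ?_
      by_contra h5
      exact hx.2 h5
    filter_upwards [h₂, measure_eq_zero_iff_ae_notMem.1 h3] with x hx hx'
    by_contra h5
    exact hx' ⟨hx, h5⟩
  obtain ⟨y, hy⟩ := hTae.exists
  -- the group generated by the differences of the atoms is cyclic
  set Γ := AddSubgroup.closure {z | ∃ x ∈ T, ∃ x' ∈ T, z = x - x'} with hΓ
  have hTΓ : ∀ x ∈ T, x - y ∈ Γ := fun x hx => AddSubgroup.subset_closure ⟨x, hx, y, hy, rfl⟩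
  have hΓl : Γ ≤ AddSubgroup.zmultiples (d₁ * c l') := by
    rw [hΓ, AddSubgroup.closure_le]
    rintro z ⟨x, hx, x', hx', rfl⟩
    obtain ⟨k, hk⟩ := (exists_int_iff_mem_zmultiples _ _).2 (sub_mem (hTl x hx) (hTl x' hx'))
    refine (exists_int_iff_mem_zmultiples _ _).1 ⟨k, ?_⟩
    have h3 : x - x' = (x / c l' - y₀ - (x' / c l' - y₀)) * c l' := by field_simp; ring
    rw [h3, hk]
    ring
  have hcyc : ∃ d₀, 0 ≤ d₀ ∧ Γ = AddSubgroup.zmultiples d₀ := by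
    rcases AddSubgroup.dense_or_cyclic Γ with h3 | ⟨a, ha⟩
    · exfalso
      have h4 : Dense (AddSubgroup.zmultiples (d₁ * c l') : Set ℝ) := h3.mono hΓl
      obtain ⟨x, hx, hx1, hx2⟩ := h4.exists_between (show (0 : ℝ) < d₁ * c l' by positivity)
      obtain ⟨k, rfl⟩ := (exists_int_iff_mem_zmultiples _ _).2 hx
      have h5 : 0 < d₁ * c l' := by positivity
      have h6 : (0 : ℝ) < k := pos_of_mul_pos_left hx1 h5.le
      have h7 : (1 : ℝ) ≤ k := by exact_mod_cast (show (0 : ℤ) < k by exact_mod_cast h6)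
      nlinarith
    · rw [← AddSubgroup.zmultiples_eq_closure] at ha
      rcases le_total 0 a with h3 | h3
      · exact ⟨a, h3, ha⟩
      · exact ⟨-a, by linarith, by rw [ha, AddSubgroup.zmultiples_neg]⟩
  obtain ⟨d₀, hd₀, hΓd⟩ := hcyc
  rcases hd₀.eq_or_lt with h0 | hd₀
  · -- a deterministic waiting time
    have h3 : ∀ᵐ x ∂ν, x = y := by
      filter_upwards [hTae] with x hx
      have h4 := hTΓ x hx
      rw [hΓd, ← h0, AddSubgroup.zmultiples_zero_eq_bot, AddSubgroup.mem_bot] at h4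
      linarith
    rcases eq_or_ne y 0 with hy0 | hy0
    · refine hκ l (hmul l one_pos ?_)
      filter_upwards [h3] with x hx
      rw [hx, hy0]
      exact zero_mem _
    · refine hκ l (hmul l (abs_pos.2 hy0) ?_)
      filter_upwards [h3] with x hx
      rw [hx]
      rcases abs_choice y with h4 | h4 <;> rw [h4]
      · exact AddSubgroup.mem_zmultiples y
      · rw [AddSubgroup.zmultiples_neg]; exact AddSubgroup.mem_zmultiples y
  · rw [lintegral_potential] at hB
    obtain ⟨n, hn⟩ : ∃ n, ∫⁻ x, R.B.indicator (fun _ => R.e) x ∂((R.k ^ n) l) ≠ 0 := by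
      by_contra! h3
      exact hB (by simp [h3])
    obtain ⟨K, hK, hKs⟩ := R.exists_nat_of_missProb hc hκν hTc (fun x hx => hx) hy hd₀ hd
      (by rw [← hΓ, hΓd]; exact AddSubgroup.mem_zmultiples d₀) n l hn
    obtain ⟨j, hj⟩ := (exists_int_iff_mem_zmultiples _ _).2 (hKs 0 hl)
    have hK' : (0 : ℝ) < K := by exact_mod_cast hK
    have hyj : y = -j * (d₀ / K) := by
      have h3 : y * (K * d) = -j * (d₀ * d) := by
        have h4 : (0 - K * (y * d / d₀)) * d₀ = j * d * d₀ := by rw [hj]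
        have h5 : (0 - K * (y * d / d₀)) * d₀ = -(y * (K * d)) := by field_simp; ring
        linarith
      have h6 : y * K = -j * d₀ := by
        have h7 : (y * K) * d = (-j * d₀) * d := by linarith
        exact mul_right_cancel₀ hd.ne' h7
      field_simp
      linarith
    refine hκ l (hmul l (div_pos hd₀ hK') ?_)
    filter_upwards [hTae] with x hx
    have h3 := hTΓ x hx
    rw [hΓd] at h3
    obtain ⟨i, hi⟩ := (exists_int_iff_mem_zmultiples _ _).2 h3
    refine (exists_int_iff_mem_zmultiples _ _).1 ⟨i * K - j, ?_⟩
    have h4 : x = i * d₀ + y := by linarith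
    rw [h4, hyj]
    push_cast
    field_simp
    ring

end Regeneration

end

section

/-! ### Regularly varying tails -/

/-- `V` varies regularly at infinity, with exponent `-α`. -/
def IsRegularlyVarying (V : ℝ → ℝ) (α : ℝ) : Prop :=
  ∀ c, 0 < c → Tendsto (fun t => V (c * t) / V t) atTop (𝓝 (c ^ (-α)))

/-- The uniform convergence theorem for antitone regularly varying functions: monotone functions
converging pointwise to a continuous limit converge locally uniformly. -/
lemma IsRegularlyVarying.tendstoUniformlyOn {V : ℝ → ℝ} {α : ℝ} (h : IsRegularlyVarying V α)
    (hV : Antitone V) (hpos : ∀ t, 0 < t → 0 < V t) {a : ℝ} (ha : 0 < a) (b : ℝ) :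
    TendstoUniformlyOn (fun t c => V (c * t) / V t) (fun c => c ^ (-α)) atTop (Icc a b) := by
  rw [← tendstoLocallyUniformlyOn_iff_tendstoUniformlyOn_of_compact isCompact_Icc,
    Metric.tendstoLocallyUniformlyOn_iff]
  intro ε hε x hx
  have hx0 : 0 < x := ha.trans_le hx.1
  have hcont : ContinuousAt (fun c : ℝ => c ^ (-α)) x :=
    Real.continuousAt_rpow_const x (-α) (Or.inl hx0.ne')
  obtain ⟨δ, hδ, hδε⟩ := Metric.continuousAt_iff.1 hcont (ε / 3) (by positivity)
  simp only [Real.dist_eq] at hδε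
  have h1 : 0 < max (x / 2) (x - δ / 2) := lt_max_of_lt_left (by positivity)
  have h1x : max (x / 2) (x - δ / 2) < x := max_lt (by linarith) (by linarith)
  have h1δ : x - δ / 2 ≤ max (x / 2) (x - δ / 2) := le_max_right _ _
  set c₁ := max (x / 2) (x - δ / 2)
  have h2x : x < x + δ / 2 := by linarith
  set c₂ := x + δ / 2 with hc₂
  refine ⟨Icc c₁ c₂, mem_nhdsWithin_of_mem_nhds (Icc_mem_nhds h1x h2x), ?_⟩
  have e1 := Metric.tendsto_nhds.1 (h c₁ h1) (ε / 3) (by positivity)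
  have e2 := Metric.tendsto_nhds.1 (h c₂ (hx0.trans h2x)) (ε / 3) (by positivity)
  filter_upwards [e1, e2, eventually_gt_atTop 0] with t ht1 ht2 ht y hy
  have hVt := hpos t ht
  rw [Real.dist_eq, abs_lt] at ht1 ht2
  have f1 := abs_lt.1 (hδε (x := c₁) (by rw [abs_lt]; constructor <;> linarith))
  have f2 := abs_lt.1 (hδε (x := c₂) (by rw [abs_lt]; constructor <;> linarith))
  have fy := abs_lt.1 (hδε (x := y) (by rw [abs_lt]; constructor <;> linarith [hy.1, hy.2]))
  have g1 : V (y * t) / V t ≤ V (c₁ * t) / V t := by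
    gcongr
    exact hV (by gcongr; exact hy.1)
  have g2 : V (c₂ * t) / V t ≤ V (y * t) / V t := by
    gcongr
    exact hV (by gcongr; exact hy.2)
  rw [Real.dist_eq, abs_lt]
  constructor <;> linarith

lemma IsRegularlyVarying.exists_abs_sub_le {V : ℝ → ℝ} {α : ℝ} (h : IsRegularlyVarying V α)
    (hV : Antitone V) (hpos : ∀ t, 0 < t → 0 < V t) {a : ℝ} (ha : 0 < a) (b : ℝ) {η : ℝ}
    (hη : 0 < η) :
    ∀ᶠ t in atTop, ∀ c ∈ Icc a b, |V (c * t) - c ^ (-α) * V t| ≤ η * V t := by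
  filter_upwards [Metric.tendstoUniformlyOn_iff.1 (h.tendstoUniformlyOn hV hpos ha b) η hη,
    eventually_gt_atTop 0] with t ht ht0 c hc
  have hVt := hpos t ht0
  have h1 := (ht c hc).le
  rw [dist_comm, Real.dist_eq] at h1
  have h2 : V (c * t) - c ^ (-α) * V t = (V (c * t) / V t - c ^ (-α)) * V t := by
    field_simp
  rw [h2, abs_mul, abs_of_pos hVt]
  gcongr

/-- A regularly varying tail with exponent `> -1` has an infinite mean. -/
lemma IsRegularlyVarying.lintegral_eq_top {ν : Measure ℝ} [IsProbabilityMeasure ν] {α : ℝ}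
    (h : IsRegularlyVarying (fun t => ν.real (Ioi t)) α)
    (hpos : ∀ t, 0 < t → 0 < ν.real (Ioi t)) (hα : α < 1) :
    ∫⁻ x, ENNReal.ofReal x ∂ν = ∞ := by
  by_contra hfin
  set V : ℝ → ℝ := fun t => ν.real (Ioi t)
  -- `t * V t` is at most the mean, but it grows by a factor `q > 1` when `t` is doubled
  have h2 : Tendsto (fun t => 2 * (V (2 * t) / V t)) atTop (𝓝 (2 * 2 ^ (-α))) :=
    (h 2 two_pos).const_mul 2
  have hq : (1 : ℝ) < 2 * 2 ^ (-α) := by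
    have : (2 : ℝ) * 2 ^ (-α) = 2 ^ (1 - α) := by
      rw [sub_eq_add_neg, Real.rpow_add two_pos, Real.rpow_one]
    rw [this]
    exact Real.one_lt_rpow one_lt_two (by linarith)
  obtain ⟨q, hq1, hq2⟩ := exists_between hq
  obtain ⟨t₀, ht₀⟩ := eventually_atTop.1 (h2.eventually (lt_mem_nhds hq2))
  set s := max t₀ 1
  have hs : 0 < s := lt_max_of_lt_right one_pos
  have h3 : ∀ k : ℕ, q ^ k * (s * V s) ≤ 2 ^ k * s * V (2 ^ k * s) := by
    intro k
    induction k with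
    | zero => simp
    | succ k ih =>
      have h4 : 0 < V (2 ^ k * s) := hpos _ (by positivity)
      have h5 := (ht₀ (2 ^ k * s) ((le_max_left _ _).trans
        (le_mul_of_one_le_left hs.le (one_le_pow₀ one_le_two)))).le
      have h6 : q * V (2 ^ k * s) ≤ 2 * V (2 * (2 ^ k * s)) := by
        rw [← mul_div_assoc, le_div_iff₀ h4] at h5
        exact h5
      calc q ^ (k + 1) * (s * V s) = q * (q ^ k * (s * V s)) := by ring
        _ ≤ q * (2 ^ k * s * V (2 ^ k * s)) := by gcongr
        _ = 2 ^ k * s * (q * V (2 ^ k * s)) := by ring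
        _ ≤ 2 ^ k * s * (2 * V (2 * (2 ^ k * s))) := by gcongr
        _ = 2 ^ (k + 1) * s * V (2 ^ (k + 1) * s) := by
          rw [show (2 : ℝ) * (2 ^ k * s) = 2 ^ (k + 1) * s by ring]; ring
  have h4 : ∀ t, 0 < t → t * V t ≤ (∫⁻ x, ENNReal.ofReal x ∂ν).toReal := by
    intro t ht
    have h5 := mul_meas_ge_le_lintegral (μ := ν) ENNReal.measurable_ofReal (ENNReal.ofReal t)
    have h6 : ENNReal.ofReal t * ν (Ioi t) ≤ ∫⁻ x, ENNReal.ofReal x ∂ν := by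
      refine le_trans ?_ h5
      gcongr
      exact fun x hx => ENNReal.ofReal_le_ofReal (le_of_lt hx)
    have h7 := ENNReal.toReal_mono hfin h6
    rwa [ENNReal.toReal_mul, ENNReal.toReal_ofReal ht.le] at h7
  have h5 : Tendsto (fun k : ℕ => q ^ k * (s * V s)) atTop atTop :=
    (tendsto_pow_atTop_atTop_of_one_lt hq1).atTop_mul_const (mul_pos hs (hpos s hs))
  obtain ⟨k, hk⟩ := (h5.eventually_gt_atTop (∫⁻ x, ENNReal.ofReal x ∂ν).toReal).exists
  exact absurd (hk.trans_le ((h3 k).trans (h4 _ (by positivity)))) (lt_irrefl _)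

lemma tendsto_measureReal_Ioi (ν : Measure ℝ) [IsProbabilityMeasure ν] :
    Tendsto (fun t => ν.real (Ioi t)) atTop (𝓝 0) := by
  have h : ∀ t, ν.real (Ioi t) = 1 - cdf ν t := by
    intro t
    rw [cdf_eq_real, ← probReal_compl_eq_one_sub measurableSet_Iic, compl_Iic]
  simp_rw [h]
  simpa using (tendsto_cdf_atTop ν).const_sub 1

lemma antitone_measureReal_Ioi (ν : Measure ℝ) [IsProbabilityMeasure ν] :
    Antitone fun t => ν.real (Ioi t) :=
  fun _ _ h => measureReal_mono (Ioi_subset_Ioi h)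

lemma SlowlyVarying.isRegularlyVarying {L : ℝ → ℝ} (hL : SlowlyVarying L) {ν : Measure ℝ}
    [IsProbabilityMeasure ν] {α : ℝ} (h : ∀ t, 0 < t → 1 - cdf ν t = t ^ (-α) * L t) :
    IsRegularlyVarying (fun t => ν.real (Ioi t)) α ∧ ∀ t, 0 < t → 0 < ν.real (Ioi t) := by
  have h1 : ∀ t, 0 < t → ν.real (Ioi t) = t ^ (-α) * L t := by
    intro t ht
    rw [← h t ht, cdf_eq_real, ← probReal_compl_eq_one_sub measurableSet_Iic, compl_Iic]
  refine ⟨fun c hc => ?_, fun t ht => ?_⟩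
  · have h2 := (hL.2 c hc).const_mul (c ^ (-α))
    rw [mul_one] at h2
    refine h2.congr' ?_
    filter_upwards [eventually_gt_atTop 0] with t ht
    have h3 := hL.1 t ht.le
    have h4 : 0 < t ^ (-α) := Real.rpow_pos_of_pos ht _
    rw [h1 t ht, h1 _ (mul_pos hc ht), Real.mul_rpow hc.le ht.le]
    field_simp
  · rw [h1 t ht]
    exact mul_pos (Real.rpow_pos_of_pos ht _) (hL.1 t ht.le)

/-! ### Waiting times of scaled type -/

lemma cdf_eq_zero_of_neg {μ : Measure ℝ} [IsProbabilityMeasure μ] (h : ∀ᵐ x ∂μ, 0 ≤ x) {t : ℝ}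
    (ht : t < 0) : cdf μ t = 0 := by
  rw [cdf_eq_real, measureReal_def, measure_mono_null (t := {x | ¬ 0 ≤ x}) _ (ae_iff.1 h)]
  · rfl
  · intro x hx
    exact not_le.2 (lt_of_le_of_lt hx ht)

namespace IsScaledType

variable {a b : ℝ} {κ : Kernel (Icc a b) ℝ} {ν : Measure ℝ} {ρ : Measure (Icc a b)}
  [IsProbabilityMeasure ρ]

lemma type_pos (h : IsScaledType κ ν) (l : Icc a b) : 0 < (l : ℝ) := h.pos.trans_le l.2.1

lemma rpow_le (h : IsScaledType κ ν) {α : ℝ} (hα : 0 ≤ α) (l : Icc a b) :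
    (l : ℝ) ^ (-α) ≤ a ^ (-α) :=
  Real.rpow_le_rpow_of_nonpos h.pos l.2.1 (by linarith)

lemma integrable_rpow (h : IsScaledType κ ν) {α : ℝ} (hα : 0 ≤ α) :
    Integrable (fun l : Icc a b => (l : ℝ) ^ (-α)) ρ := by
  refine Integrable.of_bound (Measurable.aestronglyMeasurable (by fun_prop)) (a ^ (-α))
    (Eventually.of_forall fun l => ?_)
  rw [Real.norm_of_nonneg (Real.rpow_nonneg (h.type_pos l).le _)]
  exact h.rpow_le hα l

lemma integral_rpow_pos (h : IsScaledType κ ν) {α : ℝ} (hα : 0 ≤ α) :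
    0 < ∫ l : Icc a b, (l : ℝ) ^ (-α) ∂ρ := by
  rw [integral_pos_iff_support_of_nonneg
    (fun l => Real.rpow_nonneg (h.type_pos l).le _) (h.integrable_rpow hα)]
  have : Function.support (fun l : Icc a b => (l : ℝ) ^ (-α)) = univ :=
    eq_univ_of_forall fun l => (Real.rpow_pos_of_pos (h.type_pos l) _).ne'
  rw [this, measure_univ]
  exact one_pos

variable [IsMarkovKernel κ] [IsProbabilityMeasure ν]

lemma eq_map (h : IsScaledType κ ν) (hκ : BasicAssumptions κ) (l : Icc a b) :
    κ l = ν.map (fun x => x / (l : ℝ)) := by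
  have hl := h.type_pos l
  have : IsProbabilityMeasure (ν.map (fun x => x / (l : ℝ))) :=
    Measure.isProbabilityMeasure_map (by fun_prop)
  refine Measure.eq_of_cdf _ _ ?_
  ext t
  have h1 : cdf (ν.map fun x => x / (l : ℝ)) t = cdf ν (l * t) := by
    rw [cdf_eq_real, cdf_eq_real, map_measureReal_apply (by fun_prop) measurableSet_Iic]
    congr 1
    ext x
    simp [div_le_iff₀ hl, mul_comm]
  rw [h1]
  rcases le_or_gt 0 t with ht | ht
  · exact h.scaled l t ht
  · rw [cdf_eq_zero_of_neg (hκ.nonneg l) ht,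
      cdf_eq_zero_of_neg h.nonneg (mul_neg_of_pos_of_neg hl ht)]

lemma measureReal_Ioi (h : IsScaledType κ ν) (hκ : BasicAssumptions κ) (l : Icc a b) (t : ℝ) :
    (κ l).real (Ioi t) = ν.real (Ioi (l * t)) := by
  rw [h.eq_map hκ, map_measureReal_apply (by fun_prop) measurableSet_Ioi]
  congr 1
  ext x
  simp [lt_div_iff₀ (h.type_pos l), mul_comm]

lemma meanWait_eq (h : IsScaledType κ ν) (hκ : BasicAssumptions κ) (l : Icc a b) :
    meanWait κ l = (∫⁻ x, ENNReal.ofReal x ∂ν) * ENNReal.ofReal (l : ℝ)⁻¹ := by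
  rw [meanWait, h.eq_map hκ, lintegral_map ENNReal.measurable_ofReal (by fun_prop),
    ← lintegral_mul_const _ ENNReal.measurable_ofReal]
  refine lintegral_congr fun x => ?_
  rw [div_eq_mul_inv, ENNReal.ofReal_mul' (inv_nonneg.2 (h.type_pos l).le)]

lemma setLIntegral_meanWait (h : IsScaledType κ ν) (hκ : BasicAssumptions κ)
    (A : Set (Icc a b)) :
    ∫⁻ l in A, meanWait κ l ∂ρ
      = (∫⁻ x, ENNReal.ofReal x ∂ν) * ENNReal.ofReal (∫ l in A, (l : ℝ)⁻¹ ∂ρ) := by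
  have h1 : Integrable (fun l : Icc a b => (l : ℝ)⁻¹) ρ := by
    simpa [Real.rpow_neg_one] using h.integrable_rpow (ρ := ρ) zero_le_one
  simp_rw [h.meanWait_eq hκ]
  rw [lintegral_const_mul _ (by fun_prop), ofReal_integral_eq_lintegral_ofReal h1.integrableOn
    (Eventually.of_forall fun l => inv_nonneg.2 (h.type_pos l).le)]

/-- With `T (t) = ν (t, ∞)` for `t ≥ 0`, the tail of type `l` is `T (l * t)`, which is
asymptotically `l ^ (-α) * T t`. The convolution property is the subexponentiality of regularly
varying tails. -/
lemma isReferenceTail (h : IsScaledType κ ν) (hκ : BasicAssumptions κ) {α : ℝ} (hα : 0 ≤ α)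
    (hreg : IsRegularlyVarying (fun t => ν.real (Ioi t)) α)
    (hpos : ∀ t, 0 < t → 0 < ν.real (Ioi t)) :
    IsReferenceTail κ ((Ici (0 : ℝ)).indicator fun t => ν.real (Ioi t))
      (fun l => (l : ℝ) ^ (-α)) := by
  have hanti := antitone_measureReal_Ioi ν
  have hlim := tendsto_measureReal_Ioi ν
  have hκV := h.measureReal_Ioi hκ
  have hV0 : ∀ t, 0 ≤ ν.real (Ioi t) := fun t => measureReal_nonneg
  have hV1 : ∀ t, ν.real (Ioi t) ≤ 1 := fun t => measureReal_le_one
  set V : ℝ → ℝ := fun t => ν.real (Ioi t) with hV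
  change ∀ (l : Icc a b) t, (κ l).real (Ioi t) = V (l * t) at hκV
  change ∀ t, 0 < t → 0 < V t at hpos
  change ∀ t, 0 ≤ V t at hV0
  change ∀ t, V t ≤ 1 at hV1
  have hVm : Measurable V := hanti.measurable
  have hTV : ∀ t, 0 ≤ t → (Ici (0 : ℝ)).indicator V t = V t :=
    fun t ht => indicator_of_mem ht _
  have hT0 : ∀ t, t < 0 → (Ici (0 : ℝ)).indicator V t = 0 :=
    fun t ht => indicator_of_notMem (not_le.2 ht) _
  have ha := h.pos
  refine
    { measurable := hVm.indicator measurableSet_Ici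
      nonneg := fun t => indicator_nonneg (fun s _ => hV0 s) t
      le_one := fun t => indicator_le' (fun s _ => hV1 s) (fun _ _ => zero_le_one) t
      tendsto := ?_
      measurable_factor := by fun_prop
      bounded_factor := ⟨a ^ (-α), fun l => ?_⟩
      le_survival := ?_
      tail := ?_
      conv := ?_ }
  · refine hlim.congr' ?_
    filter_upwards [eventually_ge_atTop 0] with t ht
    exact (hTV t ht).symm
  · rw [abs_of_nonneg (Real.rpow_nonneg (h.type_pos l).le _)]
    exact h.rpow_le hα l
  · -- `V (B * t)` is at least a multiple of `V t`, for `t ≥ 0`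
    set B := max b 1 with hB
    have hB0 : 0 < B := lt_max_of_lt_right one_pos
    have hq : 0 < B ^ (-α) := Real.rpow_pos_of_pos hB0 _
    obtain ⟨t₀, ht₀⟩ := eventually_atTop.1
      (((hreg B hB0).eventually (lt_mem_nhds (half_lt_self hq))).and (eventually_gt_atTop 0))
    have ht₀0 : 0 < t₀ := (ht₀ t₀ le_rfl).2
    set m := min (B ^ (-α) / 2) (V (B * t₀))
    have hm : 0 < m := lt_min (half_pos hq) (hpos _ (by positivity))
    have hle : ∀ t, 0 ≤ t → m * V t ≤ V (B * t) := by
      intro t ht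
      rcases le_or_gt t₀ t with h1 | h1
      · have h2 := (ht₀ t h1).1.le
        change _ ≤ V (B * t) / V t at h2
        rw [le_div_iff₀ (hpos t (ht₀ t h1).2)] at h2
        exact (mul_le_mul_of_nonneg_right (min_le_left _ _) (hV0 t)).trans h2
      · calc m * V t ≤ m * 1 := by gcongr; exact hV1 t
          _ ≤ V (B * t₀) := by rw [mul_one]; exact min_le_right _ _
          _ ≤ V (B * t) := hanti (by gcongr)
    refine ⟨ENNReal.ofReal m⁻¹, ENNReal.ofReal_ne_top, fun y => ?_⟩
    rcases lt_or_ge y.2 0 with h1 | h1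
    · rw [hT0 _ h1, ENNReal.ofReal_zero]
      exact zero_le
    · have h2 : survival κ univ y = ENNReal.ofReal (V (y.1 * y.2)) := by
        rw [← hκV, survival, indicator_of_mem (show y ∈ univ ×ˢ Ici (0 : ℝ) from ⟨mem_univ _, h1⟩),
          ofReal_measureReal]
      rw [hTV _ h1, h2, ← ENNReal.ofReal_mul (inv_nonneg.2 hm.le)]
      refine ENNReal.ofReal_le_ofReal ?_
      rw [inv_mul_eq_div, le_div_iff₀ hm, mul_comm]
      refine (hle _ h1).trans (hanti ?_)
      gcongr
      exact y.1.2.2.trans (le_max_left _ _)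
  · intro η hη
    obtain ⟨t₀, ht₀⟩ := eventually_atTop.1
      ((hreg.exists_abs_sub_le hanti hpos ha b hη).and (eventually_ge_atTop 0))
    refine ⟨t₀, fun l t ht => ?_⟩
    rw [hκV, hTV t (ht₀ t ht).2]
    exact (ht₀ t ht).1 l l.2
  · intro η hη
    -- jumps below `θ t` and between `(1 - θ) t` and `t` contribute an excess of at most this
    -- multiple of `V t`, apart from the error in the regular variation
    have hcont : Tendsto (fun θ : ℝ => (1 + a ^ (-α)) * ((1 - θ) ^ (-α) - 1)) (𝓝[>] 0) (𝓝 0) := by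
      have h1 : ContinuousAt (fun θ : ℝ => (1 + a ^ (-α)) * ((1 - θ) ^ (-α) - 1)) 0 := by
        refine ContinuousAt.mul continuousAt_const (ContinuousAt.sub ?_ continuousAt_const)
        exact ContinuousAt.rpow_const (by fun_prop) (Or.inl (by norm_num))
      have h2 := h1.tendsto
      simp only [sub_zero, Real.one_rpow, sub_self, mul_zero] at h2
      exact h2.mono_left nhdsWithin_le_nhds
    obtain ⟨θ, hθη, hθ0, hθ2⟩ :=
      ((hcont.eventually (gt_mem_nhds (show 0 < η / 4 by positivity))).and
      (Ioo_mem_nhdsGT (show (0 : ℝ) < 1 / 2 by norm_num))).exists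
    set q := (1 - θ) ^ (-α) with hq
    have hq1 : 1 ≤ q := by
      have := Real.rpow_le_rpow_of_nonpos (x := 1 - θ) (y := 1) (z := -α) (by linarith)
        (by linarith) (by linarith)
      rwa [Real.one_rpow] at this
    have e1 := hreg.exists_abs_sub_le hanti hpos (a := 1 - θ) (by linarith) (1 - θ)
      (show 0 < η / 8 by positivity)
    have e2 := hreg.exists_abs_sub_le hanti hpos (half_pos ha) b (show 0 < η / 8 by positivity)
    -- jumps between `θ t` and `(1 - θ) t`
    have e3 : ∀ᶠ t in atTop, V (θ * t) / V t * V (a * (θ * t)) < η / 8 := by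
      have h1 : Tendsto (fun t => V (a * (θ * t))) atTop (𝓝 0) :=
        hlim.comp (tendsto_id.const_mul_atTop hθ0 |>.const_mul_atTop ha)
      have h2 := (hreg θ hθ0).mul h1
      rw [mul_zero] at h2
      exact h2.eventually (gt_mem_nhds (by positivity))
    have e4 : ∀ᶠ t in atTop, V (a * t) < η := by
      have h1 : Tendsto (fun t => V (a * t)) atTop (𝓝 0) :=
        hlim.comp (tendsto_id.const_mul_atTop ha)
      exact h1.eventually (gt_mem_nhds hη)
    obtain ⟨t₀, ht₀⟩ := eventually_atTop.1
      (e1.and (e2.and (e3.and (e4.and (eventually_gt_atTop 0)))))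
    refine ⟨t₀, fun l t ht => ?_⟩
    obtain ⟨h1, h2, h3, h4, ht0⟩ := ht₀ t ht
    have hl := h.type_pos l
    have hVt := hpos t ht0
    have hTm : Measurable fun x => (Ici (0 : ℝ)).indicator V (t - x) :=
      (hVm.indicator measurableSet_Ici).comp (by fun_prop)
    have hTint : Integrable (fun x => (Ici (0 : ℝ)).indicator V (t - x)) (κ l) := by
      refine Integrable.of_bound hTm.aestronglyMeasurable 1 (Eventually.of_forall fun x => ?_)
      rw [Real.norm_of_nonneg (indicator_nonneg (fun s _ => hV0 s) _)]
      exact indicator_le' (fun s _ => hV1 s) (fun _ _ => zero_le_one) _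
    rw [hTV t ht0.le, abs_le]
    constructor
    · have h5 : ∫ x, (Iic t).indicator (fun _ => V t) x ∂(κ l)
          ≤ ∫ x, (Ici (0 : ℝ)).indicator V (t - x) ∂(κ l) := by
        refine integral_mono_ae ((integrable_const _).indicator measurableSet_Iic) hTint ?_
        filter_upwards [hκ.nonneg l] with x hx
        rcases le_or_gt x t with hxt | hxt
        · rw [indicator_of_mem (show x ∈ Iic t from hxt), hTV (t - x) (by linarith)]
          exact hanti (by linarith)
        · rw [indicator_of_notMem (show x ∉ Iic t from not_le.2 hxt)]
          exact indicator_nonneg (fun s _ => hV0 s) _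
      rw [integral_indicator measurableSet_Iic, setIntegral_const, smul_eq_mul] at h5
      have h6 : (κ l).real (Iic t) = 1 - V (l * t) := by
        rw [← hκV, ← probReal_compl_eq_one_sub measurableSet_Ioi, compl_Ioi]
      have h7 : V (l * t) ≤ η := (hanti (by gcongr; exact l.2.1)).trans h4.le
      rw [h6] at h5
      nlinarith
    · set U : ℝ → ℝ := fun x => V ((1 - θ) * t) + (Ioi (θ * t)).indicator (fun _ => V (θ * t)) x
        + (Ioi ((1 - θ) * t)).indicator (fun _ => 1) x - (Ioi t).indicator (fun _ => 1) x with hU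
      have i2 : Integrable (fun x => (Ioi (θ * t)).indicator (fun _ => V (θ * t)) x) (κ l) :=
        (integrable_const _).indicator measurableSet_Ioi
      have i3 : ∀ s : ℝ, Integrable (fun x => (Ioi s).indicator (fun _ => (1 : ℝ)) x) (κ l) :=
        fun s => (integrable_const _).indicator measurableSet_Ioi
      have i12 : Integrable (fun x => V ((1 - θ) * t) +
          (Ioi (θ * t)).indicator (fun _ => V (θ * t)) x) (κ l) := (integrable_const _).add i2
      have i123 : Integrable (fun x => V ((1 - θ) * t) +
          (Ioi (θ * t)).indicator (fun _ => V (θ * t)) x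
          + (Ioi ((1 - θ) * t)).indicator (fun _ => 1) x) (κ l) := i12.add (i3 _)
      have h5 : ∫ x, (Ici (0 : ℝ)).indicator V (t - x) ∂(κ l) ≤ ∫ x, U x ∂(κ l) := by
        refine integral_mono hTint (i123.sub (i3 _)) fun x => ?_
        simp only [hU]
        have hθt : θ * t ≤ (1 - θ) * t := by nlinarith
        have hθt' : (1 - θ) * t ≤ t := by nlinarith
        rcases le_or_gt x (θ * t) with hx | hx
        · rw [indicator_of_notMem (show x ∉ Ioi (θ * t) from not_lt.2 hx),
            indicator_of_notMem (show x ∉ Ioi ((1 - θ) * t) from not_lt.2 (hx.trans hθt)),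
            indicator_of_notMem (show x ∉ Ioi t from not_lt.2 (show x ≤ t by linarith)),
            hTV (t - x) (by linarith), add_zero, add_zero, sub_zero]
          exact hanti (by linarith)
        rw [indicator_of_mem (show x ∈ Ioi (θ * t) from hx)]
        rcases le_or_gt x ((1 - θ) * t) with hx2 | hx2
        · rw [indicator_of_notMem (show x ∉ Ioi ((1 - θ) * t) from not_lt.2 hx2),
            indicator_of_notMem (show x ∉ Ioi t from not_lt.2 (show x ≤ t by linarith)),
            hTV (t - x) (by linarith), add_zero, sub_zero]
          have h6 : V (t - x) ≤ V (θ * t) := hanti (by linarith)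
          linarith [hV0 ((1 - θ) * t)]
        rw [indicator_of_mem (show x ∈ Ioi ((1 - θ) * t) from hx2)]
        have h6 := hV0 ((1 - θ) * t)
        have h7 := hV0 (θ * t)
        rcases le_or_gt x t with hx3 | hx3
        · rw [indicator_of_notMem (show x ∉ Ioi t from not_lt.2 hx3), hTV (t - x) (by linarith)]
          linarith [hV1 (t - x)]
        · rw [indicator_of_mem (show x ∈ Ioi t from hx3), hT0 (t - x) (by linarith)]
          linarith
      have h6 : ∫ x, U x ∂(κ l) = V ((1 - θ) * t) + V (l * (θ * t)) * V (θ * t)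
          + V (l * ((1 - θ) * t)) - V (l * t) := by
        simp only [hU]
        rw [integral_sub i123 (i3 _), integral_add i12 (i3 _), integral_add (integrable_const _) i2]
        simp only [integral_indicator measurableSet_Ioi, integral_const, smul_eq_mul,
          measureReal_restrict_apply_univ, hκV, probReal_univ, one_mul, mul_one]
      rw [h6] at h5
      have g1 := (abs_le.1 (h1 (1 - θ) ⟨le_rfl, le_rfl⟩)).2
      have g2 := (abs_le.1 (h2 (l * (1 - θ)) ⟨by nlinarith [l.2.1], by nlinarith [l.2.2]⟩)).2
      have g3 := (abs_le.1 (h2 l ⟨by linarith [l.2.1], l.2.2⟩)).1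
      rw [Real.mul_rpow hl.le (by linarith), ← hq, mul_assoc (l : ℝ)] at g2
      rw [← hq] at g1
      have g4 : V (l * (θ * t)) * V (θ * t) ≤ η / 8 * V t := by
        rw [div_mul_eq_mul_div, div_lt_iff₀ hVt] at h3
        have h7 : V (l * (θ * t)) ≤ V (a * (θ * t)) := hanti (by gcongr; exact l.2.1)
        calc V (l * (θ * t)) * V (θ * t) ≤ V (a * (θ * t)) * V (θ * t) := by
              gcongr
          _ ≤ η / 8 * V t := by linarith
      have g5 : (l : ℝ) ^ (-α) * (q - 1) * V t ≤ a ^ (-α) * (q - 1) * V t :=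
        mul_le_mul_of_nonneg_right
          (mul_le_mul_of_nonneg_right (h.rpow_le hα l) (by linarith)) hVt.le
      have g6 : (1 + a ^ (-α)) * (q - 1) * V t ≤ η / 4 * V t := by gcongr
      nlinarith

end IsScaledType

end

end MarkovRenewal

theorem mainTheorem3 {a b : ℝ}
    (g : ProbabilityTheory.Kernel (Set.Icc a b) (Set.Icc a b)) [IsMarkovKernel g]
    (hrec : MarkovRenewal.IsRecurrentHarris g) (hgap : MarkovRenewal.HasSpectralGap g)
    (ρ : Measure (Set.Icc a b)) [IsProbabilityMeasure ρ] (hρ : Kernel.Invariant g ρ)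
    (κ : ProbabilityTheory.Kernel (Set.Icc a b) ℝ) [IsMarkovKernel κ]
    (hκ : MarkovRenewal.BasicAssumptions κ)
    (A : Set (Set.Icc a b)) (hA : MeasurableSet A) (hρA : 0 < ρ A) :
    -- general waiting times, finite stationary mean
    ((∀ l, ¬ MarkovRenewal.IsLattice (κ l)) →
      ∫⁻ l, MarkovRenewal.meanWait κ l ∂ρ < ∞ →
      ∀ l₀, Tendsto (fun t => MarkovRenewal.currentTypeProb g κ t l₀ A) atTop
        (𝓝 ((∫⁻ l in A, MarkovRenewal.meanWait κ l ∂ρ).toReal /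
          (∫⁻ l, MarkovRenewal.meanWait κ l ∂ρ).toReal))) ∧
    -- scaled type
    ∀ (ν : Measure ℝ) [IsProbabilityMeasure ν], MarkovRenewal.IsScaledType κ ν →
      -- finite mean
      (∫⁻ x, ENNReal.ofReal x ∂ν < ∞ →
        ∀ l₀, Tendsto (fun t => MarkovRenewal.currentTypeProb g κ t l₀ A) atTop
          (𝓝 ((∫ l in A, (l : ℝ)⁻¹ ∂ρ) / ∫ l, (l : ℝ)⁻¹ ∂ρ))) ∧
      -- regularly varying tail
      ∀ (α : ℝ) (L : ℝ → ℝ), 0 ≤ α → α ≤ 1 → MarkovRenewal.SlowlyVarying L →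
        (∀ t, 0 < t → 1 - cdf ν t = t ^ (-α) * L t) →
        (∀ l₀, Tendsto (fun t => MarkovRenewal.currentTypeProb g κ t l₀ A) atTop
          (𝓝 ((∫ l in A, (l : ℝ) ^ (-α) ∂ρ) / ∫ l, (l : ℝ) ^ (-α) ∂ρ))) ∧
        (α = 0 →
          ∀ l₀, Tendsto (fun t => MarkovRenewal.currentTypeProb g κ t l₀ A) atTop
            (𝓝 (ρ.real A))) := by
  have key : (∀ R : MarkovRenewal.Regeneration g, IsMarkovKernel (R.cycleKernel κ) →
      ¬ MarkovRenewal.IsArithmetic (R.cycleLaw κ)) → ∀ l₀ : Icc a b,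
      ∃ R : MarkovRenewal.Regeneration g, MarkovRenewal.RenewalSetting R κ ρ := by
    intro h l₀
    obtain ⟨R, hR⟩ := MarkovRenewal.IsRecurrentHarris.exists_regeneration g hrec l₀
    exact ⟨R, hκ, hgap, hρ, hR, h R (R.isMarkovKernel_cycleKernel hgap hρ hR κ)⟩
  have hfinite : ∀ (l₀ : Icc a b) (R : MarkovRenewal.Regeneration g),
      MarkovRenewal.RenewalSetting R κ ρ → ∫⁻ l, MarkovRenewal.meanWait κ l ∂ρ < ∞ →
      Tendsto (fun t => MarkovRenewal.currentTypeProb g κ t l₀ A) atTop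
        (𝓝 ((∫⁻ l in A, MarkovRenewal.meanWait κ l ∂ρ).toReal /
          (∫⁻ l, MarkovRenewal.meanWait κ l ∂ρ).toReal)) := by
    intro l₀ R P hfin
    have h1 := ENNReal.tendsto_ofReal (P.tendsto_avgSurvival hfin.ne hA)
    have h2 : ∀ t, ENNReal.ofReal (MarkovRenewal.avgSurvival R κ A t).toReal =
        MarkovRenewal.avgSurvival R κ A t := fun t =>
      ENNReal.ofReal_toReal (ne_top_of_le_ne_top ENNReal.one_ne_top
        (MarkovRenewal.avgSurvival_le_one hκ R A t))
    simp_rw [h2] at h1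
    have h3 := P.tendsto_currentTypeProb hA h1 l₀
    rwa [ENNReal.toReal_ofReal (by positivity)] at h3
  refine ⟨fun hlat hfin l₀ => ?_, fun ν _ hs => ?_⟩
  · obtain ⟨R, P⟩ := key (fun R _ => R.not_isArithmetic_cycleLaw_of_not_isLattice hlat) l₀
    exact hfinite l₀ R P hfin
  have hset : ∀ l₀ : Icc a b,
      ∃ R : MarkovRenewal.Regeneration g, MarkovRenewal.RenewalSetting R κ ρ :=
    key fun R _ => R.not_isArithmetic_cycleLaw_of_scaled hs.type_pos (hs.eq_map hκ)
      hκ.nonarithmetic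
  have hinv : 0 < ∫ l : Icc a b, (l : ℝ)⁻¹ ∂ρ := by
    simpa [Real.rpow_neg_one] using hs.integral_rpow_pos (ρ := ρ) zero_le_one
  have hmean := fun B => hs.setLIntegral_meanWait hκ (ρ := ρ) B
  have hmean' := hmean univ
  simp only [Measure.restrict_univ] at hmean'
  have hfin : ∫⁻ x, ENNReal.ofReal x ∂ν < ∞ →
      ∀ l₀, Tendsto (fun t => MarkovRenewal.currentTypeProb g κ t l₀ A) atTop
        (𝓝 ((∫ l in A, (l : ℝ)⁻¹ ∂ρ) / ∫ l, (l : ℝ)⁻¹ ∂ρ)) := by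
    intro hν l₀
    obtain ⟨R, P⟩ := hset l₀
    have h1 := hfinite l₀ R P (by
      rw [hmean']; exact ENNReal.mul_lt_top hν ENNReal.ofReal_lt_top)
    have h2 : (∫⁻ x, ENNReal.ofReal x ∂ν) ≠ 0 := by
      intro h0
      have h3 := MarkovRenewal.lintegral_meanWait_pos (ρ := ρ) hκ
      rw [hmean', h0, zero_mul] at h3
      exact lt_irrefl _ h3
    have h3 : 0 ≤ ∫ l in A, (l : ℝ)⁻¹ ∂ρ :=
      integral_nonneg fun l => inv_nonneg.2 (hs.type_pos l).le
    rwa [hmean, hmean', ENNReal.toReal_mul, ENNReal.toReal_mul, ENNReal.toReal_ofReal h3,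
      ENNReal.toReal_ofReal hinv.le,
      mul_div_mul_left _ _ (ENNReal.toReal_pos h2 hν.ne).ne'] at h1
  refine ⟨hfin, fun α L hα0 hα1 hL hF => ?_⟩
  have hlim : ∀ l₀, Tendsto (fun t => MarkovRenewal.currentTypeProb g κ t l₀ A) atTop
      (𝓝 ((∫ l in A, (l : ℝ) ^ (-α) ∂ρ) / ∫ l, (l : ℝ) ^ (-α) ∂ρ)) := by
    obtain ⟨hreg, hpos⟩ := hL.isRegularlyVarying hF
    rcases eq_or_ne (∫⁻ x, ENNReal.ofReal x ∂ν) ∞ with hν | hν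
    · intro l₀
      obtain ⟨R, P⟩ := hset l₀
      refine P.tendsto_currentTypeProb_of_isReferenceTail ?_
        (hs.isReferenceTail hκ hα0 hreg hpos) (hs.integral_rpow_pos hα0) hA l₀
      rw [hmean', hν, ENNReal.top_mul (ENNReal.ofReal_pos.2 hinv).ne']
    · -- a finite mean leaves only the exponent `α = 1`
      obtain rfl : α = 1 :=
        hα1.eq_or_lt.resolve_right fun h => hν (hreg.lintegral_eq_top hpos h)
      simp_rw [Real.rpow_neg_one]
      exact hfin hν.lt_top
  refine ⟨hlim, ?_⟩
  rintro rfl l₀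
  simpa using hlim l₀
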